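/- Let $q$ be a power of an odd prime and let $F_1$ be a field automorphism of the groups $\mathrm{Sp}_{2n}(q)$, that is, the automorphism applying a fixed automorphism $\sigma$ of $\mathbb{F}_q$ to every matrix entry; put $q_1=|\mathbb{F}_q^{F_1}|$, the number of elements of $\mathbb{F}_q$ fixed by $\sigma$. For each $n\ge 1$ let $\delta$ be a non-inner diagonal automorphism of $\mathrm{Sp}_{2n}(q)$, that is, a non-inner automorphism induced by conjugation by an element of the conformal symplectic group $\mathrm{CSp}_{2n}(q)$. Let $c_n(\delta,F_1)$ be the number of conjugacy classes of $\mathrm{Sp}_{2n}(q)$ that are mapped to themselves by $\delta F_1$, and put $c_0(\delta,F_1)=1$ (the number of classes of the trivial group). Then, as formal power series in $t$, $$\sum_{n\ge 0} c_n(\delta,F_1)\,t^n=\prod_{i\ge 1}\frac{(1+t^{2i})^2}{1-q_1t^i}.$$ -/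

import Mathlib

open Matrix
open scoped PowerSeries.WithPiTopology

/-- The conformal symplectic group `CSp_{2n}(F)`: the invertible matrices which preserve the
standard symplectic form up to a nonzero scalar. -/
def conformalSymplecticGroup (n : ℕ) (F : Type*) [Field F] :
    Subgroup (GL (Fin n ⊕ Fin n) F) where
  carrier := {g | ∃ c : Fˣ, g.val * J (Fin n) F * g.valᵀ = (c : F) • J (Fin n) F}
  one_mem' := ⟨1, by simp⟩
  mul_mem' := by
    rintro a b ⟨c, hc⟩ ⟨d, hd⟩
    refine ⟨c * d, ?_⟩
    calc (a * b).val * J (Fin n) F * (a * b).valᵀ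
        = a.val * (b.val * J (Fin n) F * b.valᵀ) * a.valᵀ := by
          simp only [Units.val_mul, transpose_mul, Matrix.mul_assoc]
      _ = ((c * d : Fˣ) : F) • J (Fin n) F := by
          rw [hd, Matrix.mul_smul, Matrix.smul_mul, hc, smul_smul, Units.val_mul, mul_comm]
  inv_mem' := by
    rintro a ⟨c, hc⟩
    refine ⟨c⁻¹, ?_⟩
    have h1 : (a⁻¹).val * a.val = 1 := by rw [← Units.val_mul]; simp
    have h2 : a.valᵀ * (a⁻¹).valᵀ = 1 := by rw [← transpose_mul, h1, transpose_one]
    have h3 : J (Fin n) F = ((c⁻¹ : Fˣ) : F) • (a.val * J (Fin n) F * a.valᵀ) := by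
      rw [hc, smul_smul, ← Units.val_mul]; simp
    calc (a⁻¹).val * J (Fin n) F * (a⁻¹).valᵀ
        = (a⁻¹).val * (((c⁻¹ : Fˣ) : F) • (a.val * J (Fin n) F * a.valᵀ)) * (a⁻¹).valᵀ := by
          rw [← h3]
      _ = ((c⁻¹ : Fˣ) : F) •
            (((a⁻¹).val * a.val) * J (Fin n) F * (a.valᵀ * (a⁻¹).valᵀ)) := by
          simp only [Matrix.mul_smul, Matrix.smul_mul, Matrix.mul_assoc]
      _ = ((c⁻¹ : Fˣ) : F) • J (Fin n) F := by rw [h1, h2]; simp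

/-- An automorphism of `Sp_{2n}(F)` is diagonal if it is the restriction of the conjugation by an
element of `CSp_{2n}(F)`. -/
def IsDiagonalAut {n : ℕ} {F : Type*} [Field F]
    (δ : MulAut (symplecticGroup (Fin n) F)) : Prop :=
  ∃ g ∈ conformalSymplecticGroup n F, ∀ x : symplecticGroup (Fin n) F,
    (δ x : Matrix (Fin n ⊕ Fin n) (Fin n ⊕ Fin n) F) = g.val * x * (g⁻¹).val

/-- An automorphism of a group is inner if it is the conjugation by an element of the group. -/
def IsInnerAut {G : Type*} [Group G] (δ : MulAut G) : Prop :=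
  ∃ h : G, δ = MulAut.conj h

theorem map_mem_symplecticGroup {n : ℕ} {F : Type*} [Field F] (σ : F ≃+* F)
    {x : Matrix (Fin n ⊕ Fin n) (Fin n ⊕ Fin n) F} (hx : x ∈ symplecticGroup (Fin n) F) :
    x.map σ ∈ symplecticGroup (Fin n) F := by
  rw [SymplecticGroup.mem_iff] at hx ⊢
  have h := congrArg (fun m : Matrix (Fin n ⊕ Fin n) (Fin n ⊕ Fin n) F => m.map σ) hx
  simpa only [Matrix.map_mul, ← transpose_map, map_J] using h

/-- The field automorphism of `Sp_{2n}(F)` induced by an automorphism `σ` of `F`: it applies `σ`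
to every matrix entry. -/
def fieldAut (n : ℕ) {F : Type*} [Field F] (σ : F ≃+* F) :
    MulAut (symplecticGroup (Fin n) F) where
  toFun x := ⟨(x : Matrix _ _ F).map σ, map_mem_symplecticGroup σ x.2⟩
  invFun x := ⟨(x : Matrix _ _ F).map σ.symm, map_mem_symplecticGroup σ.symm x.2⟩
  left_inv x := by ext i j; simp
  right_inv x := by ext i j; simp
  map_mul' x y := by
    apply Subtype.ext
    simp [Matrix.map_mul]

/-- The number of conjugacy classes of `G` which the automorphism `φ` maps to themselves. -/
noncomputable def numInvariantClasses {G : Type*} [Group G] (φ : MulAut G) : ℕ :=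
  Nat.card {C : ConjClasses G // C.map φ.toMonoidHom = C}

-- A conjugacy class of the symplectic group is an isometry class of a symplectic space with an
-- isometry `x`. In odd characteristic over a finite field, such a pair is determined by two kinds
-- of invariants. The first is the `F[X]`-module, recorded by monic polynomials `G i`: the product
-- of the irreducible `p` for which `p ^ i` is an elementary divisor, with multiplicity. The second
-- is a pair of signs for each even `i`: the discriminant of the residual symmetric form `b ((x - 1)
-- ^ (i - 1) v) w` on `ker ((x - 1) ^ i)` modulo its radical, and the same for `-x`. The ranks of
-- these forms are the multiplicities of `X - 1` and `X + 1` in `G i`. For odd `i` the residual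
-- forms are alternating; they have even rank and no discriminant.
--
-- A non-inner diagonal automorphism times a field automorphism comes from a `σ`-semilinear
-- bijection multiplying the form by a nonsquare. It applies `σ` to the coefficients of every `G i`
-- and multiplies every discriminant by `(-1)` to the rank. Hence a class is fixed exactly when all
-- `G i` are `σ`-invariant and all residual ranks are even (`isConj_apply_iff`). Every `G i` is
-- self-reciprocal, because `x` and its inverse are adjoint; with even multiplicities at the roots 1
-- and -1 it becomes palindromic of even degree. Conversely all such families occur, with arbitrary
-- signs wherever the corresponding eigenvalue is present (`Admissible.realizes`).
--
-- It remains to count. A `σ`-invariant palindromic monic polynomial of degree `2k` has `k` free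
-- coefficients in the fixed field, which gives `q₁ ^ k` choices. For even `i`, a sign -1 at the
-- root `r` is allowed only if `(X - r) ^ 2` divides `G i`, so summing over the four sign patterns
-- gives the series `(1 + t) ^ 2 / (1 - q₁ t)`; for odd `i` it is `1 / (1 - q₁ t)`. The dimension
-- `2n` is the sum of the `i * deg (G i)`, so one puts `t ^ i` for `t` and multiplies over `i`.
--
-- The classification (`isometric_of_dsc_eq`, `isometric_of_equiv`) separates the eigenvalue -1 by a
-- Fitting decomposition and then inducts on dimension. Where 1 is not an eigenvalue, two invariant
-- forms differ by a self-adjoint operator, which is shown to be a norm. Otherwise the form descends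
-- to `range (x - 1)` with the opposite symmetry, and an isometry there is glued with one of the
-- residual spaces.

universe u

/-! ### The quadratic character of a finite field -/

section QuadraticCharacter

/-- The quadratic character on the nonzero elements of a finite field, with values in `ℤˣ`. -/
noncomputable def qchi {F : Type*} [Field F] (a : F) : ℤˣ :=
  open Classical in if IsSquare a then 1 else -1

variable {F : Type*} [Field F]

theorem qchi_eq_one_iff {a : F} : qchi a = 1 ↔ IsSquare a := by
  unfold qchi; split_ifs with h <;> simp [h]

theorem qchi_congr {F' : Type*} [Field F'] {a : F} {b : F'} (h : IsSquare a ↔ IsSquare b) :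
    qchi a = qchi b := by
  by_cases hb : IsSquare b
  · rw [qchi_eq_one_iff.2 hb, qchi_eq_one_iff.2 (h.2 hb)]
  · simp [qchi, hb, mt h.1 hb]

theorem qchi_one : qchi (1 : F) = 1 := qchi_eq_one_iff.2 IsSquare.one

theorem qchi_mul_sq {a c : F} (hc : c ≠ 0) : qchi (a * c ^ 2) = qchi a := by
  have : IsSquare (a * c ^ 2) ↔ IsSquare a := by
    constructor
    · rintro ⟨d, hd⟩
      refine ⟨d / c, ?_⟩
      field_simp
      rw [hd]; ring
    · rintro ⟨d, rfl⟩
      exact ⟨d * c, by ring⟩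
  exact qchi_congr this

theorem qchi_map (σ : F ≃+* F) (a : F) : qchi (σ a) = qchi a := by
  have : IsSquare (σ a) ↔ IsSquare a := by
    constructor
    · intro h
      have := h.map σ.symm
      simpa using this
    · intro h; exact h.map σ
  exact qchi_congr this

theorem isSquare_mul_of_not [Finite F] {a b : F} (ha : ¬ IsSquare a)
    (hb : ¬ IsSquare b) : IsSquare (a * b) := by
  classical
  have := Fintype.ofFinite F
  have ha0 : a ≠ 0 := by rintro rfl; exact ha IsSquare.zero
  have hb0 : b ≠ 0 := by rintro rfl; exact hb IsSquare.zero
  have h1 : quadraticChar F a = -1 := quadraticChar_neg_one_iff_not_isSquare.2 ha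
  have h2 : quadraticChar F b = -1 := quadraticChar_neg_one_iff_not_isSquare.2 hb
  rw [← quadraticChar_one_iff_isSquare (mul_ne_zero ha0 hb0), map_mul, h1, h2]
  norm_num

theorem qchi_mul [Finite F] {a b : F} (ha : a ≠ 0) (hb : b ≠ 0) :
    qchi (a * b) = qchi a * qchi b := by
  by_cases h1 : IsSquare a
  · obtain ⟨c, rfl⟩ := h1
    have hc : c ≠ 0 := by rintro rfl; simp at ha
    rw [show c * c * b = b * c ^ 2 by ring, qchi_mul_sq hc, qchi_eq_one_iff.2 ⟨c, rfl⟩, one_mul]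
  · by_cases h2 : IsSquare b
    · obtain ⟨c, rfl⟩ := h2
      have hc : c ≠ 0 := by rintro rfl; simp at hb
      rw [show a * (c * c) = a * c ^ 2 by ring, qchi_mul_sq hc,
        qchi_eq_one_iff.2 (⟨c, rfl⟩ : IsSquare (c * c)), mul_one]
    · have := isSquare_mul_of_not h1 h2
      simp [qchi, h1, h2, this]

theorem qchi_pow [Finite F] {a : F} (ha : a ≠ 0) (n : ℕ) : qchi (a ^ n) = qchi a ^ n := by
  induction n with
  | zero => simp [qchi_one]
  | succ n ih => rw [pow_succ, qchi_mul (pow_ne_zero _ ha) ha, ih, pow_succ]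

end QuadraticCharacter

/-! ### Gram matrices, rank and discriminant of possibly degenerate forms -/

section Gram

open Module LinearMap

variable {F : Type*} [Field F] {V V' : Type*} [AddCommGroup V] [Module F V]
  [AddCommGroup V'] [Module F V']

/-- The Gram matrix of a family of vectors. -/
def gramMat (b : V →ₗ[F] V →ₗ[F] F) {ι : Type*} (e : ι → V) : Matrix ι ι F :=
  Matrix.of fun i j => b (e i) (e j)

/-- The rank of a bilinear form. -/
noncomputable def formRank (b : V →ₗ[F] V →ₗ[F] F) : ℕ := finrank F (range b)

theorem vecMul_gramMat (b : V →ₗ[F] V →ₗ[F] F) {ι : Type*} [Fintype ι] (e : ι → V) (g : ι → F)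
    (j : ι) : (g ᵥ* gramMat b e) j = b (∑ i, g i • e i) (e j) := by
  simp [Matrix.vecMul, dotProduct, gramMat, LinearMap.sum_apply]

theorem linearIndependent_of_det_gramMat (b : V →ₗ[F] V →ₗ[F] F) {ι : Type*} [Fintype ι]
    [DecidableEq ι] {e : ι → V} (h : (gramMat b e).det ≠ 0) :
    LinearIndependent F (fun i => b (e i)) := by
  rw [Fintype.linearIndependent_iff]
  intro g hg
  have : g ᵥ* gramMat b e = 0 := by
    funext j
    rw [vecMul_gramMat, map_sum]
    simp only [map_smul]
    rw [hg]; rfl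
  have := Matrix.eq_zero_of_vecMul_eq_zero h this
  intro i; rw [this]; rfl

/-- The discriminant class of a symmetric bilinear form modulo its radical. -/
noncomputable def dsc (b : V →ₗ[F] V →ₗ[F] F) : ℤˣ :=
  open Classical in
  if h : ∃ e : Fin (formRank b) → V, (gramMat b e).det ≠ 0 then qchi (gramMat b h.choose).det else 1

/-- The functionals `b (e i)` are independent and their number is the rank, so they form a basis of
the range of `b`. Hence `e'` is, modulo the radical, a combination of `e` with some matrix `A`, and
the Gram determinant changes by the square of `det A`. -/
theorem qchi_det_gram_eq [FiniteDimensional F V] {b : V →ₗ[F] V →ₗ[F] F}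
    (hb : ∀ v w, b v w = b w v)
    {ι : Type*} [Fintype ι] [DecidableEq ι] {e e' : ι → V} (hι : Fintype.card ι = formRank b)
    (h : (gramMat b e).det ≠ 0) (h' : (gramMat b e').det ≠ 0) :
    qchi (gramMat b e').det = qchi (gramMat b e).det := by
  have hli := linearIndependent_of_det_gramMat b h
  have hspan : Submodule.span F (Set.range fun i => b (e i)) = range b := by
    apply Submodule.eq_of_le_of_finrank_eq
    · rw [Submodule.span_le]
      rintro _ ⟨i, rfl⟩
      exact ⟨e i, rfl⟩
    · rw [finrank_span_eq_card hli, hι]; rfl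
  have hA : ∀ j, ∃ a : ι → F, ∑ i, a i • b (e i) = b (e' j) := fun j => by
    have : b (e' j) ∈ Submodule.span F (Set.range fun i => b (e i)) := by
      rw [hspan]; exact ⟨_, rfl⟩
    exact (Submodule.mem_span_range_iff_exists_fun F).1 this
  choose A hA using hA
  have hA' : ∀ j v, b (e' j) v = ∑ i, A j i * b (e i) v := fun j v => by
    rw [← hA j]; simp [LinearMap.sum_apply]
  have key : gramMat b e' = Matrix.of A * gramMat b e * (Matrix.of A)ᵀ := by
    ext j l
    simp only [gramMat, Matrix.mul_apply, Matrix.of_apply, Matrix.transpose_apply]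
    rw [hA', Finset.sum_congr rfl fun i _ => by rw [hb (e i), hA' l]]
    simp only [Finset.mul_sum, Finset.sum_mul]
    rw [Finset.sum_comm]
    refine Finset.sum_congr rfl fun i _ => Finset.sum_congr rfl fun k _ => ?_
    rw [hb (e i)]
    ring
  have hd : (Matrix.of A).det ≠ 0 := by
    intro h0
    apply h'
    rw [key, Matrix.det_mul, Matrix.det_mul, h0]; simp
  rw [key, Matrix.det_mul, Matrix.det_mul, Matrix.det_transpose,
    show (Matrix.of A).det * (gramMat b e).det * (Matrix.of A).det
      = (gramMat b e).det * (Matrix.of A).det ^ 2 by ring, qchi_mul_sq hd]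

theorem dsc_eq [FiniteDimensional F V] {b : V →ₗ[F] V →ₗ[F] F} (hb : ∀ v w, b v w = b w v)
    {ι : Type*} [Fintype ι] [DecidableEq ι] {e : ι → V} (hι : Fintype.card ι = formRank b)
    (h : (gramMat b e).det ≠ 0) : dsc b = qchi (gramMat b e).det := by
  let u : Fin (formRank b) ≃ ι := (Fintype.equivFinOfCardEq hι).symm
  have hu : gramMat b (e ∘ u) = (gramMat b e).submatrix u u := rfl
  have h1 : (gramMat b (e ∘ u)).det = (gramMat b e).det := by
    rw [hu, Matrix.det_submatrix_equiv_self]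
  have hex : ∃ e : Fin (formRank b) → V, (gramMat b e).det ≠ 0 := ⟨e ∘ u, by rwa [h1]⟩
  rw [dsc, dif_pos hex, ← h1]
  exact qchi_det_gram_eq hb (by simp) (by rwa [h1]) hex.choose_spec

/-- Any basis of a complement of the radical works: a relation between the rows is a vector of the
complement orthogonal to the complement and, by `ε`-symmetry, to the radical; so it lies in both and
vanishes. -/
theorem exists_gram_det_ne_zero [FiniteDimensional F V] {b : V →ₗ[F] V →ₗ[F] F} {ε : F}
    (hb : ∀ v w, b v w = ε * b w v) :
    ∃ e : Fin (formRank b) → V, (gramMat b e).det ≠ 0 := by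
  obtain ⟨C, hC⟩ := Submodule.exists_isCompl (ker b)
  have hdim : finrank F C = formRank b := by
    have h1 := LinearMap.finrank_range_add_finrank_ker b
    have h2 := Submodule.finrank_add_eq_of_isCompl hC
    unfold formRank; omega
  let e := Module.finBasisOfFinrankEq F C hdim
  refine ⟨fun i => (e i : V), fun h0 => ?_⟩
  obtain ⟨v, hv0, hv⟩ := Matrix.exists_vecMul_eq_zero_iff.2 h0
  set c : C := ∑ i, v i • e i with hc
  have hc' : (c : V) = ∑ i, v i • (e i : V) := by simp [hc]
  have hcC : ∀ w : C, b c w = 0 := by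
    have : (b c) ∘ₗ C.subtype = 0 := by
      apply e.ext
      intro j
      have := congrFun hv j
      rw [vecMul_gramMat, ← hc'] at this
      simpa using this
    intro w
    exact LinearMap.congr_fun this w
  have hcker : (c : V) ∈ ker b := by
    rw [LinearMap.mem_ker]
    ext w
    have hw : w ∈ ker b ⊔ C := by rw [hC.sup_eq_top]; trivial
    obtain ⟨k, hk, d, hd, rfl⟩ := Submodule.mem_sup.1 hw
    rw [map_add, hcC ⟨d, hd⟩, hb, LinearMap.mem_ker.1 hk]
    simp
  have hc0 : (c : V) = 0 := by
    have := hC.disjoint.le_bot ⟨hcker, c.2⟩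
    simpa using this
  have hc0' : c = 0 := Subtype.ext hc0
  apply hv0
  have := Fintype.linearIndependent_iff.1 e.linearIndependent v (by rw [← hc, hc0'])
  funext i; exact this i

theorem even_formRank_of_skew [FiniteDimensional F V] (h2 : (2 : F) ≠ 0) {b : V →ₗ[F] V →ₗ[F] F}
    (hb : ∀ v w, b v w = - b w v) : Even (formRank b) := by
  obtain ⟨e, he⟩ := exists_gram_det_ne_zero (ε := -1) (b := b) (by simpa using hb)
  by_contra hodd
  rw [Nat.not_even_iff_odd] at hodd
  have : (gramMat b e)ᵀ = - gramMat b e := by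
    ext i j; simp [gramMat, hb (e j) (e i)]
  have h3 := congrArg Matrix.det this
  rw [Matrix.det_transpose, Matrix.det_neg, Fintype.card_fin, hodd.neg_one_pow] at h3
  apply he
  have : (2 : F) * (gramMat b e).det = 0 := by linear_combination h3
  exact (mul_eq_zero.1 this).resolve_left h2

/-- Only the Gram matrix of the image family matters, so `f` need not be linear. This lets the lemma
serve for subspaces, for semilinear maps and for similitudes alike. -/
theorem dsc_eq_of_map [Finite F] [FiniteDimensional F V] [FiniteDimensional F V']
    {b : V →ₗ[F] V →ₗ[F] F} {b' : V' →ₗ[F] V' →ₗ[F] F}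
    (hb : ∀ v w, b v w = b w v) (hb' : ∀ v w, b' v w = b' w v) (σ : F ≃+* F) {a : F} (ha : a ≠ 0)
    (f : V → V') (hf : ∀ v w, b' (f v) (f w) = a * σ (b v w)) (hr : formRank b = formRank b') :
    dsc b' = qchi a ^ formRank b * dsc b := by
  obtain ⟨e, he⟩ := exists_gram_det_ne_zero (ε := 1) (b := b) (by simpa using hb)
  have h1 : gramMat b' (f ∘ e) = a • (gramMat b e).map σ := by
    ext i j; simp [gramMat, hf]
  have h2 : (gramMat b' (f ∘ e)).det = a ^ formRank b * σ (gramMat b e).det := by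
    rw [h1, Matrix.det_smul, Fintype.card_fin]
    congr 1
    exact (RingHom.map_det σ.toRingHom _).symm
  have h3 : σ (gramMat b e).det ≠ 0 := by simpa using he
  rw [dsc_eq hb (by simp) he, dsc_eq hb' (e := f ∘ e) (by simp [hr])
    (by rw [h2]; exact mul_ne_zero (pow_ne_zero _ ha) h3), h2,
    qchi_mul (pow_ne_zero _ ha) h3, qchi_map, qchi_pow ha]

theorem dsc_eq_one_of_formRank_eq_zero [FiniteDimensional F V] {b : V →ₗ[F] V →ₗ[F] F}
    (hb : ∀ v w, b v w = b w v) (h : formRank b = 0) : dsc b = 1 := by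
  rw [dsc_eq hb (ι := Fin 0) (e := Fin.elim0) (by simp [h]) (by simp)]
  simp [qchi_one]

/-- Here `f` need only be surjective modulo the radical of `b'`. Then `b` is, up to the factor `a`,
the pullback of `b'`, and the transpose of `f` is injective on the range of `b'`. -/
theorem formRank_eq_of_map {b : V →ₗ[F] V →ₗ[F] F}
    {b' : V' →ₗ[F] V' →ₗ[F] F} {ε : F} (hb' : ∀ v w, b' v w = ε * b' w v)
    {a : F} (ha : a ≠ 0) (f : V →ₗ[F] V') (hf : ∀ v w, b' (f v) (f w) = a * b v w)
    (hs : ∀ v', ∃ v, b' (f v) = b' v') : formRank b = formRank b' := by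
  have h1 : range (b' ∘ₗ f) = range b' := by
    ext φ
    constructor
    · rintro ⟨v, rfl⟩; exact ⟨f v, rfl⟩
    · rintro ⟨v', rfl⟩
      obtain ⟨v, hv⟩ := hs v'
      exact ⟨v, hv⟩
  have h2 : a • b = (Module.Dual.transpose f) ∘ₗ (b' ∘ₗ f) := by
    ext v w
    exact (hf v w).symm
  have h3 : range (a • b) = range b := LinearMap.range_smul b a ha
  have h4 : range b = (range b').map (Module.Dual.transpose f) := by
    rw [← h3, h2, LinearMap.range_comp, h1]
  unfold formRank
  rw [h4]
  let T : range b' →ₗ[F] Module.Dual F V := (Module.Dual.transpose f).domRestrict (range b')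
  have hT : range T = (range b').map (Module.Dual.transpose f) := by
    simp [T, LinearMap.domRestrict, LinearMap.range_comp]
  rw [← hT]
  apply LinearMap.finrank_range_of_inj
  rw [injective_iff_map_eq_zero]
  rintro ⟨_, u, rfl⟩ h
  apply Subtype.ext
  ext w
  obtain ⟨v, hv⟩ := hs w
  have h5 : b' u (f v) = 0 := LinearMap.congr_fun h v
  have h6 : ε * b' (f v) u = 0 := by rw [← hb', h5]
  have h7 : b' u w = 0 := by rw [hb', ← hv]; exact h6
  exact h7

/-- The orthogonal sum of two bilinear forms. -/
def orthSum (b : V →ₗ[F] V →ₗ[F] F) (b' : V' →ₗ[F] V' →ₗ[F] F) :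
    V × V' →ₗ[F] V × V' →ₗ[F] F :=
  b.compl₁₂ (LinearMap.fst F V V') (LinearMap.fst F V V') +
    b'.compl₁₂ (LinearMap.snd F V V') (LinearMap.snd F V V')

@[simp] theorem orthSum_apply (b : V →ₗ[F] V →ₗ[F] F) (b' : V' →ₗ[F] V' →ₗ[F] F) (v w : V × V') :
    orthSum b b' v w = b v.1 w.1 + b' v.2 w.2 := rfl

theorem formRank_orthSum [FiniteDimensional F V] [FiniteDimensional F V']
    (b : V →ₗ[F] V →ₗ[F] F) (b' : V' →ₗ[F] V' →ₗ[F] F) :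
    formRank (orthSum b b') = formRank b + formRank b' := by
  have hk : ker (orthSum b b') = (ker b).prod (ker b') := by
    ext ⟨v, v'⟩
    simp only [LinearMap.mem_ker, Submodule.mem_prod]
    constructor
    · intro h
      constructor
      · ext w; simpa using LinearMap.congr_fun h (w, 0)
      · ext w; simpa using LinearMap.congr_fun h (0, w)
    · rintro ⟨h1, h2⟩
      apply LinearMap.ext
      intro w
      simp [h1, h2]
  have h1 := LinearMap.finrank_range_add_finrank_ker (orthSum b b')
  have h2 := LinearMap.finrank_range_add_finrank_ker b
  have h3 := LinearMap.finrank_range_add_finrank_ker b'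
  have h4 : finrank F ((ker b).prod (ker b')) = finrank F (ker b) + finrank F (ker b') := by
    rw [← Module.finrank_prod]
    refine LinearEquiv.finrank_eq
      { toFun := fun u => (⟨u.1.1, u.2.1⟩, ⟨u.1.2, u.2.2⟩)
        invFun := fun u => ⟨(u.1.1, u.2.1), ⟨u.1.2, u.2.2⟩⟩
        map_add' := fun _ _ => rfl
        map_smul' := fun _ _ => rfl
        left_inv := fun _ => rfl
        right_inv := fun _ => rfl }
  rw [hk, h4, Module.finrank_prod] at h1
  unfold formRank
  omega

theorem dsc_orthSum [Finite F] [FiniteDimensional F V] [FiniteDimensional F V']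
    {b : V →ₗ[F] V →ₗ[F] F} {b' : V' →ₗ[F] V' →ₗ[F] F}
    (hb : ∀ v w, b v w = b w v) (hb' : ∀ v w, b' v w = b' w v) :
    dsc (orthSum b b') = dsc b * dsc b' := by
  obtain ⟨e, he⟩ := exists_gram_det_ne_zero (ε := 1) (b := b) (by simpa using hb)
  obtain ⟨e', he'⟩ := exists_gram_det_ne_zero (ε := 1) (b := b') (by simpa using hb')
  let E : Fin (formRank b) ⊕ Fin (formRank b') → V × V' :=
    Sum.elim (fun i => (e i, 0)) (fun i => (0, e' i))
  have hE : gramMat (orthSum b b') E = Matrix.fromBlocks (gramMat b e) 0 0 (gramMat b' e') := by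
    ext i j
    rcases i with i | i <;> rcases j with j | j <;> simp [gramMat, E]
  have hd : (gramMat (orthSum b b') E).det = (gramMat b e).det * (gramMat b' e').det := by
    rw [hE, Matrix.det_fromBlocks_zero₂₁]
  rw [dsc_eq (b := orthSum b b') (e := E) (fun v w => by simp [hb v.1, hb' v.2])
    (by simp [formRank_orthSum]) (by rw [hd]; exact mul_ne_zero he he'), hd, qchi_mul he he',
    dsc_eq hb (by simp) he, dsc_eq hb' (by simp) he']

end Gram

/-! ### Isometries and the classification of forms without operator -/

section Isometry

open Module LinearMap

variable {F : Type*} [Field F] {V V' V'' : Type u} [AddCommGroup V] [Module F V]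
  [AddCommGroup V'] [Module F V'] [AddCommGroup V''] [Module F V'']

/-- `b` is a nondegenerate form with `b v w = ε * b w v`. -/
structure IsForm (ε : F) (b : V →ₗ[F] V →ₗ[F] F) : Prop where
  symm : ∀ v w, b v w = ε * b w v
  nondeg : ∀ v, (∀ w, b v w = 0) → v = 0

/-- Two spaces with a bilinear form and an endomorphism are isomorphic. -/
def Isometric (b : V →ₗ[F] V →ₗ[F] F) (x : End F V) (b' : V' →ₗ[F] V' →ₗ[F] F) (x' : End F V') :
    Prop :=
  ∃ θ : V ≃ₗ[F] V', (∀ v, θ (x v) = x' (θ v)) ∧ ∀ v w, b' (θ v) (θ w) = b v w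

theorem Isometric.symm {b : V →ₗ[F] V →ₗ[F] F} {x : End F V} {b' : V' →ₗ[F] V' →ₗ[F] F}
    {x' : End F V'} (h : Isometric b x b' x') : Isometric b' x' b x := by
  obtain ⟨θ, h1, h2⟩ := h
  refine ⟨θ.symm, fun v => ?_, fun v w => ?_⟩
  · apply θ.injective; rw [h1]; simp
  · rw [← h2]; simp

theorem Isometric.trans {b : V →ₗ[F] V →ₗ[F] F} {x : End F V} {b' : V' →ₗ[F] V' →ₗ[F] F}
    {x' : End F V'} {b'' : V'' →ₗ[F] V'' →ₗ[F] F} {x'' : End F V''}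
    (h : Isometric b x b' x') (h' : Isometric b' x' b'' x'') : Isometric b x b'' x'' := by
  obtain ⟨θ, h1, h2⟩ := h
  obtain ⟨θ', h1', h2'⟩ := h'
  exact ⟨θ.trans θ', fun v => by simp [h1, h1'], fun v w => by simp [h2, h2']⟩

theorem Isometric.orthSum {V₁ V₁' : Type u} [AddCommGroup V₁] [Module F V₁] [AddCommGroup V₁']
    [Module F V₁'] {b : V →ₗ[F] V →ₗ[F] F} {x : End F V} {b' : V' →ₗ[F] V' →ₗ[F] F}
    {x' : End F V'} {b₁ : V₁ →ₗ[F] V₁ →ₗ[F] F} {x₁ : End F V₁} {b₁' : V₁' →ₗ[F] V₁' →ₗ[F] F}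
    {x₁' : End F V₁'} (h : Isometric b x b' x') (h₁ : Isometric b₁ x₁ b₁' x₁') :
    Isometric (_root_.orthSum b b₁) (x.prodMap x₁) (_root_.orthSum b' b₁') (x'.prodMap x₁') := by
  obtain ⟨θ, h1, h2⟩ := h
  obtain ⟨θ', h1', h2'⟩ := h₁
  exact ⟨θ.prodCongr θ', fun v => by simp [h1, h1'], fun v w => by simp [h2, h2']⟩

theorem IsForm.formRank_eq [FiniteDimensional F V] {ε : F} {b : V →ₗ[F] V →ₗ[F] F}
    (hb : IsForm ε b) : formRank b = finrank F V := by
  apply LinearMap.finrank_range_of_inj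
  rw [injective_iff_map_eq_zero]
  intro v hv
  exact hb.nondeg v fun w => by rw [hv]; rfl

/-- Every functional is represented by a nondegenerate form. -/
theorem IsForm.exists_eq [FiniteDimensional F V] {ε : F} {b : V →ₗ[F] V →ₗ[F] F}
    (hb : IsForm ε b) (φ : Dual F V) : ∃ v, b v = φ := by
  have hinj : Function.Injective b := by
    rw [injective_iff_map_eq_zero]
    intro v hv
    exact hb.nondeg v fun w => by rw [hv]; rfl
  exact (LinearMap.injective_iff_surjective_of_finrank_eq_finrank
    (Subspace.dual_finrank_eq (K := F) (V := V)).symm).1 hinj φ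

/-- The restriction of a bilinear form to a subspace. -/
def restr (b : V →ₗ[F] V →ₗ[F] F) (W : Submodule F V) : W →ₗ[F] W →ₗ[F] F :=
  b.domRestrict₁₂ W W

@[simp] theorem restr_apply (b : V →ₗ[F] V →ₗ[F] F) (W : Submodule F V) (v w : W) :
    restr b W v w = b v w := rfl

theorem isometric_of_isCompl {b : V →ₗ[F] V →ₗ[F] F} {x : End F V} {W U : Submodule F V}
    (h : IsCompl W U) (hW : ∀ v ∈ W, x v ∈ W) (hU : ∀ v ∈ U, x v ∈ U)
    (h1 : ∀ w ∈ W, ∀ u ∈ U, b w u = 0) (h2 : ∀ w ∈ W, ∀ u ∈ U, b u w = 0) :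
    Isometric (orthSum (restr b W) (restr b U)) ((x.restrict hW).prodMap (x.restrict hU)) b x := by
  refine ⟨Submodule.prodEquivOfIsCompl W U h, fun v => ?_, fun v w => ?_⟩
  · simp
  · simp [h1 _ v.1.2 _ w.2.2, h2 _ w.1.2 _ v.2.2]

theorem isForm_restr_of_isCompl {ε : F} {b : V →ₗ[F] V →ₗ[F] F} (hb : IsForm ε b)
    {W U : Submodule F V} (h : IsCompl W U) (h1 : ∀ w ∈ W, ∀ u ∈ U, b w u = 0) :
    IsForm ε (restr b W) := by
  refine ⟨fun v w => hb.symm _ _, fun v hv => Subtype.ext (hb.nondeg _ fun w => ?_)⟩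
  have hw : w ∈ W ⊔ U := by rw [h.sup_eq_top]; trivial
  obtain ⟨k, hk, d, hd, rfl⟩ := Submodule.mem_sup.1 hw
  rw [map_add, h1 _ v.2 _ hd, add_zero]
  exact hv ⟨k, hk⟩

/-- The vectors orthogonal to a family. -/
def orthFamily (b : V →ₗ[F] V →ₗ[F] F) {ι : Type*} (e : ι → V) : Submodule F V :=
  ⨅ i, ker (b (e i))

theorem mem_orthFamily {b : V →ₗ[F] V →ₗ[F] F} {ι : Type*} {e : ι → V} {v : V} :
    v ∈ orthFamily b e ↔ ∀ i, b (e i) v = 0 := by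
  simp [orthFamily, Submodule.mem_iInf]

theorem isCompl_span_orthFamily {ε : F} {b : V →ₗ[F] V →ₗ[F] F}
    (hb : ∀ v w, b v w = ε * b w v) {ι : Type*} [Fintype ι] [DecidableEq ι] {e : ι → V}
    (he : (gramMat b e).det ≠ 0) : IsCompl (Submodule.span F (Set.range e)) (orthFamily b e) := by
  constructor
  · rw [Submodule.disjoint_def]
    intro v hv hv'
    obtain ⟨c, rfl⟩ := (Submodule.mem_span_range_iff_exists_fun F).1 hv
    have : c ᵥ* gramMat b e = 0 := by
      funext j
      rw [vecMul_gramMat, hb, mem_orthFamily.1 hv' j]; simp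
    rw [Matrix.eq_zero_of_vecMul_eq_zero he this]; simp
  · rw [codisjoint_iff, eq_top_iff]
    intro v _
    have hu : IsUnit (gramMat b e).det := isUnit_iff_ne_zero.2 he
    -- The coordinates of the orthogonal projection of `v` to the span of `e`.
    set c := (gramMat b e)⁻¹ *ᵥ (fun j => b (e j) v) with hc
    have hc' : gramMat b e *ᵥ c = fun j => b (e j) v := by
      rw [hc, Matrix.mulVec_mulVec, Matrix.mul_nonsing_inv _ hu, Matrix.one_mulVec]
    refine Submodule.mem_sup.2 ⟨∑ i, c i • e i,
      (Submodule.mem_span_range_iff_exists_fun F).2 ⟨c, rfl⟩, v - ∑ i, c i • e i, ?_, by abel⟩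
    rw [mem_orthFamily]
    intro j
    have := congrFun hc' j
    simp only [Matrix.mulVec, dotProduct, gramMat, Matrix.of_apply] at this
    rw [map_sub, ← this, map_sum]
    simp [mul_comm]

theorem span_orthFamily {b : V →ₗ[F] V →ₗ[F] F} {ι : Type*} {e : ι → V} :
    ∀ w ∈ Submodule.span F (Set.range e), ∀ u ∈ orthFamily b e, b w u = 0 := by
  intro w hw u hu
  have : Submodule.span F (Set.range e) ≤ ker (b.flip u) := by
    rw [Submodule.span_le]
    rintro _ ⟨i, rfl⟩
    exact mem_orthFamily.1 hu i
  exact this hw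

theorem linearIndependent_of_det_gramMat' (b : V →ₗ[F] V →ₗ[F] F) {ι : Type*} [Fintype ι]
    [DecidableEq ι] {e : ι → V} (h : (gramMat b e).det ≠ 0) : LinearIndependent F e :=
  LinearIndependent.of_comp b (linearIndependent_of_det_gramMat b h)

theorem isometric_one_of_gramMat_eq {b : V →ₗ[F] V →ₗ[F] F} {b' : V' →ₗ[F] V' →ₗ[F] F}
    {ι : Type*} [Fintype ι] [DecidableEq ι] (e : Basis ι F V) (e' : Basis ι F V')
    (h : gramMat b e = gramMat b' e') : Isometric b 1 b' 1 := by
  refine ⟨e.equiv e' (Equiv.refl _), fun v => rfl, ?_⟩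
  have : b'.compl₁₂ (e.equiv e' (Equiv.refl _)).toLinearMap (e.equiv e' (Equiv.refl _)).toLinearMap
      = b := by
    refine e.ext fun i => e.ext fun j => ?_
    simpa [gramMat] using (congrFun (congrFun h i) j).symm
  intro v w
  exact LinearMap.congr_fun (LinearMap.congr_fun this v) w

/-- The inductive step for both classifications below: families with equal invertible Gram matrix
span isometric orthogonal summands, so only the orthogonal complements remain to be compared. -/
theorem isometric_one_of_orthFamily {ε : F} {b : V →ₗ[F] V →ₗ[F] F} {b' : V' →ₗ[F] V' →ₗ[F] F}
    (hb : ∀ v w, b v w = ε * b w v) (hb' : ∀ v w, b' v w = ε * b' w v)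
    {ι : Type*} [Fintype ι] [DecidableEq ι] {e : ι → V} {e' : ι → V'}
    (he : (gramMat b e).det ≠ 0) (h : gramMat b e = gramMat b' e')
    (hU : Isometric (restr b (orthFamily b e)) 1 (restr b' (orthFamily b' e')) 1) :
    Isometric b 1 b' 1 := by
  have he' : (gramMat b' e').det ≠ 0 := by rwa [← h]
  have key : ∀ {V : Type u} [AddCommGroup V] [Module F V] {b : V →ₗ[F] V →ₗ[F] F}
    (_ : ∀ v w, b v w = ε * b w v) {e : ι → V} (_ : (gramMat b e).det ≠ 0),
      Isometric (orthSum (restr b (Submodule.span F (Set.range e))) (restr b (orthFamily b e)))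
        (LinearMap.prodMap 1 1) b 1 := by
    intro V _ _ b hb e he
    exact isometric_of_isCompl (x := 1) (isCompl_span_orthFamily hb he) (fun _ h => h)
      (fun _ h => h) span_orthFamily
      (fun w hw u hu => by rw [hb, span_orthFamily w hw u hu, mul_zero])
  refine (key hb he).symm.trans (Isometric.trans (Isometric.orthSum ?_ hU) (key hb' he'))
  refine isometric_one_of_gramMat_eq (Basis.span (linearIndependent_of_det_gramMat' b he))
    (Basis.span (linearIndependent_of_det_gramMat' b' he')) ?_
  ext i j
  have := congrFun (congrFun h i) j
  simpa [gramMat, Basis.span_apply] using this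

theorem isForm_restr_orthFamily {ε : F} {b : V →ₗ[F] V →ₗ[F] F} (hb : IsForm ε b)
    {ι : Type*} [Fintype ι] [DecidableEq ι] {e : ι → V} (he : (gramMat b e).det ≠ 0) :
    IsForm ε (restr b (orthFamily b e)) :=
  isForm_restr_of_isCompl hb (isCompl_span_orthFamily hb.symm he).symm
    (fun w hw u hu => by rw [hb.symm, span_orthFamily u hu w hw, mul_zero])

theorem finrank_orthFamily [FiniteDimensional F V] {ε : F} {b : V →ₗ[F] V →ₗ[F] F}
    (hb : IsForm ε b) {ι : Type*} [Fintype ι] [DecidableEq ι] {e : ι → V}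
    (he : (gramMat b e).det ≠ 0) :
    Fintype.card ι + finrank F (orthFamily b e) = finrank F V := by
  rw [← Submodule.finrank_add_eq_of_isCompl (isCompl_span_orthFamily hb.symm he),
    finrank_span_eq_card (linearIndependent_of_det_gramMat' b he)]

/-- Nondegenerate alternating forms of equal dimension are isometric. -/
theorem isometric_one_of_alternating (h2 : (2 : F) ≠ 0) : ∀ (n : ℕ) {V V' : Type u}
    [AddCommGroup V] [Module F V] [AddCommGroup V'] [Module F V'] [FiniteDimensional F V]
    [FiniteDimensional F V'] {b : V →ₗ[F] V →ₗ[F] F} {b' : V' →ₗ[F] V' →ₗ[F] F}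
    (_ : IsForm (-1) b) (_ : IsForm (-1) b') (_ : finrank F V = n) (_ : finrank F V' = n),
    Isometric b 1 b' 1 := by
  intro n
  induction n using Nat.strong_induction_on with
  | _ n ih =>
    intro V V' _ _ _ _ _ _ b b' hb hb' hn hn'
    rcases Nat.eq_zero_or_pos n with rfl | hpos
    · have := finrank_zero_iff.1 hn
      have := finrank_zero_iff.1 hn'
      exact ⟨0, fun v => Subsingleton.elim _ _, fun v w => by
        rw [Subsingleton.elim v 0]; simp⟩
    -- A hyperbolic plane splits off.
    · have key : ∀ {V : Type u} [AddCommGroup V] [Module F V] [FiniteDimensional F V]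
          {b : V →ₗ[F] V →ₗ[F] F} (_ : IsForm (-1) b) (_ : finrank F V = n),
          ∃ e : Fin 2 → V, gramMat b e = !![0, 1; -1, 0] := by
        intro V _ _ _ b hb hn
        have : Nontrivial V := nontrivial_of_finrank_pos (R := F) (by omega)
        obtain ⟨v, hv⟩ := exists_ne (0 : V)
        have : ∃ w, b v w ≠ 0 := by
          by_contra hcon
          push Not at hcon
          exact hv (hb.nondeg v hcon)
        obtain ⟨w, hw⟩ := this
        have hself : ∀ u, b u u = 0 := fun u => by
          have := hb.symm u u
          have h3 : (2 : F) * b u u = 0 := by linear_combination this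
          exact (mul_eq_zero.1 h3).resolve_left h2
        refine ⟨![v, (b v w)⁻¹ • w], ?_⟩
        ext i j
        fin_cases i <;> fin_cases j <;> simp [gramMat, hself, hw]
        rw [hb.symm w v]; field_simp
      obtain ⟨e, he⟩ := key hb hn
      obtain ⟨e', he'⟩ := key hb' hn'
      have hd : (gramMat b e).det ≠ 0 := by rw [he, Matrix.det_fin_two]; simp
      have hd' : (gramMat b' e').det ≠ 0 := by rw [he', Matrix.det_fin_two]; simp
      have hf := finrank_orthFamily hb hd
      have hf' := finrank_orthFamily hb' hd'
      simp only [Fintype.card_fin] at hf hf'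
      refine isometric_one_of_orthFamily hb.symm hb'.symm hd (he.trans he'.symm)
        (ih (n - 2) (by omega) (isForm_restr_orthFamily hb hd) (isForm_restr_orthFamily hb' hd')
          (by omega) (by omega))

theorem dsc_congr [Finite F] [FiniteDimensional F V] [FiniteDimensional F V']
    {b : V →ₗ[F] V →ₗ[F] F} {x : End F V} {b' : V' →ₗ[F] V' →ₗ[F] F} {x' : End F V'}
    (hb : ∀ v w, b v w = b w v) (h : Isometric b x b' x') : dsc b = dsc b' := by
  obtain ⟨θ, -, hθ⟩ := h
  have hb' : ∀ v w, b' v w = b' w v := fun v w => by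
    have := hθ (θ.symm v) (θ.symm w)
    have h2 := hθ (θ.symm w) (θ.symm v)
    simp only [LinearEquiv.apply_symm_apply] at this h2
    rw [this, h2, hb]
  have hr : formRank b = formRank b' :=
    formRank_eq_of_map (ε := 1) (by simpa using hb') one_ne_zero θ.toLinearMap
      (by simpa using hθ) (fun v' => ⟨θ.symm v', by simp⟩)
  rw [dsc_eq_of_map hb hb' (RingEquiv.refl F) one_ne_zero θ (by simpa using hθ) hr, qchi_one]
  simp

/-- A nondegenerate diagonal binary form over a finite field is universal: in characteristic 2 every
element is a square, in odd characteristic the values of two quadratic polynomials must meet. -/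
theorem exists_mul_sq_add_mul_sq [Finite F] {a c : F} (ha : a ≠ 0)
    (hc : c ≠ 0) (t : F) : ∃ u v : F, a * u ^ 2 + c * v ^ 2 = t := by
  classical
  have := Fintype.ofFinite F
  by_cases hF : ringChar F = 2
  · obtain ⟨u, hu⟩ := FiniteField.isSquare_of_char_two hF (t / a)
    refine ⟨u, 0, ?_⟩
    rw [pow_two, ← hu]; field_simp; simp
  · have hodd : Fintype.card F % 2 = 1 := FiniteField.odd_card_of_char_ne_two hF
    open Polynomial in
    have hf : (C a * X ^ 2 : F[X]).degree = 2 := by simpa using degree_C_mul_X_pow 2 ha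
    open Polynomial in
    have hg : (C c * X ^ 2 - C t : F[X]).degree = 2 := by
      rw [degree_sub_eq_left_of_degree_lt]
      · simpa using degree_C_mul_X_pow 2 hc
      · rw [show (C c * X ^ 2 : F[X]).degree = 2 by simpa using degree_C_mul_X_pow 2 hc]
        exact lt_of_le_of_lt degree_C_le (by norm_num)
    obtain ⟨u, v, huv⟩ := FiniteField.exists_root_sum_quadratic hf hg hodd
    refine ⟨u, v, ?_⟩
    simp at huv
    linear_combination huv

/-- Nondegenerate symmetric forms over a finite field of odd characteristic with equal dimension
and discriminant are isometric. -/
theorem isometric_one_of_symmetric [Finite F] (h2 : (2 : F) ≠ 0) : ∀ (n : ℕ) {V V' : Type u}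
    [AddCommGroup V] [Module F V] [AddCommGroup V'] [Module F V'] [FiniteDimensional F V]
    [FiniteDimensional F V'] {b : V →ₗ[F] V →ₗ[F] F} {b' : V' →ₗ[F] V' →ₗ[F] F}
    (_ : IsForm 1 b) (_ : IsForm 1 b') (_ : finrank F V = n) (_ : finrank F V' = n)
    (_ : dsc b = dsc b'), Isometric b 1 b' 1 := by
  intro n
  induction n with
  | zero =>
    intro V V' _ _ _ _ _ _ b b' hb hb' hn hn' _
    have := finrank_zero_iff.1 hn
    have := finrank_zero_iff.1 hn'
    exact ⟨0, fun v => Subsingleton.elim _ _, fun v w => by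
      rw [Subsingleton.elim v 0]; simp⟩
  | succ n ih =>
    intro V V' _ _ _ _ _ _ b b' hb hb' hn hn' hd
    have : Invertible (2 : F) := invertibleOfNonzero h2
    have horth : ∀ {V : Type u} [AddCommGroup V] [Module F V] [FiniteDimensional F V]
        {b : V →ₗ[F] V →ₗ[F] F} (_ : IsForm 1 b) (_ : finrank F V = n + 1),
        ∃ e : Basis (Fin (n + 1)) F V, (∀ i j, i ≠ j → b (e i) (e j) = 0) ∧
          ∀ i, b (e i) (e i) ≠ 0 := by
      intro V _ _ _ b hb hn
      obtain ⟨v, hv⟩ := LinearMap.BilinForm.exists_orthogonal_basis (B := b)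
        ⟨fun x y => by simpa using hb.symm x y⟩
      let e : Basis (Fin (n + 1)) F V := v.reindex (finCongr hn)
      have he : ∀ i j, i ≠ j → b (e i) (e j) = 0 := by
        intro i j hij
        simp only [e, Basis.reindex_apply]
        exact hv (fun h => hij (by simpa using h))
      refine ⟨e, he, fun i hi => ?_⟩
      refine e.ne_zero i (hb.nondeg _ fun w => ?_)
      have : b (e i) = 0 := by
        refine e.ext fun j => ?_
        by_cases hij : i = j
        · subst hij; simpa using hi
        · simpa using he i j hij
      rw [this]; rfl
    rcases Nat.eq_zero_or_pos n with rfl | hpos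
    · obtain ⟨e, -, he⟩ := horth hb hn
      obtain ⟨e', -, he'⟩ := horth hb' hn'
      have hdet : (gramMat b e).det = b (e 0) (e 0) := by simp [gramMat]
      have hdet' : (gramMat b' e').det = b' (e' 0) (e' 0) := by simp [gramMat]
      rw [dsc_eq (by simpa using hb.symm) (e := e) (by simp [hb.formRank_eq, hn])
          (by rw [hdet]; exact he 0),
        dsc_eq (by simpa using hb'.symm) (e := e') (by simp [hb'.formRank_eq, hn'])
          (by rw [hdet']; exact he' 0), hdet, hdet'] at hd
      have hsq : IsSquare (b (e 0) (e 0) * b' (e' 0) (e' 0)) := by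
        rw [← qchi_eq_one_iff, qchi_mul (he 0) (he' 0), hd, Int.units_mul_self]
      obtain ⟨r, hr⟩ := hsq
      set a := b (e 0) (e 0)
      set a' := b' (e' 0) (e' 0) with ha'
      have hr0 : r ≠ 0 := by
        rintro rfl
        exact mul_ne_zero (he 0) (he' 0) (by simpa using hr)
      -- Since `a * a' = r ^ 2`, the vector `(r / a') • e' 0` has norm `r ^ 2 / a' = a`.
      have hu : ∀ i : Fin 1, IsUnit (r / a') := fun _ =>
        isUnit_iff_ne_zero.2 (div_ne_zero hr0 (he' 0))
      refine isometric_one_of_gramMat_eq e (e'.isUnitSMul hu) ?_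
      ext i j
      fin_cases i; fin_cases j
      have : a' ≠ 0 := he' 0
      simp [gramMat, Basis.isUnitSMul_apply, ← ha']
      field_simp
      linear_combination hr
    -- In dimension at least two the form represents 1. Splitting off a vector of norm 1 leaves the
    -- discriminant unchanged.
    · have key : ∀ {V : Type u} [AddCommGroup V] [Module F V] [FiniteDimensional F V]
        {b : V →ₗ[F] V →ₗ[F] F} (_ : IsForm 1 b) (_ : finrank F V = n + 1),
        ∃ e : Fin 1 → V, gramMat b e = 1 := by
        intro V _ _ _ b hb hn
        obtain ⟨e, he, he0⟩ := horth hb hn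
        let i : Fin (n + 1) := ⟨0, by omega⟩
        let j : Fin (n + 1) := ⟨1, by omega⟩
        have hij : i ≠ j := by simp [i, j]
        obtain ⟨u, v, huv⟩ := exists_mul_sq_add_mul_sq (he0 i) (he0 j) 1
        refine ⟨fun _ => u • e i + v • e j, ?_⟩
        ext k l
        rw [Subsingleton.elim k 0, Subsingleton.elim l 0]
        simp [gramMat, he i j hij, he j i hij.symm]
        linear_combination huv
      have hdU : ∀ {V : Type u} [AddCommGroup V] [Module F V] [FiniteDimensional F V]
        {b : V →ₗ[F] V →ₗ[F] F} (_ : IsForm 1 b) (_ : finrank F V = n + 1) (e : Fin 1 → V)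
        (_ : gramMat b e = 1), dsc b = dsc (restr b (orthFamily b e)) := by
        intro V _ _ _ b hb hn e he
        have hb1 : ∀ v w, b v w = b w v := by simpa using hb.symm
        have hdet : (gramMat b e).det ≠ 0 := by rw [he]; simp
        have h1 := dsc_congr (fun v w => by simp [hb1]) (isometric_of_isCompl (x := 1)
          (isCompl_span_orthFamily hb.symm hdet) (fun _ h => h)
          (fun _ h => h) span_orthFamily
          (fun w hw u hu => by rw [hb.symm, span_orthFamily w hw u hu, mul_zero]))
        rw [← h1, dsc_orthSum (b := restr b _) (b' := restr b _) (fun v w => hb1 v w) (fun v w => hb1 v w)]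
        have hW : IsForm 1 (restr b (Submodule.span F (Set.range e))) :=
          isForm_restr_of_isCompl hb (isCompl_span_orthFamily hb.symm hdet) span_orthFamily
        let E := Basis.span (linearIndependent_of_det_gramMat' b hdet)
        have hE : gramMat (restr b (Submodule.span F (Set.range e))) E = 1 := by
          rw [← he]; ext i j; simp [gramMat, E, Basis.span_apply]
        rw [dsc_eq (b := restr b _) (fun v w => hb1 v w) (e := E)
          (by rw [hW.formRank_eq, Module.finrank_eq_card_basis E]) (by rw [hE]; simp), hE]
        simp [qchi_one]
      obtain ⟨e, he⟩ := key hb hn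
      obtain ⟨e', he'⟩ := key hb' hn'
      have hdt : (gramMat b e).det ≠ 0 := by rw [he]; simp
      have hdt' : (gramMat b' e').det ≠ 0 := by rw [he']; simp
      have hf := finrank_orthFamily hb hdt
      have hf' := finrank_orthFamily hb' hdt'
      simp only [Fintype.card_fin] at hf hf'
      refine isometric_one_of_orthFamily hb.symm hb'.symm hdt (he.trans he'.symm)
        (ih (isForm_restr_orthFamily hb hdt) (isForm_restr_orthFamily hb' hdt')
          (by omega) (by omega) ?_)
      rw [← hdU hb hn e he, ← hdU hb' hn' e' he', hd]

end Isometry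

/-! ### A norm equation over a finite commutative ring -/

section NormEquation

/-- In a finite commutative ring with `2`, `d`, `g` invertible, `g` is represented by the form
`α² - d β²`. -/
theorem exists_sq_sub_mul_sq {R : Type*} [CommRing R] [Finite R] (h2 : IsUnit (2 : R)) {d g : R}
    (hd : IsUnit d) (hg : IsUnit g) : ∃ α β : R, α ^ 2 - d * β ^ 2 = g := by
  -- The reduced quotient is a finite product of finite fields, where the equation is solvable
  -- factor by factor.
  set S := R ⧸ nilradical R
  have hS : Finite S := Quotient.finite _
  let π : R →+* S := Ideal.Quotient.mk _
  have hred : IsReduced S :=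
    (Ideal.isRadical_iff_quotient_reduced _).1 (Ideal.radical_isRadical ⊥)
  let e := IsArtinianRing.equivPi S
  have hfield : ∀ I : MaximalSpectrum S, ∃ a c : S ⧸ I.asIdeal,
      a ^ 2 - Ideal.Quotient.mk _ (π d) * c ^ 2 = Ideal.Quotient.mk _ (π g) := by
    intro I
    let _ : Field (S ⧸ I.asIdeal) := Ideal.Quotient.field _
    have : Finite (S ⧸ I.asIdeal) := Quotient.finite _
    have hd0 : (Ideal.Quotient.mk I.asIdeal (π d)) ≠ 0 := ((hd.map π).map _).ne_zero
    obtain ⟨a, c, h⟩ := exists_mul_sq_add_mul_sq (F := S ⧸ I.asIdeal) one_ne_zero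
      (neg_ne_zero.2 hd0) (Ideal.Quotient.mk I.asIdeal (π g))
    exact ⟨a, c, by rw [← h]; ring⟩
  choose a c hac using hfield
  obtain ⟨α, hα⟩ := Ideal.Quotient.mk_surjective (e.symm a)
  obtain ⟨β, hβ⟩ := Ideal.Quotient.mk_surjective (e.symm c)
  have hnil : IsNilpotent (α ^ 2 - d * β ^ 2 - g) := by
    rw [← mem_nilradical, ← Ideal.Quotient.eq_zero_iff_mem]
    have : π (α ^ 2 - d * β ^ 2 - g) = e.symm a ^ 2 - π d * e.symm c ^ 2 - π g := by
      rw [← hα, ← hβ]; simp [π]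
    change π _ = 0
    rw [this]
    apply e.injective
    rw [map_sub, map_sub, map_mul, map_pow, map_pow, map_zero, AlgEquiv.apply_symm_apply,
      AlgEquiv.apply_symm_apply]
    funext I
    have := hac I
    simp only [Pi.sub_apply, Pi.mul_apply, Pi.pow_apply, Pi.zero_apply]
    rw [sub_eq_zero]
    exact this
  obtain ⟨g', hg'⟩ := hg.exists_right_inv
  -- The quotient of the approximate norm by `g`. It differs from 1 by a nilpotent, so, 2 being
  -- invertible, Newton iteration from 1 gives a square root `r`; dividing `α` and `β` by `r`
  -- corrects the approximation.
  set h := 1 + g' * (α ^ 2 - d * β ^ 2 - g) with hh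
  have hgh : g * h = α ^ 2 - d * β ^ 2 := by
    rw [hh]; linear_combination (α ^ 2 - d * β ^ 2 - g) * hg'
  have hnil' : IsNilpotent (1 - h) := by
    rw [hh, show (1 : R) - (1 + g' * (α ^ 2 - d * β ^ 2 - g))
      = -g' * (α ^ 2 - d * β ^ 2 - g) by ring]
    exact (Commute.all _ _).isNilpotent_mul_left hnil
  open Polynomial in
  obtain ⟨r, ⟨hr1, hr2⟩, -⟩ := existsUnique_nilpotent_sub_and_aeval_eq_zero (R := R) (S := R)
    (P := X ^ 2 - C h) (x := 1) (by simpa using hnil') (by simpa [one_add_one_eq_two] using h2)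
  have hr : r ^ 2 = h := by
    simpa [sub_eq_zero] using hr2
  have hru : IsUnit r := by
    have := IsNilpotent.isUnit_one_sub hr1
    simpa using this
  obtain ⟨r', hr'⟩ := hru.exists_right_inv
  refine ⟨α * r', β * r', ?_⟩
  calc (α * r') ^ 2 - d * (β * r') ^ 2 = (α ^ 2 - d * β ^ 2) * r' ^ 2 := by ring
    _ = g * (r * r') ^ 2 := by rw [← hgh, ← hr]; ring
    _ = g := by rw [hr']; ring

end NormEquation

/-! ### Spaces with an isometry, and their residual forms -/

section Triples

open Module LinearMap

variable {F : Type*} [Field F] {V V' V'' : Type u} [AddCommGroup V] [Module F V]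
  [AddCommGroup V'] [Module F V'] [AddCommGroup V''] [Module F V'']

/-- A nondegenerate `ε`-symmetric form with an isometry `x` with inverse `y`. -/
structure IsTriple (ε : F) (b : V →ₗ[F] V →ₗ[F] F) (x y : End F V) : Prop where
  form : IsForm ε b
  xy : x * y = 1
  yx : y * x = 1
  isom : ∀ v w, b (x v) (x w) = b v w

namespace IsTriple

variable {ε : F} {b : V →ₗ[F] V →ₗ[F] F} {x y : End F V}

theorem xy_apply (h : IsTriple ε b x y) (v : V) : x (y v) = v :=
  LinearMap.congr_fun h.xy v

theorem yx_apply (h : IsTriple ε b x y) (v : V) : y (x v) = v :=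
  LinearMap.congr_fun h.yx v

theorem adj (h : IsTriple ε b x y) (v w : V) : b (x v) w = b v (y w) := by
  rw [← h.isom v (y w), h.xy_apply]

theorem adj' (h : IsTriple ε b x y) (v w : V) : b (y v) w = b v (x w) := by
  rw [← h.isom (y v) w, h.xy_apply]

theorem commute (h : IsTriple ε b x y) : Commute x y := by
  rw [Commute, SemiconjBy, h.xy, h.yx]

end IsTriple

/-- Write `b₂ v w = b (g v) w`; then `g` commutes with `x` and is self-adjoint, while `s = x - y` is
skew and invertible. If `α`, `β` are self-adjoint, commute with everything in sight and satisfy `α ^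
2 - s ^ 2 * β ^ 2 = g`, then `U = α + s * β` has adjoint `α - s * β`, and `U` carries `b₂` to `b`.
This is surjectivity of the norm, as for hermitian forms over finite fields. -/
theorem exists_isometry_of_injective [Finite F] [FiniteDimensional F V] (h2 : (2 : F) ≠ 0)
    {ε : F} (hε : ε * ε = 1) {b b₂ : V →ₗ[F] V →ₗ[F] F} {x y : End F V} (h : IsTriple ε b x y)
    (h₂ : IsTriple ε b₂ x y) (hs : Function.Injective (x - y)) : Isometric b₂ x b x := by
  have hbinj : Function.Injective b := by
    rw [injective_iff_map_eq_zero]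
    intro v hv
    exact h.form.nondeg v fun w => by rw [hv]; rfl
  let B : V ≃ₗ[F] Dual F V := LinearMap.linearEquivOfInjective b hbinj
    (Subspace.dual_finrank_eq (K := F) (V := V)).symm
  let g : End F V := B.symm.toLinearMap ∘ₗ b₂
  have hg : ∀ v w, b (g v) w = b₂ v w := fun v w => by
    have : B (g v) = b₂ v := by simp [g]
    exact LinearMap.congr_fun this w
  set s : End F V := x - y with hsdef
  have hext : ∀ {u v : V}, (∀ w, b u w = b v w) → u = v := fun {u v} huv => by
    rw [← sub_eq_zero]
    refine h.form.nondeg _ fun w => ?_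
    rw [map_sub, LinearMap.sub_apply, huv, sub_self]
  have hgx : g * x = x * g := by
    ext v
    refine hext fun w => ?_
    change b (g (x v)) w = b (x (g v)) w
    rw [hg, h₂.adj, h.adj, hg]
  have hgy : g * y = y * g := by
    ext v
    refine hext fun w => ?_
    change b (g (y v)) w = b (y (g v)) w
    rw [hg, h₂.adj', h.adj', hg]
  have hgadj : ∀ v w, b (g v) w = b v (g w) := fun v w => by
    rw [hg, h₂.form.symm, ← hg, h.form.symm (g w), ← mul_assoc, hε, one_mul]
  have hsadj : ∀ v w, b (s v) w = - b v (s w) := fun v w => by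
    simp only [hsdef, LinearMap.sub_apply, map_sub, h.adj, h.adj']
    ring
  let T : Set (End F V) := {s * s, g}
  have hgs : g * s = s * g := by
    rw [hsdef, mul_sub, sub_mul, hgx, hgy]
  have hcomm : ∀ p ∈ T, ∀ q ∈ T, p * q = q * p := by
    have h1 : s * s * g = g * (s * s) := by
      rw [mul_assoc, ← hgs, ← mul_assoc, ← hgs, mul_assoc]
    rintro p (rfl | rfl) q (rfl | rfl)
    · rfl
    · exact h1
    · exact h1.symm
    · rfl
  -- The algebra generated by `s ^ 2` and `g` is finite and commutative, and all its elements are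
  -- self-adjoint and commute with `x` and `y`. The norm equation is solved in it.
  let C := Algebra.adjoin F T
  let _ : CommRing C := { (inferInstance : Ring C) with
    mul_comm := (Algebra.isMulCommutative_adjoin F hcomm).is_comm.comm }
  have hVfin : Finite V := Module.finite_of_finite F
  have hEfin : Finite (End F V) := Module.finite_of_finite F
  have hxC : ∀ c ∈ C, c * x = x * c ∧ c * y = y * c ∧ ∀ v w, b (c v) w = b v (c w) := by
    intro c hc
    induction hc using Algebra.adjoin_induction with
    | mem c hc =>
      rcases hc with rfl | rfl
      · have hsx : s * x = x * s := by
          rw [hsdef, sub_mul, mul_sub, h.xy, h.yx]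
        have hsy : s * y = y * s := by
          rw [hsdef, sub_mul, mul_sub, h.xy, h.yx]
        refine ⟨by rw [mul_assoc, hsx, ← mul_assoc, hsx, mul_assoc],
          by rw [mul_assoc, hsy, ← mul_assoc, hsy, mul_assoc], fun v w => ?_⟩
        change b (s (s v)) w = b v (s (s w))
        rw [hsadj, hsadj, neg_neg]
      · exact ⟨hgx, hgy, hgadj⟩
    | algebraMap r =>
      exact ⟨Algebra.commutes r x, Algebra.commutes r y, fun v w => by
        simp [Module.algebraMap_end_apply]⟩
    | add p q _ _ hp hq =>
      refine ⟨by rw [add_mul, mul_add, hp.1, hq.1], by rw [add_mul, mul_add, hp.2.1, hq.2.1],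
        fun v w => ?_⟩
      simp [hp.2.2, hq.2.2]
    | mul p q hp' hq' hp hq =>
      refine ⟨by rw [mul_assoc, hq.1, ← mul_assoc, hp.1, mul_assoc],
        by rw [mul_assoc, hq.2.1, ← mul_assoc, hp.2.1, mul_assoc], fun v w => ?_⟩
      have hpq : p * q = q * p :=
        congrArg Subtype.val (mul_comm (⟨p, hp'⟩ : C) ⟨q, hq'⟩)
      change b (p (q v)) w = b v ((p * q) w)
      rw [hpq, hp.2.2, hq.2.2]; rfl
  have hunit : ∀ c : C, Function.Injective c.1 → IsUnit c := by
    intro c hc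
    have : Finite C := inferInstance
    apply IsArtinianRing.isUnit_of_mem_nonZeroDivisors
    rw [mem_nonZeroDivisors_iff_right]
    intro z hz
    rw [mul_comm] at hz
    apply Subtype.ext
    ext v
    apply hc
    have := LinearMap.congr_fun (congrArg Subtype.val hz) v
    simpa using this
  let S : C := ⟨s * s, Algebra.subset_adjoin (by simp [T])⟩
  let G : C := ⟨g, Algebra.subset_adjoin (by simp [T])⟩
  have hS : IsUnit S := hunit S (hs.comp hs)
  have hG : IsUnit G := by
    refine hunit G ?_
    rw [injective_iff_map_eq_zero]
    intro v hv
    refine h₂.form.nondeg v fun w => ?_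
    rw [← hg]
    change b (G.1 v) w = 0
    rw [hv]; simp
  have hC2 : IsUnit (2 : C) := by
    have := (isUnit_iff_ne_zero.2 h2).map (algebraMap F C)
    rwa [map_ofNat] at this
  have hCfin : Finite C := inferInstance
  obtain ⟨α, β, hαβ⟩ := exists_sq_sub_mul_sq hC2 hS hG
  obtain ⟨hα1, hα2, hα3⟩ := hxC α.1 α.2
  obtain ⟨hβ1, hβ2, hβ3⟩ := hxC β.1 β.2
  have hαs : α.1 * s = s * α.1 := by rw [hsdef, mul_sub, sub_mul, hα1, hα2]
  have hβs : β.1 * s = s * β.1 := by rw [hsdef, mul_sub, sub_mul, hβ1, hβ2]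
  have hαβc : α.1 * β.1 = β.1 * α.1 := congrArg Subtype.val (mul_comm α β)
  have hval : ∀ v, α.1 (α.1 v) - s (s (β.1 (β.1 v))) = g v := by
    intro v
    have := LinearMap.congr_fun (congrArg Subtype.val hαβ) v
    simpa [S, G, pow_two] using this
  have hαs' : ∀ v, α.1 (s v) = s (α.1 v) := LinearMap.congr_fun hαs
  have hβs' : ∀ v, β.1 (s v) = s (β.1 v) := LinearMap.congr_fun hβs
  have hαβ' : ∀ v, α.1 (β.1 v) = β.1 (α.1 v) := LinearMap.congr_fun hαβc
  let U : End F V := α.1 + s * β.1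
  have hU : ∀ v w, b (U v) (U w) = b₂ v w := by
    intro v w
    rw [← hg, ← hval v]
    simp only [U, LinearMap.add_apply, Module.End.mul_apply, map_add, map_sub, LinearMap.sub_apply]
    have e1 : b (α.1 v) (α.1 w) = b (α.1 (α.1 v)) w := (hα3 _ _).symm
    have e2 : b (s (β.1 v)) (α.1 w) = b (s (α.1 (β.1 v))) w := by
      rw [← hα3, hαs']
    have e3 : b (α.1 v) (s (β.1 w)) = - b (s (α.1 (β.1 v))) w := by
      rw [← neg_neg (b (α.1 v) (s (β.1 w))), ← hsadj, ← hβ3, hβs', hαβ']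
    have e4 : b (s (β.1 v)) (s (β.1 w)) = - b (s (s (β.1 (β.1 v)))) w := by
      rw [← neg_neg (b (s (β.1 v)) (s (β.1 w))), ← hsadj, ← hβ3, hβs', hβs']
    rw [e1, e2, e3, e4]; ring
  have hUinj : Function.Injective U := by
    rw [injective_iff_map_eq_zero]
    intro v hv
    refine h₂.form.nondeg v fun w => ?_
    rw [← hU, hv]; simp
  refine ⟨LinearEquiv.ofInjectiveEndo U hUinj, fun v => ?_, fun v w => ?_⟩
  · change U (x v) = x (U v)
    have hsx : ∀ v, s (x v) = x (s v) := fun v => by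
      simp [hsdef, h.xy_apply, h.yx_apply]
    have ha : α.1 (x v) = x (α.1 v) := LinearMap.congr_fun hα1 v
    have hb : β.1 (x v) = x (β.1 v) := LinearMap.congr_fun hβ1 v
    simp [U, ha, hb, hsx]
  · exact hU v w

/-! ### Residual forms at the eigenvalue 1 -/

section ResidualForms

variable {ε : F} {b : V →ₗ[F] V →ₗ[F] F} {x y : End F V}

/-- The residual form on `ker (x - 1)^(k+1)`. -/
def resForm (b : V →ₗ[F] V →ₗ[F] F) (x : End F V) (k : ℕ) :
    ker ((x - 1) ^ (k + 1)) →ₗ[F] ker ((x - 1) ^ (k + 1)) →ₗ[F] F :=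
  restr (b ∘ₗ (x - 1) ^ k) (ker ((x - 1) ^ (k + 1)))

theorem resForm_apply (k : ℕ) (v w : ker ((x - 1) ^ (k + 1))) :
    resForm b x k v w = b (((x - 1) ^ k) v) w := rfl

theorem IsTriple.adj_sub_one_pow (h : IsTriple ε b x y) (k : ℕ) (v w : V) :
    b (((x - 1) ^ k) v) w = b v (((y - 1) ^ k) w) := by
  induction k generalizing v with
  | zero => rfl
  | succ k ih =>
    rw [pow_succ, pow_succ', Module.End.mul_apply, Module.End.mul_apply, ih]
    simp [h.adj]

theorem IsTriple.y_sub_one_pow (h : IsTriple ε b x y) (k : ℕ) :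
    (y - 1) ^ k = (-1 : F) ^ k • (y ^ k * (x - 1) ^ k) := by
  have h1 : y - 1 = (-1 : F) • (y * (x - 1)) := by
    rw [mul_sub, h.yx]; simp
  have hc : Commute y (x - 1) := (h.commute.symm).sub_right (Commute.one_right y)
  rw [h1, smul_pow, hc.mul_pow]

theorem IsTriple.y_pow_apply (h : IsTriple ε b x y) {v : V} (hv : x v = v) (k : ℕ) :
    (y ^ k) v = v := by
  have hy : y v = v := by simpa [hv] using h.yx_apply v
  induction k with
  | zero => rfl
  | succ k ih => rw [pow_succ, Module.End.mul_apply, hy, ih]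

theorem x_apply_of_mem_ker {k : ℕ} {v : V} (hv : v ∈ ker ((x - 1) ^ (k + 1))) :
    x (((x - 1) ^ k) v) = ((x - 1) ^ k) v := by
  rw [LinearMap.mem_ker, pow_succ', Module.End.mul_apply] at hv
  rw [← sub_eq_zero]; simpa using hv

/-- The adjoint of `x - 1` is `y - 1 = -y (x - 1)`, and `y` acts trivially on `(x - 1) ^ k w`; each
of the `k` factors therefore contributes one sign. -/
theorem resForm_symm (h : IsTriple ε b x y) (k : ℕ) (v w : ker ((x - 1) ^ (k + 1))) :
    resForm b x k v w = ε * (-1) ^ k * resForm b x k w v := by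
  rw [resForm_apply, resForm_apply, h.adj_sub_one_pow, h.y_sub_one_pow, LinearMap.smul_apply,
    Module.End.mul_apply, h.y_pow_apply (x_apply_of_mem_ker w.2), map_smul, h.form.symm,
    smul_eq_mul]
  ring

theorem mem_range_of_orth [FiniteDimensional F V] (hb : IsForm ε b) {M M' : End F V}
    (hM : ∀ v w, b (M v) w = b v (M' w)) {v : V} (hv : ∀ w ∈ ker M', b v w = 0) : v ∈ range M := by
  have : b v ∈ range M'.dualMap := by
    rw [LinearMap.range_dualMap_eq_dualAnnihilator_ker, Submodule.mem_dualAnnihilator]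
    exact hv
  obtain ⟨φ, hφ⟩ := this
  obtain ⟨u, rfl⟩ := hb.exists_eq φ
  refine ⟨u, ?_⟩
  rw [← sub_eq_zero]
  refine hb.nondeg _ fun w => ?_
  rw [map_sub, LinearMap.sub_apply, hM, ← hφ]
  simp [LinearMap.dualMap_apply]

theorem IsTriple.ker_y_sub_one_pow (h : IsTriple ε b x y) (k : ℕ) :
    ker ((y - 1) ^ k) = ker ((x - 1) ^ k) := by
  ext v
  rw [LinearMap.mem_ker, LinearMap.mem_ker, h.y_sub_one_pow, LinearMap.smul_apply,
    smul_eq_zero_iff_right (pow_ne_zero _ (by simp)), Module.End.mul_apply]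
  constructor
  · intro hv
    have h1 : x ^ k * y ^ k = 1 := by rw [← h.commute.mul_pow, h.xy, one_pow]
    have := congrArg (x ^ k) hv
    rw [← Module.End.mul_apply, h1] at this
    simpa using this
  · intro hv; rw [hv, map_zero]

/-- The adjoint `(y - 1) ^ k` is an invertible multiple of `(x - 1) ^ k`, so the two have the same
kernel, and the range of an operator is the orthogonal of the kernel of its adjoint. -/
theorem IsTriple.mem_range_iff [FiniteDimensional F V] (h : IsTriple ε b x y) (k : ℕ) (v : V) :
    v ∈ range ((x - 1) ^ k) ↔ ∀ w ∈ ker ((x - 1) ^ k), b v w = 0 := by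
  constructor
  · rintro ⟨u, rfl⟩ w hw
    rw [← h.ker_y_sub_one_pow] at hw
    rw [h.adj_sub_one_pow, LinearMap.mem_ker.1 hw, map_zero]
  · intro hv
    refine mem_range_of_orth h.form (h.adj_sub_one_pow k) fun w hw => hv w ?_
    rwa [← h.ker_y_sub_one_pow]

theorem finrank_map_add_finrank_inf_ker [FiniteDimensional F V] (f : V →ₗ[F] V')
    (S : Submodule F V) :
    finrank F (S.map f) + finrank F (S ⊓ ker f : Submodule F V) = finrank F S := by
  rw [← LinearMap.finrank_range_add_finrank_ker (f.domRestrict S)]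
  congr 1
  · rw [LinearMap.domRestrict, LinearMap.range_comp, Submodule.range_subtype]
  · have : ker (f.domRestrict S) = Submodule.comap S.subtype (S ⊓ ker f) := by
      ext v; simp
    rw [this]
    exact (Submodule.comapSubtypeEquivOfLe inf_le_left).finrank_eq.symm

/-- The rank of the powers of an endomorphism. -/
noncomputable def powRank (N : End F V) (k : ℕ) : ℕ := finrank F (range (N ^ k))

theorem powRank_eq_add [FiniteDimensional F V] (N : End F V) (k : ℕ) :
    powRank N (k + 1) + finrank F (range (N ^ k) ⊓ ker N : Submodule F V) = powRank N k := by
  rw [powRank, powRank, ← finrank_map_add_finrank_inf_ker N (range (N ^ k)), pow_succ',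
    Module.End.mul_eq_comp, LinearMap.range_comp]

/-- The rank of the residual form is the number of Jordan blocks of size exactly `k + 1` at the
eigenvalue 1, that is, the second difference of the ranks of the powers of `x - 1`; the formula is
arranged to avoid subtraction. -/
theorem formRank_resForm [FiniteDimensional F V] (h : IsTriple ε b x y) (k : ℕ) :
    formRank (resForm b x k) + 2 * powRank (x - 1) (k + 1) =
      powRank (x - 1) k + powRank (x - 1) (k + 2) := by
  have h1 := powRank_eq_add (x - 1) k
  have h2 := powRank_eq_add (x - 1) (k + 1)
  have h3 := LinearMap.finrank_range_add_finrank_ker (resForm b x k)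
  set K := ker ((x - 1) ^ (k + 1)) with hK
  -- The radical of the residual form: `(x - 1) ^ k v` is orthogonal to the kernel `K` exactly when
  -- it lies in the range of `(x - 1) ^ (k + 1)`.
  set Z : Submodule F V := K ⊓ (range ((x - 1) ^ (k + 1))).comap ((x - 1) ^ k) with hZ
  have h4 : finrank F (ker (resForm b x k)) = finrank F Z := by
    have : ker (resForm b x k) = Z.comap K.subtype := by
      ext v
      rw [LinearMap.mem_ker, Submodule.mem_comap, hZ, Submodule.mem_inf, Submodule.mem_comap,
        h.mem_range_iff]
      constructor
      · intro hv
        exact ⟨v.2, fun w hw => LinearMap.congr_fun hv ⟨w, hw⟩⟩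
      · rintro ⟨-, hv⟩
        ext w
        exact hv w w.2
    rw [this]
    exact (Submodule.comapSubtypeEquivOfLe inf_le_left).finrank_eq
  have h5 := finrank_map_add_finrank_inf_ker ((x - 1) ^ k) K
  have h6 := finrank_map_add_finrank_inf_ker ((x - 1) ^ k) Z
  have hmem : ∀ v, v ∈ K ↔ (x - 1) (((x - 1) ^ k) v) = 0 := fun v => by
    rw [hK, LinearMap.mem_ker, pow_succ', Module.End.mul_apply]
  have h7 : K.map ((x - 1) ^ k) = range ((x - 1) ^ k) ⊓ ker (x - 1) := by
    ext v
    simp only [Submodule.mem_map, Submodule.mem_inf, LinearMap.mem_range, LinearMap.mem_ker]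
    constructor
    · rintro ⟨u, hu, rfl⟩; exact ⟨⟨u, rfl⟩, (hmem u).1 hu⟩
    · rintro ⟨⟨u, rfl⟩, hu⟩; exact ⟨u, (hmem u).2 hu, rfl⟩
  have h8 : Z.map ((x - 1) ^ k) = range ((x - 1) ^ (k + 1)) ⊓ ker (x - 1) := by
    ext v
    simp only [hZ, Submodule.mem_map, Submodule.mem_inf, LinearMap.mem_ker, Submodule.mem_comap]
    constructor
    · rintro ⟨u, ⟨hu, hu'⟩, rfl⟩; exact ⟨hu', (hmem u).1 hu⟩
    · rintro ⟨⟨u, rfl⟩, hu⟩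
      refine ⟨(x - 1) u, ⟨(hmem _).2 ?_, u, ?_⟩, ?_⟩
      · rw [pow_succ, Module.End.mul_apply] at hu; exact hu
      · rw [pow_succ, Module.End.mul_apply]
      · rw [pow_succ, Module.End.mul_apply]
  have h9 : K ⊓ ker ((x - 1) ^ k) = Z ⊓ ker ((x - 1) ^ k) := by
    ext v
    simp only [hZ, Submodule.mem_inf, LinearMap.mem_ker, Submodule.mem_comap]
    constructor
    · rintro ⟨a, c⟩; exact ⟨⟨a, by rw [c]; exact zero_mem _⟩, c⟩
    · rintro ⟨⟨a, -⟩, c⟩; exact ⟨a, c⟩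
  rw [h7] at h5
  rw [h8, ← h9] at h6
  change formRank _ + _ = _ at h3
  have h11 : powRank (x - 1) (k + 1 + 1) = powRank (x - 1) (k + 2) := rfl
  have h10 : finrank F (ker ((x - 1) ^ (k + 1))) = finrank F K := rfl
  omega

end ResidualForms

end Triples

/-! ### Classification away from the eigenvalue -1 -/

section Classification

open Module LinearMap

/-- In the gluing argument this produces one linear map that extends prescribed values on a subspace
and also has prescribed image under a surjection. -/
theorem exists_lift_of_surjective {F A B M S : Type*} [Field F] [AddCommGroup A] [Module F A]
    [AddCommGroup B] [Module F B] [AddCommGroup M] [Module F M] [AddCommGroup S] [Module F S]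
    (p : A →ₗ[F] B) (hp : Function.Surjective p) (i : S →ₗ[F] M) (hi : Function.Injective i)
    (h : M →ₗ[F] B) (l : S →ₗ[F] A) (hl : ∀ s, p (l s) = h (i s)) :
    ∃ L : M →ₗ[F] A, (∀ m, p (L m) = h m) ∧ ∀ s, L (i s) = l s := by
  obtain ⟨g, hg⟩ := p.exists_rightInverse_of_surjective (LinearMap.range_eq_top.2 hp)
  obtain ⟨r, hr⟩ := i.exists_leftInverse_of_injective (LinearMap.ker_eq_bot.2 hi)
  have hg' : ∀ b, p (g b) = b := LinearMap.congr_fun hg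
  have hr' : ∀ s, r (i s) = s := LinearMap.congr_fun hr
  refine ⟨g ∘ₗ h + (l - g ∘ₗ h ∘ₗ i) ∘ₗ r, fun m => ?_, fun s => ?_⟩
  · simp [hg', hl]
  · simp [hr']

variable {F : Type*} [Field F] {V V' V'' : Type u} [AddCommGroup V] [Module F V]
  [AddCommGroup V'] [Module F V'] [AddCommGroup V''] [Module F V'']

variable {ε : F} {b : V →ₗ[F] V →ₗ[F] F} {x y : End F V}

/-- The skew endomorphism `(x - x⁻¹) / 2`. -/
noncomputable def skewPart (x y : End F V) : End F V := (2 : F)⁻¹ • (x - y)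

/-- When `x + 1` is invertible, this factorization shows that the skew-adjoint operator `(x - y) /
2` has the same kernel and range as `x - 1`. It replaces `x - 1` because it is skew-adjoint on the
nose. -/
theorem IsTriple.skewPart_eq (h : IsTriple ε b x y) :
    skewPart x y = (2 : F)⁻¹ • ((x + 1) * y * (x - 1)) := by
  rw [skewPart]
  congr 1
  rw [mul_sub, mul_one, mul_assoc, h.yx, mul_one, add_mul, h.xy, one_mul]
  abel

theorem IsTriple.skewPart_comm (h : IsTriple ε b x y) (v : V) :
    skewPart x y (x v) = x (skewPart x y v) := by
  simp [skewPart, h.xy_apply, h.yx_apply]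

theorem IsTriple.skewPart_adj (h : IsTriple ε b x y) (v w : V) :
    b (skewPart x y v) w = - b v (skewPart x y w) := by
  simp only [skewPart, LinearMap.smul_apply, LinearMap.sub_apply, map_smul, map_sub, h.adj, h.adj',
    smul_eq_mul]
  ring

/-- The factor `1 / 2` in `skewPart` is chosen for this: on fixed vectors `(x + 1) * y` acts as 2.
Consequently the residual forms may be computed with either operator. -/
theorem IsTriple.skewPart_of_fixed (h2 : (2 : F) ≠ 0) (h : IsTriple ε b x y) {v : V}
    (hv : x ((x - 1) v) = (x - 1) v) : skewPart x y v = (x - 1) v := by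
  have hy : y ((x - 1) v) = (x - 1) v := by simpa using h.y_pow_apply hv 1
  rw [h.skewPart_eq]
  simp only [LinearMap.smul_apply, Module.End.mul_apply]
  rw [hy, LinearMap.add_apply, hv, Module.End.one_apply, ← two_smul F, smul_smul,
    inv_mul_cancel₀ h2, one_smul]

theorem IsTriple.injective_mul (h : IsTriple ε b x y) (hx : Function.Injective ⇑(x + 1)) :
    Function.Injective ⇑((x + 1) * y) := by
  refine hx.comp fun v w hvw => ?_
  rw [← h.xy_apply v, hvw, h.xy_apply]

theorem IsTriple.skewPart_eq_zero_iff (h2 : (2 : F) ≠ 0) (h : IsTriple ε b x y)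
    (hx : Function.Injective ⇑(x + 1)) (v : V) : skewPart x y v = 0 ↔ (x - 1) v = 0 := by
  rw [h.skewPart_eq, LinearMap.smul_apply, smul_eq_zero_iff_right (inv_ne_zero h2),
    Module.End.mul_apply]
  exact map_eq_zero_iff _ (h.injective_mul hx)

theorem IsTriple.range_skewPart [FiniteDimensional F V] (h2 : (2 : F) ≠ 0) (h : IsTriple ε b x y)
    (hx : Function.Injective ⇑(x + 1)) : range (skewPart x y) = range (x - 1) := by
  have hc : (x + 1) * y * (x - 1) = (x - 1) * ((x + 1) * y) := by
    rw [mul_assoc, mul_sub, h.yx, mul_one, ← mul_assoc, mul_sub, mul_one]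
    simp only [add_mul, mul_add, sub_mul, one_mul, mul_one, mul_assoc, h.xy]
    abel
  rw [h.skewPart_eq, LinearMap.range_smul _ _ (inv_ne_zero h2), hc, Module.End.mul_eq_comp,
    LinearMap.range_comp_of_range_eq_top]
  exact LinearMap.range_eq_top.2 (LinearMap.injective_iff_surjective.1 (h.injective_mul hx))

theorem IsTriple.mem_ker_of_orth (h : IsTriple ε b x y) {v : V}
    (hv : ∀ w, b v ((x - 1) w) = 0) : (x - 1) v = 0 := by
  have h1 : v ∈ ker ((y - 1) ^ 1) := by
    rw [pow_one, LinearMap.mem_ker]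
    refine h.form.nondeg _ fun w => ?_
    rw [← hv w]
    simp [h.adj']
  rw [h.ker_y_sub_one_pow, pow_one] at h1
  exact h1

theorem IsTriple.map_range (_h : IsTriple ε b x y) : ∀ v ∈ range (x - 1), x v ∈ range (x - 1) := by
  rintro _ ⟨u, rfl⟩; exact ⟨x u, by simp⟩

theorem IsTriple.map_range' (h : IsTriple ε b x y) :
    ∀ v ∈ range (x - 1), y v ∈ range (x - 1) := by
  rintro _ ⟨u, rfl⟩; exact ⟨y u, by simp [h.xy_apply, h.yx_apply]⟩

theorem coe_restrict_sub_one_pow {W : Submodule F V} (hW : ∀ v ∈ W, x v ∈ W) (k : ℕ) (v : W) :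
    ((((x.restrict hW) - 1) ^ k) v : V) = ((x - 1) ^ k) v := by
  induction k with
  | zero => rfl
  | succ k ih => rw [pow_succ', pow_succ', Module.End.mul_apply, Module.End.mul_apply, ← ih]; simp

/-- The rule `b₁ (s v) w = b v w` with `s = skewPart x y` is well defined on `range (x - 1)`,
because the kernel of `s` is `ker (x - 1)`, which is orthogonal to `range (x - 1)`. -/
theorem IsTriple.exists_descend [FiniteDimensional F V] (h2 : (2 : F) ≠ 0) (h : IsTriple ε b x y)
    (hx : Function.Injective ⇑(x + 1)) :
    ∃ b₁ : range (x - 1) →ₗ[F] range (x - 1) →ₗ[F] F,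
      ∀ (u : range (x - 1)) (v : V), (u : V) = skewPart x y v → ∀ w, b₁ u w = b v w := by
  have hr := h.range_skewPart h2 hx
  let s₁ : V →ₗ[F] range (x - 1) := (skewPart x y).codRestrict _ fun v => by
    rw [← hr]; exact ⟨v, rfl⟩
  have hs₁ : range s₁ = ⊤ := by
    rw [LinearMap.range_eq_top]
    rintro ⟨u, hu⟩
    rw [← hr] at hu
    obtain ⟨v, rfl⟩ := hu
    exact ⟨v, rfl⟩
  obtain ⟨g, hg⟩ := s₁.exists_rightInverse_of_surjective hs₁
  refine ⟨b.compl₁₂ g (range (x - 1)).subtype, fun u v huv w => ?_⟩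
  have h1 : skewPart x y (g u) = u := congrArg Subtype.val (LinearMap.congr_fun hg u)
  have h3 : (x - 1) (g u - v) = 0 := by
    rw [← h.skewPart_eq_zero_iff h2 hx, map_sub, h1, huv, sub_self]
  have h4 := (h.mem_range_iff 1 w).1 (by rw [pow_one]; exact w.2) (g u - v)
    (by rw [pow_one]; exact h3)
  rw [← sub_eq_zero]
  change b (g u) w - b v w = 0
  rw [← LinearMap.sub_apply, ← map_sub, h.form.symm, h4, mul_zero]

/-! ### Descent of the form to the range of `x - 1` -/

section Descent

variable {b₁ : range (x - 1) →ₗ[F] range (x - 1) →ₗ[F] F}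

theorem IsTriple.exists_skewPart [FiniteDimensional F V] (h2 : (2 : F) ≠ 0) (h : IsTriple ε b x y)
    (hx : Function.Injective ⇑(x + 1)) (u : range (x - 1)) : ∃ v, (u : V) = skewPart x y v := by
  have hu : (u : V) ∈ range (skewPart x y) := by rw [h.range_skewPart h2 hx]; exact u.2
  obtain ⟨v, hv⟩ := hu
  exact ⟨v, hv.symm⟩

/-- The symmetry changes sign because `skewPart x y` is skew-adjoint. Nondegeneracy holds because a
vector orthogonal to `range (x - 1)` is fixed by `x`. -/
theorem IsTriple.descend [FiniteDimensional F V] (h2 : (2 : F) ≠ 0) (h : IsTriple ε b x y)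
    (hx : Function.Injective ⇑(x + 1))
    (hb₁ : ∀ (u : range (x - 1)) (v : V), (u : V) = skewPart x y v → ∀ w, b₁ u w = b v w) :
    IsTriple (-ε) b₁ (x.restrict h.map_range) (y.restrict h.map_range') := by
  refine ⟨⟨fun u w => ?_, fun u hu => ?_⟩, ?_, ?_, fun u w => ?_⟩
  · obtain ⟨v, hv⟩ := h.exists_skewPart h2 hx u
    obtain ⟨v', hv'⟩ := h.exists_skewPart h2 hx w
    rw [hb₁ u v hv, hb₁ w v' hv', hv, hv', h.form.symm v, h.skewPart_adj]
    ring
  · obtain ⟨v, hv⟩ := h.exists_skewPart h2 hx u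
    apply Subtype.ext
    rw [hv, ZeroMemClass.coe_zero, h.skewPart_eq_zero_iff h2 hx]
    refine h.mem_ker_of_orth fun w => ?_
    rw [← hu ⟨(x - 1) w, w, rfl⟩, hb₁ u v hv]
  · ext v; simp [h.xy_apply]
  · ext v; simp [h.yx_apply]
  · obtain ⟨v, hv⟩ := h.exists_skewPart h2 hx u
    rw [hb₁ u v hv, hb₁ _ (x v) (by rw [h.skewPart_comm, ← hv]; rfl)]
    exact h.isom v w

/-- With `s = skewPart x y`, the map `s` sends `ker ((x - 1) ^ (k + 2))` onto the corresponding
kernel of exponent `k + 1` in the range, and `b₁ ((x - 1) ^ k (s v)) (s w) = b ((x - 1) ^ k v) (s w)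
= -b ((x - 1) ^ (k + 1) v) w`. Descent thus lowers the index of residual forms by one, at the cost
of a factor -1. -/
theorem IsTriple.dsc_resForm_descend [Finite F] [FiniteDimensional F V] (h2 : (2 : F) ≠ 0)
    (h : IsTriple ε b x y) (hx : Function.Injective ⇑(x + 1))
    (hb₁ : ∀ (u : range (x - 1)) (v : V), (u : V) = skewPart x y v → ∀ w, b₁ u w = b v w) (k : ℕ)
    (hk : -ε * (-1) ^ k = 1) :
    dsc (resForm b₁ (x.restrict h.map_range) k) =
      qchi (-1 : F) ^ formRank (resForm b x (k + 1)) * dsc (resForm b x (k + 1)) := by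
  have h₁ := h.descend h2 hx hb₁
  have hcomm : ∀ (j : ℕ) (v : V), ((x - 1) ^ j) (skewPart x y v)
      = skewPart x y (((x - 1) ^ j) v) := by
    intro j v
    induction j with
    | zero => rfl
    | succ j ih =>
      rw [pow_succ', Module.End.mul_apply, Module.End.mul_apply, ih]
      simp [h.skewPart_comm]
  have hr := h.range_skewPart h2 hx
  have hmem : ∀ v, skewPart x y v ∈ range (x - 1) := fun v => by rw [← hr]; exact ⟨v, rfl⟩
  have hmem' : ∀ v : ker ((x - 1) ^ (k + 1 + 1)),
      (⟨skewPart x y v, hmem v⟩ : range (x - 1)) ∈ ker ((x.restrict h.map_range - 1) ^ (k + 1)) := by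
    intro v
    rw [LinearMap.mem_ker]
    apply Subtype.ext
    rw [coe_restrict_sub_one_pow, hcomm, ZeroMemClass.coe_zero, h.skewPart_eq_zero_iff h2 hx]
    exact (LinearMap.congr_fun (pow_succ' (x - 1) (k + 1)) (v : V)).symm.trans
      (LinearMap.mem_ker.1 v.2)
  let f : ker ((x - 1) ^ (k + 1 + 1)) →ₗ[F] ker ((x.restrict h.map_range - 1) ^ (k + 1)) :=
    (((skewPart x y).domRestrict _).codRestrict _ fun v => hmem v).codRestrict _ hmem'
  have hf : ∀ v w, resForm b₁ (x.restrict h.map_range) k (f v) (f w)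
      = (-1) * resForm b x (k + 1) v w := by
    intro v w
    rw [resForm_apply, resForm_apply]
    have e1 : (((x.restrict h.map_range - 1) ^ k) (f v : range (x - 1)) : V)
        = skewPart x y (((x - 1) ^ k) v) := by
      rw [coe_restrict_sub_one_pow]; exact hcomm k v
    rw [hb₁ _ _ e1]
    have e2 : ((f w : range (x - 1)) : V) = skewPart x y w := rfl
    rw [e2, ← neg_neg (b _ (skewPart x y w)), ← h.skewPart_adj, h.skewPart_of_fixed h2,
      ← Module.End.mul_apply, ← pow_succ']
    · ring
    · rw [← Module.End.mul_apply (x - 1), ← pow_succ']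
      exact x_apply_of_mem_ker v.2
  have hsurj : Function.Surjective f := by
    rintro ⟨u, hu⟩
    obtain ⟨v, hv⟩ := h.exists_skewPart h2 hx u
    refine ⟨⟨v, ?_⟩, ?_⟩
    · rw [LinearMap.mem_ker, pow_succ', Module.End.mul_apply, ← h.skewPart_eq_zero_iff h2 hx,
        ← hcomm, ← hv, ← coe_restrict_sub_one_pow h.map_range, LinearMap.mem_ker.1 hu]
      rfl
    · exact Subtype.ext (Subtype.ext hv.symm)
  have hs1 := resForm_symm h₁ k
  have hs2 := resForm_symm h (k + 1)
  rw [hk] at hs1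
  rw [show ε * (-1) ^ (k + 1) = 1 by rw [pow_succ]; linear_combination hk] at hs2
  refine dsc_eq_of_map (by simpa using hs2) (by simpa using hs1) (RingEquiv.refl F)
    (a := -1) (by simp) f (by simpa using hf) ?_
  refine formRank_eq_of_map (ε := 1) hs1 (a := -1) (by simp) f hf fun v' => ?_
  obtain ⟨v, hv⟩ := hsurj v'
  exact ⟨v, by rw [hv]⟩

end Descent

theorem powRank_eq_of_equiv (θ : V ≃ₗ[F] V') {N : End F V} {N' : End F V'}
    (h : ∀ v, θ (N v) = N' (θ v)) (k : ℕ) : powRank N k = powRank N' k := by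
  have hk : ∀ v, θ ((N ^ k) v) = (N' ^ k) (θ v) := by
    intro v
    induction k with
    | zero => rfl
    | succ k ih => rw [pow_succ', pow_succ', Module.End.mul_apply, Module.End.mul_apply, h, ih]
  have : (range (N ^ k)).map θ.toLinearMap = range (N' ^ k) := by
    ext v
    constructor
    · rintro ⟨_, ⟨u, rfl⟩, rfl⟩; exact ⟨θ u, (hk u).symm⟩
    · rintro ⟨u, rfl⟩
      exact ⟨_, ⟨θ.symm u, rfl⟩, by
        have := hk (θ.symm u)
        rw [LinearEquiv.apply_symm_apply] at this
        exact this⟩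
  rw [powRank, powRank, ← this]
  exact (LinearEquiv.finrank_map_eq θ _).symm

/-- A complement of `ker (x - 1) ∩ range (x - 1)` in `ker (x - 1)`. -/
theorem IsTriple.exists_residual [Finite F] [FiniteDimensional F V] (h : IsTriple ε b x y) :
    ∃ W : Submodule F V, W ≤ ker (x - 1) ∧ W ⊓ range (x - 1) = ⊥ ∧
      W ⊔ (ker (x - 1) ⊓ range (x - 1)) = ker (x - 1) ∧ IsForm ε (restr b W) ∧
      finrank F W = formRank (resForm b x 0) ∧ (ε = 1 → dsc (restr b W) = dsc (resForm b x 0)) := by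
  obtain ⟨U, hU⟩ := Submodule.exists_isCompl (ker (x - 1) ⊓ range (x - 1))
  have hWr : (ker (x - 1) ⊓ U) ⊓ range (x - 1) = ⊥ := by
    rw [eq_bot_iff]
    rintro v ⟨⟨h1, h2⟩, h3⟩
    exact hU.disjoint.le_bot ⟨⟨h1, h3⟩, h2⟩
  have hsup : (ker (x - 1) ⊓ U) ⊔ (ker (x - 1) ⊓ range (x - 1)) = ker (x - 1) := by
    apply le_antisymm (sup_le inf_le_left inf_le_left)
    intro v hv
    have : v ∈ (ker (x - 1) ⊓ range (x - 1)) ⊔ U := by rw [hU.sup_eq_top]; trivial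
    obtain ⟨k, hk, d, hd, rfl⟩ := Submodule.mem_sup.1 this
    refine Submodule.mem_sup.2 ⟨d, ⟨?_, hd⟩, k, hk, add_comm _ _⟩
    have := Submodule.sub_mem _ hv hk.1
    simpa using this
  have horth : ∀ v ∈ ker (x - 1), ∀ u ∈ range (x - 1), b v u = 0 := fun v hv u hu => by
    rw [h.form.symm, (h.mem_range_iff 1 u).1 (by rwa [pow_one]) v (by rwa [pow_one]), mul_zero]
  have hform : IsForm ε (restr b (ker (x - 1) ⊓ U)) := by
    refine ⟨fun v w => h.form.symm _ _, fun v hv => ?_⟩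
    have : (v : V) ∈ range ((x - 1) ^ 1) := by
      rw [h.mem_range_iff]
      intro w hw
      rw [pow_one, ← hsup] at hw
      obtain ⟨w0, hw0, k, hk, rfl⟩ := Submodule.mem_sup.1 hw
      rw [map_add, horth _ v.2.1 k hk.2, add_zero]
      exact hv ⟨w0, hw0⟩
    rw [pow_one] at this
    have h0 : (v : V) ∈ (⊥ : Submodule F V) := by rw [← hWr]; exact ⟨v.2, this⟩
    exact Subtype.ext (by simpa using h0)
  have hmem : ∀ v : (ker (x - 1) ⊓ U : Submodule F V), (v : V) ∈ ker ((x - 1) ^ (0 + 1)) := by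
    intro v; rw [zero_add, pow_one]; exact v.2.1
  let f : (ker (x - 1) ⊓ U : Submodule F V) →ₗ[F] ker ((x - 1) ^ (0 + 1)) :=
    (Submodule.subtype _).codRestrict _ hmem
  have hs := resForm_symm h 0
  rw [pow_zero, mul_one] at hs
  have hr : formRank (restr b (ker (x - 1) ⊓ U)) = formRank (resForm b x 0) := by
    refine formRank_eq_of_map (ε := ε) hs one_ne_zero f
      (fun v w => by rw [one_mul]; rfl) fun v' => ?_
    have hv' : (v' : V) ∈ ker (x - 1) := by
      have h0 : ∀ a : V, a ∈ ker ((x - 1) ^ 1) → a ∈ ker (x - 1) := fun a ha => by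
        rwa [pow_one] at ha
      exact h0 _ v'.2
    have hv'' := hv'
    rw [← hsup] at hv'
    obtain ⟨w0, hw0, k, hk, hkw⟩ := Submodule.mem_sup.1 hv'
    refine ⟨⟨w0, hw0⟩, ?_⟩
    ext w
    have hw : (w : V) ∈ ker ((x - 1) ^ 1) := w.2
    change b w0 w = b (v' : V) w
    rw [← hkw, map_add, LinearMap.add_apply, (h.mem_range_iff 1 k).1 (by rw [pow_one]; exact hk.2)
      w hw, add_zero]
  refine ⟨ker (x - 1) ⊓ U, inf_le_left, hWr, hsup, hform, by rw [← hform.formRank_eq, hr], ?_⟩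
  rintro rfl
  rw [dsc_eq_of_map (by simpa using hform.symm) (by simpa using hs) (RingEquiv.refl F) one_ne_zero f
    (fun v w => by rw [one_mul]; rfl) hr, qchi_one]
  simp

/-- Gluing an isometry of the ranges of `x - 1` with an isometry of the residual spaces. -/
theorem isometric_of_descend [FiniteDimensional F V] [FiniteDimensional F V'] (h2 : (2 : F) ≠ 0)
    {b' : V' →ₗ[F] V' →ₗ[F] F} {x' y' : End F V'} (hε : ε * ε = 1)
    (h : IsTriple ε b x y) (h' : IsTriple ε b' x' y') (hx : Function.Injective ⇑(x + 1))
    (hdim : finrank F V = finrank F V')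
    {b₁ : range (x - 1) →ₗ[F] range (x - 1) →ₗ[F] F}
    (hb₁ : ∀ (u : range (x - 1)) (v : V), (u : V) = skewPart x y v → ∀ w, b₁ u w = b v w)
    {b₁' : range (x' - 1) →ₗ[F] range (x' - 1) →ₗ[F] F}
    (hb₁' : ∀ (u : range (x' - 1)) (v : V'), (u : V') = skewPart x' y' v → ∀ w, b₁' u w = b' v w)
    (f₁ : range (x - 1) ≃ₗ[F] range (x' - 1))
    (hf₁ : ∀ v, f₁ (x.restrict h.map_range v) = x'.restrict h'.map_range (f₁ v))
    (hf₁b : ∀ v w, b₁' (f₁ v) (f₁ w) = b₁ v w)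
    {W : Submodule F V} {W' : Submodule F V'} (hWk : W ≤ ker (x - 1)) (hWk' : W' ≤ ker (x' - 1))
    (hWr : W ⊓ range (x - 1) = ⊥) (hWsup : W ⊔ (ker (x - 1) ⊓ range (x - 1)) = ker (x - 1))
    (hWf : IsForm ε (restr b W)) (hWf' : IsForm ε (restr b' W'))
    (ω : W ≃ₗ[F] W') (hω : ∀ v w, restr b' W' (ω v) (ω w) = restr b W v w) :
    Isometric b x b' x' := by
  have horth : ∀ v ∈ ker (x - 1), ∀ u ∈ range (x - 1), b u v = 0 := fun v hv u hu =>
    (h.mem_range_iff 1 u).1 (by rwa [pow_one]) v (by rwa [pow_one])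
  have horth' : ∀ v ∈ ker (x' - 1), ∀ u ∈ range (x' - 1), b' u v = 0 := fun v hv u hu =>
    (h'.mem_range_iff 1 u).1 (by rwa [pow_one]) v (by rwa [pow_one])
  -- The map `p` records the two conditions on the wanted `f`: `(x' - 1) (f v)` must be `f₁ ((x - 1)
  -- v)`, and `f v` must pair with `W'` as `v` does with `W`. A lift of `H` through `p` that extends
  -- `f₁` and `ω` satisfies both.
  let p : V' →ₗ[F] range (x' - 1) × Dual F W :=
    (x' - 1).rangeRestrict.prod ((Module.Dual.transpose (W'.subtype ∘ₗ ω.toLinearMap)) ∘ₗ b')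
  have hp1 : ∀ v, ((p v).1 : V') = (x' - 1) v := fun v => rfl
  have hp2 : ∀ v w, (p v).2 w = b' v (ω w) := fun v w => rfl
  let H : V →ₗ[F] range (x' - 1) × Dual F W :=
    (f₁.toLinearMap ∘ₗ (x - 1).rangeRestrict).prod ((Module.Dual.transpose W.subtype) ∘ₗ b)
  have hH1 : ∀ v, (H v).1 = f₁ ⟨(x - 1) v, v, rfl⟩ := fun v => rfl
  have hH2 : ∀ v w, (H v).2 w = b v w := fun v w => rfl
  let i : range (x - 1) × W →ₗ[F] V := (range (x - 1)).subtype.coprod W.subtype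
  let l : range (x - 1) × W →ₗ[F] V' :=
    ((range (x' - 1)).subtype ∘ₗ f₁.toLinearMap).coprod (W'.subtype ∘ₗ ω.toLinearMap)
  have hi : Function.Injective i := by
    rw [injective_iff_map_eq_zero]
    rintro ⟨u, w⟩ huw
    have h1 : (u : V) + w = 0 := huw
    have h3 : (w : V) = 0 := by
      have : (w : V) ∈ W ⊓ range (x - 1) := by
        refine ⟨w.2, ?_⟩
        rw [eq_neg_of_add_eq_zero_right h1]
        exact neg_mem u.2
      rw [hWr] at this
      simpa using this
    have h4 : (u : V) = 0 := by rwa [h3, add_zero] at h1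
    exact Prod.ext (Subtype.ext h4) (Subtype.ext h3)
  have hp : Function.Surjective p := by
    rintro ⟨⟨_, v₀, rfl⟩, φ⟩
    obtain ⟨w', hw'⟩ := hWf'.exists_eq ((φ - (p v₀).2) ∘ₗ ω.symm.toLinearMap)
    refine ⟨v₀ + w', Prod.ext (Subtype.ext ?_) (LinearMap.ext fun w => ?_)⟩
    · rw [hp1, map_add, LinearMap.mem_ker.1 (hWk' w'.2), add_zero]
    · have := LinearMap.congr_fun hw' (ω w)
      simp only [restr_apply, LinearMap.comp_apply, LinearEquiv.coe_coe,
        LinearEquiv.symm_apply_apply, LinearMap.sub_apply] at this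
      rw [hp2, map_add, LinearMap.add_apply, this, hp2]
      ring
  have hfN : ∀ u : range (x - 1), (x' - 1) (f₁ u)
      = f₁ ⟨(x - 1) u, (u : V), rfl⟩ := fun u => by
    have h1 := congrArg Subtype.val (hf₁ u)
    have h3 : (⟨(x - 1) u, (u : V), rfl⟩ : range (x - 1)) = x.restrict h.map_range u - u :=
      Subtype.ext rfl
    rw [h3, map_sub, Submodule.coe_sub, h1]; rfl
  obtain ⟨f, hf, hfl⟩ := exists_lift_of_surjective p hp i hi H l (by
    rintro ⟨u, w⟩
    refine Prod.ext (Subtype.ext ?_) (LinearMap.ext fun w' => ?_)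
    · rw [hp1, hH1]
      change (x' - 1) ((f₁ u : V') + ω w) = f₁ ⟨(x - 1) ((u : V) + w), _⟩
      rw [map_add, LinearMap.mem_ker.1 (hWk' (ω w).2), add_zero, hfN]
      congr 3
      rw [map_add, LinearMap.mem_ker.1 (hWk w.2), add_zero]
    · rw [hp2, hH2]
      change b' ((f₁ u : V') + ω w) (ω w') = b ((u : V) + w) w'
      rw [map_add, map_add, LinearMap.add_apply, LinearMap.add_apply,
        horth' _ (hWk' (ω w').2) _ (f₁ u).2, horth _ (hWk w'.2) _ u.2, zero_add, zero_add]
      exact hω w w')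
  have hf1 : ∀ v, (x' - 1) (f v) = f₁ ⟨(x - 1) v, v, rfl⟩ := fun v => by
    rw [← hp1, hf, hH1]
  have hf2 : ∀ v w, b' (f v) (ω w) = b v w := fun v w => by
    rw [← hp2, hf, hH2]
  have hf3 : ∀ u : range (x - 1), f u = f₁ u := fun u => by
    have := hfl (u, 0)
    simpa [i, l] using this
  have hf4 : ∀ w : W, f w = ω w := fun w => by
    have := hfl (0, w)
    simpa [i, l] using this
  have hfN' : ∀ v, (x' - 1) (f v) = f ((x - 1) v) := fun v => by
    rw [hf1, ← hf3]
  have hfx : ∀ v, x' (f v) = f (x v) := fun v => by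
    have := hfN' v
    simp only [LinearMap.sub_apply, Module.End.one_apply, map_sub] at this
    exact sub_left_injective this
  have hfy : ∀ v, y' (f v) = f (y v) := fun v => by
    have := congrArg y' (hfx (y v))
    rw [h'.yx_apply, h.xy_apply] at this
    exact this.symm
  have hfs : ∀ v, skewPart x' y' (f v) = f (skewPart x y v) := fun v => by
    simp [skewPart, hfx, hfy]
  have hmem : ∀ v, skewPart x y v ∈ range (x - 1) := fun v => by
    rw [← h.range_skewPart h2 hx]; exact ⟨v, rfl⟩
  -- The failure of `f` to be isometric. It vanishes on `range (x - 1)`, where the forms are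
  -- governed by `b₁` and `b₁'`, and on `W`.
  let D : V →ₗ[F] V →ₗ[F] F := b'.compl₁₂ f f - b
  have hD : ∀ v w, b' (f v) (f w) = b v w + D v w := fun v w => by simp [D]
  have hDsymm : ∀ v w, D v w = ε * D w v := fun v w => by
    simp only [D, LinearMap.sub_apply, LinearMap.compl₁₂_apply]
    rw [h'.form.symm, h.form.symm v w]; ring
  have hD1 : ∀ v, ∀ u ∈ range (x - 1), D v u = 0 := by
    intro v u hu
    obtain ⟨w, hw⟩ := h.exists_skewPart h2 hx ⟨u, hu⟩
    change u = skewPart x y w at hw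
    subst hw
    have e1 := hb₁ ⟨skewPart x y v, hmem v⟩ v rfl ⟨skewPart x y w, hmem w⟩
    have e2 := hb₁' (f₁ ⟨skewPart x y v, hmem v⟩) (f v) (by rw [hfs, ← hf3])
      (f₁ ⟨skewPart x y w, hmem w⟩)
    rw [hf₁b, e1, ← hf3] at e2
    have e3 := hD v (skewPart x y w)
    rw [← e2] at e3
    simpa using e3
  have hD2 : ∀ v, ∀ w ∈ W, D v w = 0 := by
    intro v w hw
    have e := hD v w
    rw [hf4 ⟨w, hw⟩, hf2] at e
    simpa using e
  have hbinj : Function.Injective b := by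
    rw [injective_iff_map_eq_zero]
    intro v hv
    exact h.form.nondeg v fun w => by rw [hv]; rfl
  let B : V ≃ₗ[F] Dual F V := LinearMap.linearEquivOfInjective b hbinj
    (Subspace.dual_finrank_eq (K := F) (V := V)).symm
  -- The operator representing half of `D`. The vanishing of `D` places its values in `ker (x - 1) ⊓
  -- range (x - 1)` and makes it kill `range (x - 1)`; hence it commutes with `x`.
  let η : V →ₗ[F] V := B.symm.toLinearMap ∘ₗ ((2 : F)⁻¹ • D)
  have hη : ∀ v w, b (η v) w = (2 : F)⁻¹ * D v w := fun v w => by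
    have : B (η v) = (2 : F)⁻¹ • D v := by simp [η]
    exact LinearMap.congr_fun this w
  have hηk : ∀ v, (x - 1) (η v) = 0 := fun v => h.mem_ker_of_orth fun w => by
    rw [hη, hD1 v _ ⟨w, rfl⟩, mul_zero]
  have hηr : ∀ v, η v ∈ range (x - 1) := fun v => by
    have : η v ∈ W ⊔ (ker (x - 1) ⊓ range (x - 1)) := by rw [hWsup]; exact hηk v
    obtain ⟨w, hw, k, hk, hwk⟩ := Submodule.mem_sup.1 this
    have hw0 : (⟨w, hw⟩ : W) = 0 := by
      refine hWf.nondeg _ fun w' => ?_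
      have e := hη v w'
      rw [← hwk, map_add, LinearMap.add_apply, horth _ (hWk w'.2) _ hk.2, hD2 _ _ w'.2, add_zero,
        mul_zero] at e
      exact e
    have hw0' : w = 0 := congrArg Subtype.val hw0
    rw [← hwk, hw0', zero_add]; exact hk.2
  have hη0 : ∀ v, η ((x - 1) v) = 0 := fun v => h.form.nondeg _ fun w => by
    rw [hη, hDsymm, hD1 w _ ⟨v, rfl⟩, mul_zero, mul_zero]
  -- First-order correction, which is exact: the cross terms `b (η v) w` and `b v (η w)` each equal
  -- half of `D v w`, and the terms of second order vanish.
  let Θ : V →ₗ[F] V' := f ∘ₗ (1 - η)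
  have hΘ : ∀ v w, b' (Θ v) (Θ w) = b v w := fun v w => by
    change b' (f (v - η v)) (f (w - η w)) = b v w
    rw [hD]
    have e1 : D (v - η v) (w - η w) = D v w := by
      rw [map_sub (D (v - η v)), hD1 _ _ (hηr w), sub_zero, hDsymm, map_sub, hD1 _ _ (hηr v),
        sub_zero, hDsymm w, ← mul_assoc, hε, one_mul]
    have e2 : b (η v) (η w) = 0 := by rw [hη, hD1 _ _ (hηr w), mul_zero]
    have e3 : b v (η w) = (2 : F)⁻¹ * D v w := by
      rw [h.form.symm, hη, hDsymm w, mul_left_comm, ← mul_assoc ε, hε, one_mul]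
    rw [e1, map_sub, map_sub, LinearMap.sub_apply, LinearMap.sub_apply, e2, e3, hη]
    field_simp; ring
  have hΘinj : Function.Injective Θ := by
    rw [injective_iff_map_eq_zero]
    intro v hv
    refine h.form.nondeg v fun w => ?_
    rw [← hΘ, hv]; simp
  refine ⟨LinearMap.linearEquivOfInjective Θ hΘinj hdim, fun v => ?_, fun v w => hΘ v w⟩
  change Θ (x v) = x' (Θ v)
  change f (x v - η (x v)) = x' (f (v - η v))
  rw [hfx]
  congr 1
  have e1 := hη0 v
  have e2 := hηk v
  simp only [LinearMap.sub_apply, Module.End.one_apply, map_sub] at e1 e2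
  rw [map_sub, sub_eq_zero.1 e1, sub_eq_zero.1 e2]

/-- Induction on dimension, for both symmetries at once since descent exchanges them. If `x - 1` is
injective, so is `x - y`, and the norm argument applies. Otherwise `range (x - 1)` is smaller and is
settled by induction; the residual space of index 0 is settled by dimension and discriminant if
symmetric, by dimension alone if alternating; then the two isometries are glued. -/
theorem isometric_of_dsc_eq [Finite F] (h2 : (2 : F) ≠ 0) : ∀ (n : ℕ) {V V' : Type u}
    [AddCommGroup V] [Module F V] [AddCommGroup V'] [Module F V'] [FiniteDimensional F V]
    [FiniteDimensional F V'] {ε : F} {b : V →ₗ[F] V →ₗ[F] F} {x y : End F V}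
    {b' : V' →ₗ[F] V' →ₗ[F] F} {x' y' : End F V'}
    (_ : finrank F V = n) (_ : ε = 1 ∨ ε = -1) (_ : IsTriple ε b x y) (_ : IsTriple ε b' x' y')
    (_ : Function.Injective ⇑(x + 1)) (_ : Function.Injective ⇑(x' + 1))
    (θ : V ≃ₗ[F] V') (_ : ∀ v, θ (x v) = x' (θ v))
    (_ : ∀ k : ℕ, ε * (-1) ^ k = 1 → dsc (resForm b x k) = dsc (resForm b' x' k)),
    Isometric b x b' x' := by
  intro n
  induction n using Nat.strong_induction_on with
  | _ n ih =>
  intro V V' _ _ _ _ _ _ ε b x y b' x' y' hn hε h h' hx hx' θ hθ hdsc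
  have hεε : ε * ε = 1 := by rcases hε with rfl | rfl <;> simp
  have hθN : ∀ v, θ ((x - 1) v) = (x' - 1) (θ v) := fun v => by simp [hθ]
  have hθy : ∀ v, θ (y v) = y' (θ v) := fun v => by
    rw [← h'.yx_apply (θ (y v)), ← hθ, h.xy_apply]
  by_cases hN : Function.Injective ⇑(x - 1)
  · let b₂ : V →ₗ[F] V →ₗ[F] F := b'.compl₁₂ θ.toLinearMap θ.toLinearMap
    have hb₂ : ∀ v w, b₂ v w = b' (θ v) (θ w) := fun v w => rfl
    have hT : IsTriple ε b₂ x y := by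
      refine ⟨⟨fun v w => h'.form.symm _ _, fun v hv => ?_⟩, h.xy, h.yx, fun v w => ?_⟩
      · rw [← θ.map_eq_zero_iff]
        refine h'.form.nondeg _ fun w => ?_
        rw [← hv (θ.symm w), hb₂, LinearEquiv.apply_symm_apply]
      · rw [hb₂, hθ, hθ, h'.isom, hb₂]
    have hs : Function.Injective ⇑(x - y) := by
      rw [injective_iff_map_eq_zero]
      intro v hv
      have : skewPart x y v = 0 := by rw [skewPart, LinearMap.smul_apply, hv, smul_zero]
      rw [h.skewPart_eq_zero_iff h2 hx] at this
      exact (injective_iff_map_eq_zero _).1 hN v this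
    exact (exists_isometry_of_injective h2 hεε h hT hs).symm.trans ⟨θ, hθ, fun v w => rfl⟩
  · have hlt : finrank F (range (x - 1)) < n := by
      rw [← hn]
      apply Submodule.finrank_lt
      intro htop
      exact hN (LinearMap.injective_iff_surjective.2 (LinearMap.range_eq_top.1 htop))
    obtain ⟨b₁, hb₁⟩ := h.exists_descend h2 hx
    obtain ⟨b₁', hb₁'⟩ := h'.exists_descend h2 hx'
    have hrank : ∀ k, formRank (resForm b x k) = formRank (resForm b' x' k) := fun k => by
      have e1 := formRank_resForm h k
      have e2 := formRank_resForm h' k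
      rw [powRank_eq_of_equiv θ hθN, powRank_eq_of_equiv θ hθN, powRank_eq_of_equiv θ hθN] at e1
      omega
    have hmap : (range (x - 1)).map θ.toLinearMap = range (x' - 1) := by
      ext v
      constructor
      · rintro ⟨_, ⟨u, rfl⟩, rfl⟩; exact ⟨θ u, (hθN u).symm⟩
      · rintro ⟨u, rfl⟩
        refine ⟨_, ⟨θ.symm u, rfl⟩, ?_⟩
        change θ _ = _
        rw [hθN, LinearEquiv.apply_symm_apply]
    have hinj : ∀ {V : Type u} [AddCommGroup V] [Module F V] {x : End F V}
        (hx : Function.Injective ⇑(x + 1)) {W : Submodule F V} (hW : ∀ v ∈ W, x v ∈ W),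
        Function.Injective ⇑(x.restrict hW + 1) := by
      intro V _ _ x hx W hW v w hvw
      exact Subtype.ext (hx (congrArg Subtype.val hvw))
    obtain ⟨f₁, hf₁, hf₁b⟩ := ih _ hlt (ε := -ε) rfl (by rcases hε with rfl | rfl <;> simp)
      (h.descend h2 hx hb₁) (h'.descend h2 hx' hb₁') (hinj hx _) (hinj hx' _)
      ((θ.submoduleMap (range (x - 1))).trans (LinearEquiv.ofEq _ _ hmap))
      (fun v => Subtype.ext (hθ v)) (fun k hk => by
        rw [h.dsc_resForm_descend h2 hx hb₁ k hk, h'.dsc_resForm_descend h2 hx' hb₁' k hk, hrank,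
          hdsc (k + 1) (by rw [pow_succ]; linear_combination hk)])
    obtain ⟨W, hWk, hWr, hWsup, hWf, hWd, hWdsc⟩ := h.exists_residual
    obtain ⟨W', hWk', -, -, hWf', hWd', hWdsc'⟩ := h'.exists_residual
    have hWW : Isometric (restr b W) 1 (restr b' W') 1 := by
      rcases hε with rfl | rfl
      · exact isometric_one_of_symmetric h2 _ hWf hWf' rfl (by rw [hWd, hWd', hrank])
          (by rw [hWdsc rfl, hWdsc' rfl, hdsc 0 (by simp)])
      · exact isometric_one_of_alternating h2 _ hWf hWf' rfl (by rw [hWd, hWd', hrank])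
    obtain ⟨ω, -, hω⟩ := hWW
    exact isometric_of_descend h2 hεε h h' hx θ.finrank_eq hb₁ hb₁' f₁ hf₁ hf₁b hWk hWk' hWr
      hWsup hWf hWf' ω hω

end Classification

/-! ### Separating the eigenvalues 1 and -1 -/

section Fitting

open Module LinearMap

variable {F : Type*} [Field F] {V V' V'' : Type u} [AddCommGroup V] [Module F V]
  [AddCommGroup V'] [Module F V'] [AddCommGroup V''] [Module F V'']

variable {ε : F} {b : V →ₗ[F] V →ₗ[F] F} {x y : End F V}

theorem IsTriple.neg (h : IsTriple ε b x y) : IsTriple ε b (-x) (-y) :=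
  ⟨h.form, by rw [neg_mul_neg, h.xy], by rw [neg_mul_neg, h.yx], fun v w => by simp [h.isom]⟩

theorem Isometric.neg {b' : V' →ₗ[F] V' →ₗ[F] F} {x' : End F V'} (h : Isometric b (-x) b' (-x')) :
    Isometric b x b' x' := by
  obtain ⟨θ, h1, h2⟩ := h
  exact ⟨θ, fun v => by simpa using h1 v, h2⟩

theorem mem_of_commute_range {N x : End F V} (h : Commute x N) (k : ℕ) :
    ∀ v ∈ range (N ^ k), x v ∈ range (N ^ k) := by
  rintro _ ⟨u, rfl⟩
  exact ⟨x u, (LinearMap.congr_fun (h.pow_right k).eq u).symm⟩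

theorem mem_of_commute_ker {N x : End F V} (h : Commute x N) (k : ℕ) :
    ∀ v ∈ ker (N ^ k), x v ∈ ker (N ^ k) := by
  intro v hv
  rw [LinearMap.mem_ker] at hv ⊢
  have := LinearMap.congr_fun (h.pow_right k).eq v
  rw [Module.End.mul_apply, Module.End.mul_apply, hv, map_zero] at this
  exact this.symm

theorem IsTriple.restrict (h : IsTriple ε b x y) {A B : Submodule F V} (hAB : IsCompl A B)
    (hx : ∀ v ∈ A, x v ∈ A) (hy : ∀ v ∈ A, y v ∈ A) (h1 : ∀ w ∈ A, ∀ u ∈ B, b w u = 0) :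
    IsTriple ε (restr b A) (x.restrict hx) (y.restrict hy) := by
  refine ⟨isForm_restr_of_isCompl h.form hAB h1, ?_, ?_, fun v w => h.isom _ _⟩
  · ext v; exact h.xy_apply _
  · ext v; exact h.yx_apply _

/-- The residual form only sees the kernel of `(x - 1) ^ (k + 1)`, so it is unaffected by passing to
an orthogonal summand containing that kernel. -/
theorem IsTriple.dsc_resForm_restrict [Finite F] [FiniteDimensional F V] (h : IsTriple ε b x y)
    {A B : Submodule F V} (hAB : IsCompl A B) (hx : ∀ v ∈ A, x v ∈ A) (hy : ∀ v ∈ A, y v ∈ A)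
    (h1 : ∀ w ∈ A, ∀ u ∈ B, b w u = 0) {k : ℕ} (hk : ε * (-1) ^ k = 1)
    (hker : ker ((x - 1) ^ (k + 1)) ≤ A) :
    dsc (resForm (restr b A) (x.restrict hx) k) = dsc (resForm b x k) := by
  have hA := h.restrict hAB hx hy h1
  have hmem : ∀ v : ker ((x.restrict hx - 1) ^ (k + 1)), ((v : A) : V) ∈ ker ((x - 1) ^ (k + 1)) := by
    intro v
    rw [LinearMap.mem_ker, ← coe_restrict_sub_one_pow hx, LinearMap.mem_ker.1 v.2]
    rfl
  let f : ker ((x.restrict hx - 1) ^ (k + 1)) →ₗ[F] ker ((x - 1) ^ (k + 1)) :=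
    (A.subtype ∘ₗ Submodule.subtype _).codRestrict _ hmem
  have hf : ∀ v w, resForm b x k (f v) (f w)
      = 1 * resForm (restr b A) (x.restrict hx) k v w := by
    intro v w
    rw [resForm_apply, resForm_apply, one_mul, restr_apply, coe_restrict_sub_one_pow]
    rfl
  have hsurj : Function.Surjective f := by
    rintro ⟨v, hv⟩
    refine ⟨⟨⟨v, hker hv⟩, ?_⟩, rfl⟩
    rw [LinearMap.mem_ker]
    apply Subtype.ext
    rw [coe_restrict_sub_one_pow]
    exact hv
  have hs1 := resForm_symm hA k
  have hs2 := resForm_symm h k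
  rw [hk] at hs1 hs2
  rw [dsc_eq_of_map (b' := resForm b x k) (by simpa using hs1) (by simpa using hs2)
    (RingEquiv.refl F) one_ne_zero f hf (formRank_eq_of_map (ε := 1) hs2 one_ne_zero f hf
      fun v' => ?_), qchi_one, one_pow, one_mul]
  obtain ⟨v, rfl⟩ := hsurj v'
  exact ⟨v, rfl⟩

theorem injective_restrict_add_one {x : End F V} {A : Submodule F V} (hx : ∀ v ∈ A, x v ∈ A)
    (h : ∀ v ∈ A, x v + v = 0 → v = 0) : Function.Injective ⇑(x.restrict hx + 1) := by
  rw [injective_iff_map_eq_zero]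
  rintro ⟨v, hv⟩ h0
  exact Subtype.ext (h v hv (congrArg Subtype.val h0))

/-- Two symplectic spaces with isometries are isomorphic if the underlying modules are isomorphic
and the discriminants of the residual forms for the eigenvalues `1` and `-1` agree. -/
theorem isometric_of_equiv [Finite F] [FiniteDimensional F V] [FiniteDimensional F V']
    (h2 : (2 : F) ≠ 0) {b' : V' →ₗ[F] V' →ₗ[F] F} {x' y' : End F V'}
    (h : IsTriple (-1) b x y) (h' : IsTriple (-1) b' x' y')
    (θ : V ≃ₗ[F] V') (hθ : ∀ v, θ (x v) = x' (θ v))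
    (hd : ∀ k : ℕ, Odd k → dsc (resForm b x k) = dsc (resForm b' x' k))
    (hd' : ∀ k : ℕ, Odd k → dsc (resForm b (-x) k) = dsc (resForm b' (-x') k)) :
    Isometric b x b' x' := by
  have hodd : ∀ k : ℕ, (-1 : F) * (-1) ^ k = 1 → Odd k := by
    intro k hk
    by_contra hk'
    rw [Nat.not_odd_iff_even] at hk'
    rw [hk'.neg_one_pow] at hk
    apply h2
    linear_combination -hk
  have hodd' : ∀ k : ℕ, Odd k → (-1 : F) * (-1) ^ k = 1 := by
    intro k hk
    rw [hk.neg_one_pow]; norm_num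
  have hcN : ∀ {V : Type u} [AddCommGroup V] [Module F V] (x : End F V), Commute x (-x - 1) :=
    fun x => ((Commute.refl x).neg_right).sub_right (Commute.one_right x)
  have hcN' : ∀ {V : Type u} [AddCommGroup V] [Module F V] {b : V →ₗ[F] V →ₗ[F] F} {x y : End F V}
      (_ : IsTriple (-1) b x y), Commute y (-x - 1) :=
    fun h => (h.commute.symm.neg_right).sub_right (Commute.one_right _)
  have hθN : ∀ (n : ℕ) (v : V), θ (((-x - 1) ^ n) v) = ((-x' - 1) ^ n) (θ v) := by
    intro n v
    induction n with
    | zero => rfl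
    | succ n ih =>
      rw [pow_succ', pow_succ', Module.End.mul_apply, Module.End.mul_apply, ← ih]
      simp [hθ]
  have hfin := θ.finrank_eq
  set n := finrank F V with hn
  -- Fitting decomposition of `-x - 1`. On the range `x + 1` is injective, so the classification
  -- applies to `x`; on the kernel `x - 1` is injective, so it applies to `-x`.
  have hcompl : ∀ {V : Type u} [AddCommGroup V] [Module F V] [FiniteDimensional F V] (N : End F V)
      (_ : finrank F V = n), IsCompl (range (N ^ n)) (ker (N ^ n)) := by
    intro V _ _ _ N hN
    have hle : ∀ j, ker (N ^ j) ≤ ker (N ^ n) := fun j => by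
      rw [← hN]; exact Module.End.ker_pow_le_ker_pow_finrank N j
    have hdis : Disjoint (range (N ^ n)) (ker (N ^ n)) := by
      rw [Submodule.disjoint_def]
      rintro _ ⟨u, rfl⟩ hu
      have : u ∈ ker (N ^ (n + n)) := by
        rw [LinearMap.mem_ker, pow_add, Module.End.mul_apply]; exact hu
      exact LinearMap.mem_ker.1 (hle _ this)
    refine ⟨hdis, codisjoint_iff.2 (Submodule.eq_top_of_disjoint _ _ ?_ hdis)⟩
    rw [LinearMap.finrank_range_add_finrank_ker]
  have key : ∀ {V : Type u} [AddCommGroup V] [Module F V] [FiniteDimensional F V]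
      {b : V →ₗ[F] V →ₗ[F] F} {x y : End F V} (_ : IsTriple (-1) b x y) (_ : finrank F V = n),
      (∀ v ∈ range ((-x - 1) ^ n), ∀ w ∈ ker ((-x - 1) ^ n), b v w = 0) ∧
      (∀ w ∈ ker ((-x - 1) ^ n), ∀ v ∈ range ((-x - 1) ^ n), b w v = 0) ∧
      (∀ v ∈ range ((-x - 1) ^ n), x v + v = 0 → v = 0) ∧
      (∀ v ∈ ker ((-x - 1) ^ n), -x v + v = 0 → v = 0) ∧
      (∀ k, ker ((x - 1) ^ (k + 1)) ≤ range ((-x - 1) ^ n)) ∧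
      (∀ k, ker ((-x - 1) ^ (k + 1)) ≤ ker ((-x - 1) ^ n)) := by
    intro V _ _ _ b x y h hV
    have h1 : ∀ v ∈ range ((-x - 1) ^ n), ∀ w ∈ ker ((-x - 1) ^ n), b v w = 0 := fun v hv w hw =>
      (h.neg.mem_range_iff n v).1 hv w hw
    have hle : ∀ j, ker ((-x - 1) ^ j) ≤ ker ((-x - 1) ^ n) := fun j => by
      rw [← hV]; exact Module.End.ker_pow_le_ker_pow_finrank _ j
    have h4 : ∀ v ∈ ker ((-x - 1) ^ n), -x v + v = 0 → v = 0 := by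
      intro v hv hv'
      have hxv : (-x - 1) v = (-2 : F) • v := by
        have : x v = v := by rw [neg_add_eq_zero] at hv'; exact hv'
        simp only [LinearMap.sub_apply, LinearMap.neg_apply, this, Module.End.one_apply]
        module
      have : ∀ j, ((-x - 1) ^ j) v = (-2 : F) ^ j • v := by
        intro j
        induction j with
        | zero => simp
        | succ j ih => rw [pow_succ', Module.End.mul_apply, ih, map_smul, hxv, smul_smul, pow_succ]
      rw [LinearMap.mem_ker, this] at hv
      exact (smul_eq_zero.1 hv).resolve_left (pow_ne_zero _ (neg_ne_zero.2 h2))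
    refine ⟨h1, fun w hw v hv => by rw [h.form.symm, h1 v hv w hw, mul_zero], ?_, h4, ?_,
      fun k => hle _⟩
    · intro v hv hv'
      have : v ∈ ker ((-x - 1) ^ 1) := by
        rw [pow_one, LinearMap.mem_ker]
        simp only [LinearMap.sub_apply, LinearMap.neg_apply, Module.End.one_apply]
        rw [← neg_eq_zero, ← hv']; abel
      exact (Submodule.disjoint_def.1 (hcompl (-x - 1) hV).disjoint) v hv (hle _ this)
    · intro k v hv
      have hvt : v ∈ range ((-x - 1) ^ n) ⊔ ker ((-x - 1) ^ n) := by
        rw [(hcompl (-x - 1) hV).sup_eq_top]; trivial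
      -- The component `c` is killed by powers of both `x - 1` and `x + 1`, hence is zero, 2 being
      -- invertible.
      obtain ⟨a, ha, c, hc, rfl⟩ := Submodule.mem_sup.1 hvt
      have hcx : Commute (x - 1) (-x - 1) :=
        ((hcN x).sub_left (Commute.one_left _))
      have hinv : ∀ j : ℕ, ((x - 1) ^ j) c ∈ ker ((-x - 1) ^ n) := fun j =>
        mem_of_commute_ker (hcx.pow_left j) n c hc
      have hinv' : ∀ j : ℕ, ((x - 1) ^ j) a ∈ range ((-x - 1) ^ n) := fun j =>
        mem_of_commute_range (hcx.pow_left j) n a ha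
      have hc0 : ((x - 1) ^ (k + 1)) c = 0 := by
        have h0 : ((x - 1) ^ (k + 1)) a + ((x - 1) ^ (k + 1)) c = 0 := by
          rw [← map_add]; exact hv
        refine (Submodule.disjoint_def.1 (hcompl (-x - 1) hV).disjoint) _ ?_ (hinv _)
        rw [eq_neg_of_add_eq_zero_right h0]
        exact neg_mem (hinv' _)
      have hcz : ∀ j : ℕ, ((x - 1) ^ j) c = 0 → c = 0 := by
        intro j
        induction j with
        | zero => intro hj; simpa using hj
        | succ j ih =>
          intro hj
          apply ih
          refine h4 _ (hinv j) ?_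
          rw [pow_succ', Module.End.mul_apply] at hj
          simp only [LinearMap.sub_apply, Module.End.one_apply] at hj
          rw [← neg_eq_zero, ← hj]; abel
      rw [hcz _ hc0, add_zero]; exact ha
  obtain ⟨o1, o2, i1, i2, k1, k2⟩ := key h hn.symm
  obtain ⟨o1', o2', i1', i2', k1', k2'⟩ := key h' hfin.symm
  have c := hcompl (-x - 1) hn.symm
  have c' := hcompl (-x' - 1) hfin.symm
  have mapA : (range ((-x - 1) ^ n)).map θ.toLinearMap = range ((-x' - 1) ^ n) := by
    ext v
    constructor
    · rintro ⟨_, ⟨u, rfl⟩, rfl⟩; exact ⟨θ u, (hθN n u).symm⟩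
    · rintro ⟨u, rfl⟩
      refine ⟨_, ⟨θ.symm u, rfl⟩, ?_⟩
      change θ _ = _
      rw [hθN, LinearEquiv.apply_symm_apply]
  have mapB : (ker ((-x - 1) ^ n)).map θ.toLinearMap = ker ((-x' - 1) ^ n) := by
    ext v
    constructor
    · rintro ⟨u, hu, rfl⟩
      rw [LinearMap.mem_ker]
      change ((-x' - 1) ^ n) (θ u) = 0
      rw [← hθN, LinearMap.mem_ker.1 hu, map_zero]
    · intro hv
      refine ⟨θ.symm v, ?_, θ.apply_symm_apply v⟩
      rw [SetLike.mem_coe, LinearMap.mem_ker, ← θ.map_eq_zero_iff, hθN,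
        LinearEquiv.apply_symm_apply]
      exact hv
  have invA := mem_of_commute_range (hcN x) n
  have invA' := mem_of_commute_range (hcN x') n
  have invAy := mem_of_commute_range (hcN' h) n
  have invAy' := mem_of_commute_range (hcN' h') n
  have invB := mem_of_commute_ker (hcN x) n
  have invB' := mem_of_commute_ker (hcN x') n
  have invBn := mem_of_commute_ker (hcN x).neg_left n
  have invBn' := mem_of_commute_ker (hcN x').neg_left n
  have invBy := mem_of_commute_ker (hcN' h).neg_left n
  have invBy' := mem_of_commute_ker (hcN' h').neg_left n
  have isoA : Isometric (restr b _) (x.restrict invA) (restr b' _) (x'.restrict invA') :=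
    isometric_of_dsc_eq h2 _ rfl (Or.inr rfl) (h.restrict c invA invAy o1)
      (h'.restrict c' invA' invAy' o1') (injective_restrict_add_one _ i1)
      (injective_restrict_add_one _ i1')
      ((θ.submoduleMap _).trans (LinearEquiv.ofEq _ _ mapA)) (fun v => Subtype.ext (hθ v))
      (fun k hk => by
        rw [h.dsc_resForm_restrict c invA invAy o1 hk (k1 k),
          h'.dsc_resForm_restrict c' invA' invAy' o1' hk (k1' k), hd k (hodd k hk)])
  have isoB : Isometric (restr b _) ((-x).restrict invBn) (restr b' _) ((-x').restrict invBn') :=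
    isometric_of_dsc_eq h2 _ rfl (Or.inr rfl) (h.neg.restrict c.symm invBn invBy o2)
      (h'.neg.restrict c'.symm invBn' invBy' o2') (injective_restrict_add_one _ i2)
      (injective_restrict_add_one _ i2')
      ((θ.submoduleMap _).trans (LinearEquiv.ofEq _ _ mapB))
      (fun v => Subtype.ext (by
        change θ ((-x) v) = (-x') (θ v)
        simp [hθ]))
      (fun k hk => by
        rw [h.neg.dsc_resForm_restrict c.symm invBn invBy o2 hk (k2 k),
          h'.neg.dsc_resForm_restrict c'.symm invBn' invBy' o2' hk (k2' k), hd' k (hodd k hk)])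
  have isoB' : Isometric (restr b _) (x.restrict invB) (restr b' _) (x'.restrict invB') :=
    Isometric.neg isoB
  exact ((isometric_of_isCompl c invA invB o1 (fun w hw u hu => o2 u hu w hw)).symm.trans
    (isoA.orthSum isoB')).trans
    (isometric_of_isCompl c' invA' invB' o1' (fun w hw u hu => o2' u hu w hw))

end Fitting

/-! ### Elementary divisors and the isomorphism type of an endomorphism -/

section Invariants

open Module LinearMap Polynomial

variable {F : Type u} [Field F] {V V' : Type u} [AddCommGroup V] [Module F V]
  [AddCommGroup V'] [Module F V']

/-- `G j` is the product of the `p` such that `p ^ j` is an elementary divisor of `x`. -/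
structure HasInv (x : End F V) (G : ℕ → F[X]) : Prop where
  zero : G 0 = 1
  monic : ∀ i, (G i).Monic
  rank : ∀ p, Irreducible p → p.Monic → ∀ j, multiplicity p (G (j + 1)) * p.natDegree +
    2 * powRank (aeval x p) (j + 1) = powRank (aeval x p) j + powRank (aeval x p) (j + 2)

theorem Irreducible.finiteMultiplicity {p g : F[X]} (hp : Irreducible p) (hg : g.Monic) :
    FiniteMultiplicity p g :=
  FiniteMultiplicity.of_prime_left hp.prime hg.ne_zero

theorem Irreducible.multiplicity_mul {p g h : F[X]} (hp : Irreducible p) (hg : g.Monic)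
    (hh : h.Monic) : multiplicity p (g * h) = multiplicity p g + multiplicity p h :=
  _root_.multiplicity_mul hp.prime (hp.finiteMultiplicity (hg.mul hh))

theorem Irreducible.multiplicity_prod {ι : Type*} {p : F[X]} (hp : Irreducible p)
    (s : Finset ι) (g : ι → F[X]) (hg : ∀ i, (g i).Monic) :
    multiplicity p (∏ i ∈ s, g i) = ∑ i ∈ s, multiplicity p (g i) := by
  classical
  induction s using Finset.induction with
  | empty => simpa [multiplicity_eq_zero] using hp.not_dvd_one
  | insert a s ha ih =>
    rw [Finset.prod_insert ha, Finset.sum_insert ha,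
      hp.multiplicity_mul (hg a) (monic_prod_of_monic _ _ fun i _ => hg i), ih]

theorem Irreducible.eq_of_dvd_monic {p q : F[X]} (hp : Irreducible p) (hq : Irreducible q)
    (hpm : p.Monic) (hqm : q.Monic) (h : p ∣ q) : p = q :=
  eq_of_monic_of_associated hpm hqm (hp.associated_of_dvd hq h)

theorem Irreducible.multiplicity_irreducible [DecidableEq F[X]] {p q : F[X]} (hp : Irreducible p)
    (hq : Irreducible q) (hpm : p.Monic) (hqm : q.Monic) :
    multiplicity p q = if p = q then 1 else 0 := by
  split_ifs with h
  · rw [h, multiplicity_self]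
  · rw [multiplicity_eq_zero]
    exact fun hd => h (hp.eq_of_dvd_monic hq hpm hqm hd)

theorem eq_of_multiplicity_eq {g h : F[X]} (hg : g.Monic) (hh : h.Monic)
    (H : ∀ p, Irreducible p → p.Monic → multiplicity p g = multiplicity p h) : g = h := by
  have key : ∀ {g h : F[X]}, g.Monic → h.Monic →
      (∀ p, Irreducible p → p.Monic → multiplicity p g = multiplicity p h) → g ∣ h := by
    intro g h hg hh H
    rw [UniqueFactorizationMonoid.dvd_iff_emultiplicity_le hg.ne_zero]
    intro p hp
    have hpi := hp.irreducible
    obtain ⟨c, hc⟩ : ∃ q : F[X], q.Monic ∧ Associated p q := by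
      classical
      exact ⟨normalize p, monic_normalize hpi.ne_zero, (normalize_associated p).symm⟩
    have hci : Irreducible c := hc.2.irreducible hpi
    rw [← emultiplicity_eq_of_associated_left hc.2, ← emultiplicity_eq_of_associated_left hc.2,
      (hci.finiteMultiplicity hg).emultiplicity_eq_multiplicity,
      (hci.finiteMultiplicity hh).emultiplicity_eq_multiplicity, H c hci hc.1]
  exact eq_of_monic_of_associated hg hh (associated_of_dvd_dvd (key hg hh H)
    (key hh hg fun p h1 h2 => (H p h1 h2).symm))

theorem HasInv.unique {x : End F V} {G G' : ℕ → F[X]} (h : HasInv x G) (h' : HasInv x G') :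
    G = G' := by
  funext i
  cases i with
  | zero => rw [h.zero, h'.zero]
  | succ j =>
    refine eq_of_multiplicity_eq (h.monic _) (h'.monic _) fun p hp hpm => ?_
    have h1 := h.rank p hp hpm j
    have h2 := h'.rank p hp hpm j
    exact Nat.eq_of_mul_eq_mul_right hp.natDegree_pos (by omega)

theorem aeval_apply_equiv (θ : V ≃ₗ[F] V') {x : End F V} {x' : End F V'}
    (h : ∀ v, θ (x v) = x' (θ v)) (p : F[X]) (v : V) :
    θ (aeval x p v) = aeval x' p (θ v) := by
  induction p using Polynomial.induction_on' generalizing v with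
  | add p q hp hq => simp [hp, hq]
  | monomial n a =>
    simp only [aeval_monomial, Module.End.mul_apply, Module.algebraMap_end_apply, map_smul]
    congr 1
    induction n generalizing v with
    | zero => simp
    | succ n ih => rw [pow_succ, pow_succ, Module.End.mul_apply, Module.End.mul_apply, ih, h]

theorem HasInv.of_equiv (θ : V ≃ₗ[F] V') {x : End F V} {x' : End F V'}
    (h : ∀ v, θ (x v) = x' (θ v)) {G : ℕ → F[X]} (hG : HasInv x G) : HasInv x' G := by
  refine ⟨hG.zero, hG.monic, fun p hp hpm j => ?_⟩
  rw [← powRank_eq_of_equiv θ (aeval_apply_equiv θ h p),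
    ← powRank_eq_of_equiv θ (aeval_apply_equiv θ h p),
    ← powRank_eq_of_equiv θ (aeval_apply_equiv θ h p)]
  exact hG.rank p hp hpm j

/-- The coordinatewise endomorphism of a product. -/
def piEnd {ι : Type*} {A : ι → Type*} [∀ i, AddCommGroup (A i)] [∀ i, Module F (A i)]
    (x : ∀ i, End F (A i)) : End F (∀ i, A i) :=
  LinearMap.pi fun i => x i ∘ₗ LinearMap.proj i

@[simp]
theorem piEnd_apply {ι : Type*} {A : ι → Type*} [∀ i, AddCommGroup (A i)] [∀ i, Module F (A i)]
    (x : ∀ i, End F (A i)) (v : ∀ i, A i) (i : ι) : piEnd x v i = x i (v i) := rfl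

theorem piEnd_pow {ι : Type*} {A : ι → Type*} [∀ i, AddCommGroup (A i)] [∀ i, Module F (A i)]
    (x : ∀ i, End F (A i)) (k : ℕ) : piEnd x ^ k = piEnd fun i => x i ^ k := by
  induction k with
  | zero => rfl
  | succ k ih => rw [pow_succ, ih]; ext v i; simp [pow_succ]

theorem aeval_piEnd {ι : Type*} {A : ι → Type*} [∀ i, AddCommGroup (A i)] [∀ i, Module F (A i)]
    (x : ∀ i, End F (A i)) (p : F[X]) : aeval (piEnd x) p = piEnd fun i => aeval (x i) p := by
  induction p using Polynomial.induction_on' with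
  | add p q hp hq => rw [map_add, hp, hq]; ext v i; simp
  | monomial n a => ext v i; simp [aeval_monomial, piEnd_pow]

theorem powRank_piEnd {ι : Type*} [Fintype ι] {A : ι → Type*} [∀ i, AddCommGroup (A i)]
    [∀ i, Module F (A i)] [∀ i, FiniteDimensional F (A i)]
    (x : ∀ i, End F (A i)) (k : ℕ) : powRank (piEnd x) k = ∑ i, powRank (x i) k := by
  have h : range (piEnd x ^ k) = Submodule.pi Set.univ fun i => range (x i ^ k) := by
    rw [piEnd_pow]
    ext v
    simp only [mem_range, Submodule.mem_pi, Set.mem_univ, forall_true_left]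
    constructor
    · rintro ⟨w, rfl⟩ i
      exact ⟨w i, rfl⟩
    · intro hv
      choose w hw using hv
      exact ⟨w, funext hw⟩
  let e : (Submodule.pi Set.univ fun i => range (x i ^ k)) ≃ₗ[F] ∀ i, range (x i ^ k) :=
    { toFun := fun v i => ⟨v.1 i, v.2 i trivial⟩
      invFun := fun v => ⟨fun i => (v i).1, fun i _ => (v i).2⟩
      map_add' := fun _ _ => rfl
      map_smul' := fun _ _ => rfl }
  rw [powRank, h, e.finrank_eq, finrank_pi_fintype]
  rfl

theorem hasInv_piEnd {ι : Type u} [Fintype ι] {A : ι → Type u} [∀ i, AddCommGroup (A i)]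
    [∀ i, Module F (A i)] [∀ i, FiniteDimensional F (A i)]
    {x : ∀ i, End F (A i)} {G : ι → ℕ → F[X]} (h : ∀ i, HasInv (x i) (G i)) :
    HasInv (piEnd x) fun j => ∏ i, G i j := by
  refine ⟨Finset.prod_eq_one fun i _ => (h i).zero,
    fun j => monic_prod_of_monic _ _ fun i _ => (h i).monic j, fun p hp hpm j => ?_⟩
  rw [hp.multiplicity_prod _ _ fun i => (h i).monic _]
  simp only [aeval_piEnd, powRank_piEnd]
  rw [Finset.sum_mul, Finset.mul_sum, ← Finset.sum_add_distrib, ← Finset.sum_add_distrib]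
  exact Finset.sum_congr rfl fun i _ => (h i).rank p hp hpm j

theorem aeval_prodMap (x : End F V) (x' : End F V') (p : F[X]) :
    aeval (R := F) (LinearMap.prodMap x x' : End F (V × V')) p =
      LinearMap.prodMap (aeval x p) (aeval x' p) := by
  have h : ∀ k, (LinearMap.prodMap x x' : End F (V × V')) ^ k =
      LinearMap.prodMap (x ^ k) (x' ^ k) := by
    intro k
    induction k with
    | zero => rfl
    | succ k ih => rw [pow_succ, ih]; ext v <;> simp [pow_succ]
  induction p using Polynomial.induction_on' with
  | add p q hp hq => rw [map_add, hp, hq]; ext v <;> simp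
  | monomial n a => ext v <;> simp [aeval_monomial, h]

theorem powRank_prodMap [FiniteDimensional F V] [FiniteDimensional F V'] (x : End F V)
    (x' : End F V') (k : ℕ) :
    powRank (LinearMap.prodMap x x' : End F (V × V')) k = powRank x k + powRank x' k := by
  have h : ∀ k, (LinearMap.prodMap x x' : End F (V × V')) ^ k =
      LinearMap.prodMap (x ^ k) (x' ^ k) := by
    intro k
    induction k with
    | zero => rfl
    | succ k ih => rw [pow_succ, ih]; ext v <;> simp [pow_succ]
  let e : (Submodule.prod (range (x ^ k)) (range (x' ^ k))) ≃ₗ[F]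
      (range (x ^ k)) × (range (x' ^ k)) :=
    { toFun := fun v => (⟨v.1.1, v.2.1⟩, ⟨v.1.2, v.2.2⟩)
      invFun := fun v => ⟨(v.1.1, v.2.1), v.1.2, v.2.2⟩
      map_add' := fun _ _ => rfl
      map_smul' := fun _ _ => rfl }
  rw [powRank, h, LinearMap.range_prodMap, e.finrank_eq, finrank_prod]
  rfl

theorem HasInv.prodMap [FiniteDimensional F V] [FiniteDimensional F V'] {x : End F V}
    {x' : End F V'} {G G' : ℕ → F[X]} (h : HasInv x G) (h' : HasInv x' G') :
    HasInv (LinearMap.prodMap x x' : End F (V × V')) fun j => G j * G' j := by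
  refine ⟨by simp [h.zero, h'.zero], fun j => (h.monic j).mul (h'.monic j), fun p hp hpm j => ?_⟩
  have h1 := h.rank p hp hpm j
  have h2 := h'.rank p hp hpm j
  rw [hp.multiplicity_mul (h.monic _) (h'.monic _), aeval_prodMap, powRank_prodMap,
    powRank_prodMap, powRank_prodMap]
  linarith

/-- Multiplication by the root on `F[X] / (f)`. -/
noncomputable def cyc (f : F[X]) : End F (AdjoinRoot f) := LinearMap.mulLeft F (AdjoinRoot.root f)

@[simp]
theorem cyc_apply (f : F[X]) (v : AdjoinRoot f) : cyc f v = AdjoinRoot.root f * v := rfl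

theorem aeval_cyc (f q : F[X]) :
    aeval (cyc f) q = LinearMap.mulLeft F (AdjoinRoot.mk f q) := by
  have h : aeval (Algebra.lmul F (AdjoinRoot f) (AdjoinRoot.root f)) q =
    Algebra.lmul F (AdjoinRoot f) (aeval (AdjoinRoot.root f) q) := aeval_algHom_apply _ _ _
  rwa [AdjoinRoot.aeval_eq] at h

/-- The image of `p ^ j` in `F[X] / (p ^ e)` is isomorphic to `F[X] / (p ^ (e - j))`; truncated
subtraction covers `j ≥ e`, where the image is zero. -/
theorem powRank_cyc (p : F[X]) (hp : p ≠ 0) (e j : ℕ) :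
    powRank (aeval (cyc (p ^ e)) p) j = (e - j) * p.natDegree := by
  have h1 : (aeval (cyc (p ^ e)) p) ^ j =
      LinearMap.mulLeft F (AdjoinRoot.mk (p ^ e) (p ^ j)) := by
    rw [← map_pow, aeval_cyc]
  let φ : F[X] →ₗ[F] AdjoinRoot (p ^ e) :=
    (LinearMap.mulLeft F (AdjoinRoot.mk (p ^ e) (p ^ j))) ∘ₗ
      (AdjoinRoot.mkₐ (R := F) (p ^ e)).toLinearMap
  have hφ : ∀ q, φ q = AdjoinRoot.mk (p ^ e) (p ^ j * q) := fun q => (map_mul (AdjoinRoot.mk (p ^ e)) _ _).symm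
  have h2 : range φ = range ((aeval (cyc (p ^ e)) p) ^ j) := by
    rw [h1]
    exact LinearMap.range_comp_of_range_eq_top _
      (LinearMap.range_eq_top.2 AdjoinRoot.mk_surjective)
  have h3 : ker φ = (Ideal.span {p ^ (e - j)}).restrictScalars F := by
    ext q
    rw [LinearMap.mem_ker, hφ, AdjoinRoot.mk_eq_zero, Submodule.restrictScalars_mem,
      Ideal.mem_span_singleton]
    rcases le_total e j with h | h
    · simp only [Nat.sub_eq_zero_of_le h, pow_zero, one_dvd, iff_true]
      exact (pow_dvd_pow p h).mul_right q
    · conv_lhs => rw [← Nat.add_sub_cancel' h, pow_add]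
      exact mul_dvd_mul_iff_left (pow_ne_zero _ hp)
  rw [powRank, ← h2, ← (LinearMap.quotKerEquivRange φ).finrank_eq, h3,
    (Submodule.Quotient.restrictScalarsEquiv F (Ideal.span {p ^ (e - j)})).finrank_eq,
    finrank_quotient_span_eq_natDegree, natDegree_pow]

theorem powRank_cyc_of_isCoprime {f q : F[X]} (h : IsCoprime f q) (j : ℕ) :
    powRank (aeval (cyc f) q) j = finrank F (AdjoinRoot f) := by
  obtain ⟨a, c, hac⟩ := h
  have h1 : Function.Surjective ⇑(aeval (cyc f) q) := by
    intro v
    refine ⟨AdjoinRoot.mk f c * v, ?_⟩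
    rw [aeval_cyc, LinearMap.mulLeft_apply, ← mul_assoc, ← map_mul]
    have : AdjoinRoot.mk f (q * c) = 1 := by
      rw [← map_one (AdjoinRoot.mk f), ← hac, map_add, map_mul _ a f, AdjoinRoot.mk_self]
      simp [mul_comm]
    rw [this, one_mul]
  rw [powRank, LinearMap.range_eq_top.2, finrank_top]
  rw [Module.End.coe_pow]
  exact h1.iterate j

theorem finrank_adjoinRoot {f : F[X]} : finrank F (AdjoinRoot f) = f.natDegree :=
  finrank_quotient_span_eq_natDegree

open Classical in
/-- The invariants of the multiplication by the root on `F[X] / (p ^ e)`. -/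
noncomputable def blockInv (p : F[X]) (e : ℕ) (j : ℕ) : F[X] := if j = e ∧ e ≠ 0 then p else 1

/-- The rank of `p ^ j` on the block decreases linearly until `j = e` and is then zero, so its
second difference is concentrated at `j + 1 = e`. Any other irreducible acts invertibly and has
constant rank. -/
theorem hasInv_cyc {p : F[X]} (hp : Irreducible p) (hpm : p.Monic) (e : ℕ) :
    HasInv (cyc (p ^ e)) (blockInv p e) := by
  classical
  refine ⟨?_, ?_, ?_⟩
  · simp [blockInv, eq_comm]
  · intro i
    unfold blockInv
    split_ifs
    exacts [hpm, monic_one]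
  · intro q hq hqm j
    by_cases hpq : q = p
    · subst hpq
      rw [powRank_cyc _ hq.ne_zero, powRank_cyc _ hq.ne_zero, powRank_cyc _ hq.ne_zero]
      have : multiplicity q (blockInv q e (j + 1)) = if j + 1 = e then 1 else 0 := by
        unfold blockInv
        by_cases h : j + 1 = e
        · rw [if_pos ⟨h, by omega⟩, if_pos h, multiplicity_self]
        · rw [if_neg fun h' => h h'.1, if_neg h, multiplicity_eq_zero]
          exact hq.not_dvd_one
      rw [this, ← mul_assoc, ← add_mul, ← add_mul]
      congr 1
      split_ifs <;> omega
    · have h0 : ¬ q ∣ p := fun h => hpq (hq.eq_of_dvd_monic hp hqm hpm h)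
      have : multiplicity q (blockInv p e (j + 1)) = 0 := by
        rw [multiplicity_eq_zero]
        unfold blockInv
        split_ifs
        exacts [h0, hq.not_dvd_one]
      have hc : IsCoprime (p ^ e) q :=
        (((hq.coprime_iff_not_dvd).2 h0).symm).pow_left
      rw [this, powRank_cyc_of_isCoprime hc, powRank_cyc_of_isCoprime hc,
        powRank_cyc_of_isCoprime hc]
      ring

theorem exists_equiv_cyc [FiniteDimensional F V] (x : End F V) :
    ∃ (ι : Type u) (_ : Fintype ι) (p : ι → F[X]) (e : ι → ℕ),
      (∀ i, Irreducible (p i) ∧ (p i).Monic) ∧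
      ∃ Φ : V ≃ₗ[F] ∀ i, AdjoinRoot (p i ^ e i), ∀ v,
        Φ (x v) = piEnd (fun i => cyc (p i ^ e i)) (Φ v) := by
  classical
  obtain ⟨ι, hι, p, hp, e, ⟨Ψ⟩⟩ := Module.equiv_directSum_of_isTorsion
    (Module.AEval.isTorsion_of_finiteDimensional F V x)
  have hq : ∀ i, (F[X] ∙ p i ^ e i) = Ideal.span {normalize (p i) ^ e i} := fun i =>
    Ideal.span_singleton_eq_span_singleton.2 ((normalize_associated (p i)).symm.pow_pow)
  refine ⟨ι, hι, fun i => normalize (p i), e, fun i => ⟨(normalize_associated _).symm.irreducible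
    (hp i), monic_normalize (hp i).ne_zero⟩, ?_⟩
  let Θ : Module.AEval F V x ≃ₗ[F[X]] ∀ i, F[X] ⧸ Ideal.span {normalize (p i) ^ e i} :=
    (Ψ.trans (DirectSum.linearEquivFunOnFintype F[X] ι _)).trans
      (LinearEquiv.piCongrRight fun i => Submodule.quotEquivOfEq _ _ (hq i))
  refine ⟨(Module.AEval.of F V x).trans (Θ.restrictScalars F), fun v => ?_⟩
  have h : Module.AEval.of F V x (x v) = (X : F[X]) • Module.AEval.of F V x v :=
    (Module.AEval.X_smul_of _ _).symm
  change Θ (Module.AEval.of F V x (x v)) = _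
  rw [h, map_smul]
  rfl

theorem HasInv.eq_prod {x : End F V} {G : ℕ → F[X]} (hG : HasInv x G) {ι : Type u}
    [Fintype ι] {p : ι → F[X]} {e : ι → ℕ} (hp : ∀ i, Irreducible (p i) ∧ (p i).Monic)
    (Φ : V ≃ₗ[F] ∀ i, AdjoinRoot (p i ^ e i))
    (hΦ : ∀ v, Φ (x v) = piEnd (fun i => cyc (p i ^ e i)) (Φ v)) :
    G = fun j => ∏ i, blockInv (p i) (e i) j := by
  have hfd : ∀ i, FiniteDimensional F (AdjoinRoot (p i ^ e i)) := fun i =>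
    ((hp i).2.pow (e i)).finite_adjoinRoot
  exact (hG.of_equiv Φ hΦ).unique (hasInv_piEnd fun i => hasInv_cyc (hp i).1 (hp i).2 (e i))

theorem exists_hasInv [FiniteDimensional F V] (x : End F V) : ∃ G, HasInv x G := by
  obtain ⟨ι, hι, p, e, hp, Φ, hΦ⟩ := exists_equiv_cyc x
  have hfd : ∀ i, FiniteDimensional F (AdjoinRoot (p i ^ e i)) := fun i =>
    ((hp i).2.pow (e i)).finite_adjoinRoot
  refine ⟨_, HasInv.of_equiv Φ.symm (fun v => ?_)
    (hasInv_piEnd fun i => hasInv_cyc (hp i).1 (hp i).2 (e i))⟩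
  rw [LinearEquiv.symm_apply_eq, hΦ, LinearEquiv.apply_symm_apply]

theorem HasInv.finrank_eq [FiniteDimensional F V] {x : End F V} {G : ℕ → F[X]}
    (hG : HasInv x G) : ∃ N₀, ∀ N ≥ N₀, (∀ i ≥ N, G i = 1) ∧
      finrank F V = ∑ j ∈ Finset.range N, j * (G j).natDegree := by
  obtain ⟨ι, hι, p, e, hp, Φ, hΦ⟩ := exists_equiv_cyc x
  have hfd : ∀ i, FiniteDimensional F (AdjoinRoot (p i ^ e i)) := fun i =>
    ((hp i).2.pow (e i)).finite_adjoinRoot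
  have hG' := hG.eq_prod hp Φ hΦ
  refine ⟨∑ i, e i + 1, fun N hN => ?_⟩
  have he : ∀ i, e i < N := fun i =>
    (Finset.single_le_sum (fun i _ => Nat.zero_le (e i)) (Finset.mem_univ i)).trans_lt
      (Nat.lt_of_succ_le hN)
  have hm : ∀ i j, (blockInv (p i) (e i) j).Monic := fun i j =>
    (hasInv_cyc (hp i).1 (hp i).2 (e i)).monic j
  constructor
  · intro j hj
    rw [hG']
    refine Finset.prod_eq_one fun i _ => if_neg fun h => ?_
    have := he i
    omega
  · rw [Φ.finrank_eq, finrank_pi_fintype]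
    simp only [finrank_adjoinRoot, hG']
    have h1 : ∀ j, (∏ i, blockInv (p i) (e i) j).natDegree =
        ∑ i, (blockInv (p i) (e i) j).natDegree := fun j =>
      natDegree_prod_of_monic _ _ fun i _ => hm i j
    simp only [h1, Finset.mul_sum]
    rw [Finset.sum_comm]
    refine Finset.sum_congr rfl fun i _ => ?_
    rw [Finset.sum_eq_single (e i), natDegree_pow]
    · unfold blockInv
      by_cases h : e i = 0
      · simp [h]
      · rw [if_pos ⟨rfl, h⟩]
    · intro j _ hj
      rw [blockInv, if_neg fun h => hj h.1, natDegree_one, mul_zero]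
    · intro h
      exact absurd (Finset.mem_range.2 (he i)) h

/-- The trivial summands with exponent 0 are discarded, since they are invisible to the invariants
and would spoil the matching of blocks. -/
theorem exists_equiv_cyc_of_ne_zero [FiniteDimensional F V] (x : End F V) :
    ∃ (ι : Type u) (_ : Fintype ι) (p : ι → F[X]) (e : ι → ℕ),
      (∀ i, Irreducible (p i) ∧ (p i).Monic) ∧ (∀ i, e i ≠ 0) ∧
      ∃ Φ : V ≃ₗ[F] ∀ i, AdjoinRoot (p i ^ e i), ∀ v,
        Φ (x v) = piEnd (fun i => cyc (p i ^ e i)) (Φ v) := by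
  classical
  obtain ⟨ι, hι, p, e, hp, Φ, hΦ⟩ := exists_equiv_cyc x
  let R : (∀ i, AdjoinRoot (p i ^ e i)) →ₗ[F]
      ∀ i : {i // e i ≠ 0}, AdjoinRoot (p i.1 ^ e i.1) :=
    LinearMap.pi fun i => LinearMap.proj i.1
  have hR : Function.Bijective R := by
    constructor
    · intro v w h
      funext i
      by_cases hi : e i = 0
      · have : Subsingleton (AdjoinRoot (p i ^ e i)) := by
          rw [hi, pow_zero]
          exact Ideal.Quotient.subsingleton_iff.2 (by simp)
        exact Subsingleton.elim _ _
      · exact congrFun h ⟨i, hi⟩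
    · intro v
      refine ⟨fun i => if h : e i ≠ 0 then v ⟨i, h⟩ else 0, funext fun i => ?_⟩
      exact dif_pos i.2
  refine ⟨{i // e i ≠ 0}, inferInstance, fun i => p i.1, fun i => e i.1, fun i => hp i.1,
    fun i => i.2, Φ.trans (LinearEquiv.ofBijective R hR), fun v => ?_⟩
  change R (Φ (x v)) = _
  rw [hΦ]
  rfl

theorem card_fiber_eq_multiplicity {ι : Type u} [Fintype ι] [DecidableEq F[X]] {p : ι → F[X]}
    {e : ι → ℕ} (hp : ∀ i, Irreducible (p i) ∧ (p i).Monic) (he : ∀ i, e i ≠ 0) {q : F[X]}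
    (hq : Irreducible q) (hqm : q.Monic) (j : ℕ) :
    Fintype.card {i // (p i, e i) = (q, j)} =
      multiplicity q (∏ i, blockInv (p i) (e i) j) := by
  rw [hq.multiplicity_prod _ _ fun i => (hasInv_cyc (hp i).1 (hp i).2 (e i)).monic j,
    Fintype.card_subtype, Finset.card_filter]
  refine Finset.sum_congr rfl fun i _ => ?_
  by_cases h : j = e i
  · rw [blockInv, if_pos (show j = e i ∧ e i ≠ 0 from ⟨h, he i⟩), hq.multiplicity_irreducible (hp i).1 hqm (hp i).2]
    simp [h, eq_comm]
  · rw [blockInv, if_neg (show ¬(j = e i ∧ e i ≠ 0) from fun h' => h h'.1),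
      multiplicity_eq_zero.2 hq.not_dvd_one,
      if_neg (show ¬(p i, e i) = (q, j) from fun h' => h (Prod.ext_iff.1 h').2.symm)]

/-- The multiplicity of `q` in `G j` counts the blocks `F[X] / (q ^ j)`. Equal invariants therefore
give a bijection of the index sets that preserves the blocks. -/
theorem HasInv.exists_equiv [FiniteDimensional F V] [FiniteDimensional F V'] {x : End F V}
    {x' : End F V'} {G : ℕ → F[X]} (h : HasInv x G) (h' : HasInv x' G) :
    ∃ θ : V ≃ₗ[F] V', ∀ v, θ (x v) = x' (θ v) := by
  classical
  obtain ⟨ι, hι, p, e, hp, he, Φ, hΦ⟩ := exists_equiv_cyc_of_ne_zero x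
  obtain ⟨ι', hι', p', e', hp', he', Φ', hΦ'⟩ := exists_equiv_cyc_of_ne_zero x'
  have hG := h.eq_prod hp Φ hΦ
  have hG' := h'.eq_prod hp' Φ' hΦ'
  have hcard : ∀ c : F[X] × ℕ,
      Nonempty ({i // (p i, e i) = c} ≃ {i // (p' i, e' i) = c}) := by
    rintro ⟨q, j⟩
    by_cases hq : Irreducible q ∧ q.Monic
    · rw [← Fintype.card_eq, card_fiber_eq_multiplicity hp he hq.1 hq.2,
        card_fiber_eq_multiplicity hp' he' hq.1 hq.2, ← congrFun hG j, ← congrFun hG' j]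
    · have h1 : IsEmpty {i // (p i, e i) = (q, j)} :=
        ⟨fun i => hq ((Prod.mk.inj i.2).1 ▸ hp i.1)⟩
      have h2 : IsEmpty {i // (p' i, e' i) = (q, j)} :=
        ⟨fun i => hq ((Prod.mk.inj i.2).1 ▸ hp' i.1)⟩
      exact ⟨Equiv.equivOfIsEmpty _ _⟩
  let σ : ι ≃ ι' := Equiv.ofFiberEquiv fun c => (hcard c).some
  have hσ : ∀ i, (p' (σ i), e' (σ i)) = (p i, e i) := fun i =>
    Equiv.ofFiberEquiv_map (fun c => (hcard c).some) i
  have hf : ∀ i, p i ^ e i = p' (σ i) ^ e' (σ i) := fun i => by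
    rw [(Prod.mk.inj (hσ i)).1, (Prod.mk.inj (hσ i)).2]
  have key : ∀ {f g : F[X]} (_ : f = g), ∃ t : AdjoinRoot f ≃ₗ[F] AdjoinRoot g,
      ∀ v, t (cyc f v) = cyc g (t v) := by
    rintro f _ rfl
    exact ⟨LinearEquiv.refl _ _, fun v => rfl⟩
  choose t ht using fun i => key (hf i)
  let Ψ : (∀ i, AdjoinRoot (p i ^ e i)) ≃ₗ[F] ∀ i, AdjoinRoot (p' i ^ e' i) :=
    (LinearEquiv.piCongrRight t).trans
      (LinearEquiv.piCongrLeft F (fun i => AdjoinRoot (p' i ^ e' i)) σ)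
  have hΨ : ∀ v, Ψ (piEnd (fun i => cyc (p i ^ e i)) v) =
      piEnd (fun i => cyc (p' i ^ e' i)) (Ψ v) := by
    intro v
    funext i'
    obtain ⟨i, rfl⟩ := σ.surjective i'
    have h1 : ∀ w, Ψ w (σ i) = t i (w i) := fun w =>
      Equiv.piCongrLeft_apply_apply (fun i => AdjoinRoot (p' i ^ e' i)) σ (fun i => t i (w i)) i
    rw [h1, piEnd_apply, piEnd_apply, h1, ht]
  refine ⟨(Φ.trans Ψ).trans Φ'.symm, fun v => ?_⟩
  change Φ'.symm (Ψ (Φ (x v))) = x' (Φ'.symm (Ψ (Φ v)))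
  rw [LinearEquiv.symm_apply_eq, hΦ, hΨ, hΦ', LinearEquiv.apply_symm_apply]

end Invariants

/-! ### Reciprocal and palindromic polynomials -/

section Palindromic

open Polynomial

variable {F : Type*} [Field F]

theorem natDegree_reverse_of_coeff_zero {p : F[X]} (h : p.coeff 0 ≠ 0) :
    p.reverse.natDegree = p.natDegree := by
  rw [reverse_natDegree, natTrailingDegree_eq_zero.2 (Or.inr h), Nat.sub_zero]

theorem reverse_reverse_of_coeff_zero {p : F[X]} (h : p.coeff 0 ≠ 0) :
    p.reverse.reverse = p := by
  rw [reverse, natDegree_reverse_of_coeff_zero h, reverse, reflect_reflect]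

theorem eval_reverse_mul_pow {r : F} (hr : r * r = 1) (p : F[X]) :
    p.reverse.eval r * r ^ p.natDegree = p.eval r := by
  let _ : Invertible r := ⟨r, hr, hr⟩
  exact eval₂_reverse_mul_pow (RingHom.id F) r p

theorem reverse_X_sub_C {r : F} (hr : r * r = 1) :
    (X - C r).reverse = C (-r) * (X - C r) := by
  rw [reverse, natDegree_X_sub_C, reflect_sub, reflect_one_X, reflect_C, pow_one, mul_sub,
    ← C_mul, neg_mul, hr]
  simp
  ring

/-- The monic polynomial whose roots are the inverses of those of `p`. -/
noncomputable def starPoly (p : F[X]) : F[X] := C (p.coeff 0)⁻¹ * p.reverse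

theorem natDegree_starPoly {p : F[X]} (h : p.coeff 0 ≠ 0) :
    (starPoly p).natDegree = p.natDegree := by
  rw [starPoly, natDegree_C_mul (inv_ne_zero h), natDegree_reverse_of_coeff_zero h]

theorem monic_starPoly {p : F[X]} (h : p.coeff 0 ≠ 0) : (starPoly p).Monic := by
  rw [Monic, starPoly, leadingCoeff_mul, leadingCoeff_C, reverse_leadingCoeff, trailingCoeff,
    natTrailingDegree_eq_zero.2 (Or.inr h), inv_mul_cancel₀ h]

theorem reverse_eq_C_mul_starPoly {p : F[X]} (h : p.coeff 0 ≠ 0) :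
    p.reverse = C (p.coeff 0) * starPoly p := by
  rw [starPoly, ← mul_assoc, ← C_mul, mul_inv_cancel₀ h, C_1, one_mul]

theorem coeff_zero_starPoly {p : F[X]} (hp : p.Monic) :
    (starPoly p).coeff 0 = (p.coeff 0)⁻¹ := by
  rw [starPoly, coeff_C_mul, coeff_zero_reverse, hp.leadingCoeff, mul_one]

theorem coeff_zero_starPoly_ne_zero {p : F[X]} (hp : p.Monic) (h : p.coeff 0 ≠ 0) :
    (starPoly p).coeff 0 ≠ 0 := by
  rw [coeff_zero_starPoly hp]
  exact inv_ne_zero h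

theorem starPoly_starPoly {p : F[X]} (hp : p.Monic) (h : p.coeff 0 ≠ 0) :
    starPoly (starPoly p) = p := by
  rw [starPoly, coeff_zero_starPoly hp, inv_inv, starPoly, reverse_mul_of_domain, reverse_C,
    reverse_reverse_of_coeff_zero h, ← mul_assoc, ← C_mul, mul_inv_cancel₀ h, C_1, one_mul]

theorem starPoly_mul (p q : F[X]) : starPoly (p * q) = starPoly p * starPoly q := by
  rw [starPoly, starPoly, starPoly, mul_coeff_zero, reverse_mul_of_domain, mul_inv, C_mul]
  ring

theorem starPoly_one : starPoly (1 : F[X]) = 1 := by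
  rw [starPoly, ← C_1, reverse_C]
  simp

theorem starPoly_pow (p : F[X]) (n : ℕ) : starPoly (p ^ n) = starPoly p ^ n := by
  induction n with
  | zero => simp [starPoly_one]
  | succ n ih => rw [pow_succ, starPoly_mul, ih, pow_succ]

theorem starPoly_dvd {p q : F[X]} (h : p ∣ q) : starPoly p ∣ starPoly q := by
  obtain ⟨r, rfl⟩ := h
  exact ⟨_, starPoly_mul p r⟩

theorem irreducible_starPoly {p : F[X]} (hp : Irreducible p) (hpm : p.Monic)
    (h : p.coeff 0 ≠ 0) : Irreducible (starPoly p) := by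
  refine ⟨fun hu => ?_, fun a c hac => ?_⟩
  · have h1 := natDegree_eq_zero_of_isUnit hu
    rw [natDegree_starPoly h] at h1
    exact hp.natDegree_pos.ne' h1
  · have h1 : p = starPoly a * starPoly c := by
      rw [← starPoly_mul, ← hac, starPoly_starPoly hpm h]
    have h2 : a.coeff 0 * c.coeff 0 ≠ 0 := by
      rw [← mul_coeff_zero, ← hac]
      exact coeff_zero_starPoly_ne_zero hpm h
    have key : ∀ {a : F[X]}, a.coeff 0 ≠ 0 → IsUnit (starPoly a) → IsUnit a := by
      intro a ha hu
      have h3 := natDegree_eq_zero_of_isUnit hu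
      rw [natDegree_starPoly ha] at h3
      rw [eq_C_of_natDegree_eq_zero h3]
      exact isUnit_C.2 ha.isUnit
    rcases hp.isUnit_or_isUnit h1 with h3 | h3
    · exact Or.inl (key (left_ne_zero_of_mul h2) h3)
    · exact Or.inr (key (right_ne_zero_of_mul h2) h3)

theorem pow_starPoly_dvd_iff {p g : F[X]} (hp : p.Monic) (hp0 : p.coeff 0 ≠ 0) (hg : g.Monic)
    (hg0 : g.coeff 0 ≠ 0) (k : ℕ) : starPoly p ^ k ∣ starPoly g ↔ p ^ k ∣ g := by
  rw [← starPoly_pow]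
  refine ⟨fun h => ?_, starPoly_dvd⟩
  have h0 : (p ^ k).coeff 0 ≠ 0 := by
    rw [coeff_zero_eq_eval_zero, eval_pow, ← coeff_zero_eq_eval_zero]
    exact pow_ne_zero _ hp0
  have := starPoly_dvd h
  rwa [starPoly_starPoly (hp.pow k) h0, starPoly_starPoly hg hg0] at this

/-- Monic polynomials of even degree with palindromic coefficients. -/
structure IsPal (g : F[X]) : Prop where
  monic : g.Monic
  even : Even g.natDegree
  reverse : g.reverse = g

theorem IsPal.coeff_zero {g : F[X]} (h : IsPal g) : g.coeff 0 = 1 := by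
  rw [← h.reverse, coeff_zero_reverse, h.monic.leadingCoeff]

theorem IsPal.starPoly_eq {g : F[X]} (h : IsPal g) : starPoly g = g := by
  rw [starPoly, h.coeff_zero, h.reverse, inv_one, C_1, one_mul]

theorem isPal_one : IsPal (1 : F[X]) :=
  ⟨monic_one, by simp, by rw [← C_1, reverse_C]⟩

theorem IsPal.mul {g h : F[X]} (hg : IsPal g) (hh : IsPal h) : IsPal (g * h) :=
  ⟨hg.monic.mul hh.monic, by rw [hg.monic.natDegree_mul hh.monic]; exact hg.even.add hh.even,
    by rw [reverse_mul_of_domain, hg.reverse, hh.reverse]⟩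

theorem IsPal.of_mul_left {g h : F[X]} (hg : IsPal g) (hgh : IsPal (g * h)) : IsPal h := by
  have hh := hg.monic.of_mul_monic_left hgh.monic
  refine ⟨hh, ?_, ?_⟩
  · have := hgh.even
    rw [hg.monic.natDegree_mul hh, Nat.even_add] at this
    exact this.1 hg.even
  · have := hgh.reverse
    rw [reverse_mul_of_domain, hg.reverse] at this
    exact mul_left_cancel₀ hg.monic.ne_zero this

theorem isPal_X_sub_C_sq {r : F} (hr : r * r = 1) : IsPal ((X - C r) ^ 2) := by
  refine ⟨(monic_X_sub_C r).pow 2, by simp [natDegree_pow], ?_⟩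
  rw [sq, reverse_mul_of_domain, reverse_X_sub_C hr]
  have : C (-r) * C (-r) = (1 : F[X]) := by rw [← C_mul, neg_mul_neg, hr, C_1]
  linear_combination (X - C r) ^ 2 * this

/-- Roots at 1 and -1 are at least double. If `g = (X - r) * k`, then palindromicity of `g` gives
`-r * k.reverse = k`; as `k` has odd degree, evaluation at `r` yields `2 * k(r) = 0`. -/
theorem IsPal.exists_of_root (h2 : (2 : F) ≠ 0) {g : F[X]} (h : IsPal g) {r : F}
    (hr : r * r = 1) (h0 : g.eval r = 0) : ∃ g', g = (X - C r) ^ 2 * g' ∧ IsPal g' := by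
  obtain ⟨k, rfl⟩ := dvd_iff_isRoot.2 h0
  have hkm : k.Monic := (monic_X_sub_C r).of_mul_monic_left h.monic
  have h1 : C (-r) * k.reverse = k := by
    have := h.reverse
    rw [reverse_mul_of_domain, reverse_X_sub_C hr] at this
    refine mul_left_cancel₀ (X_sub_C_ne_zero r) ?_
    linear_combination this
  obtain ⟨m, hm⟩ : Odd k.natDegree := by
    have := h.even
    rw [(monic_X_sub_C r).natDegree_mul hkm, natDegree_X_sub_C] at this
    rw [← Nat.not_even_iff_odd]
    rwa [add_comm, Nat.even_add_one] at this
  have h3 := eval_reverse_mul_pow hr k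
  have h4 := congrArg (eval r) h1
  rw [eval_mul, eval_C] at h4
  have h5 : r ^ k.natDegree = r := by
    rw [hm, pow_succ, pow_mul, sq, hr, one_pow, one_mul]
  rw [h5] at h3
  have h6 : k.eval r = 0 := by
    have : 2 * k.eval r = 0 := by linear_combination - h4 - h3
    exact (mul_eq_zero.1 this).resolve_left h2
  obtain ⟨g', rfl⟩ := dvd_iff_isRoot.2 h6
  refine ⟨g', by ring, (isPal_X_sub_C_sq hr).of_mul_left ?_⟩
  rwa [← mul_assoc, ← sq] at h

theorem irreducible_multiplicity_mul_pow {p g : F[X]} (hp : Irreducible p) {r : F}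
    (hg : g.Monic) : multiplicity p ((X - C r) ^ 2 * g) =
      multiplicity p (X - C r) + multiplicity p (X - C r) + multiplicity p g := by
  have hm := monic_X_sub_C r
  have fin : ∀ {h : F[X]}, h.Monic → FiniteMultiplicity p h := fun hh =>
    FiniteMultiplicity.of_prime_left hp.prime hh.ne_zero
  rw [sq, _root_.multiplicity_mul hp.prime (fin ((hm.mul hm).mul hg)),
    _root_.multiplicity_mul hp.prime (fin (hm.mul hm))]

theorem IsPal.even_multiplicity (h2 : (2 : F) ≠ 0) {r : F} (hr : r * r = 1) :
    ∀ (n : ℕ) {g : F[X]}, g.natDegree = n → IsPal g → Even (multiplicity (X - C r) g) := by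
  intro n
  induction n using Nat.strong_induction_on with
  | _ n ih =>
    intro g hn h
    by_cases h0 : g.eval r = 0
    · obtain ⟨g', rfl, hg'⟩ := h.exists_of_root h2 hr h0
      rw [irreducible_multiplicity_mul_pow (irreducible_X_sub_C r) hg'.monic]
      rw [((monic_X_sub_C r).pow 2).natDegree_mul hg'.monic, natDegree_pow, natDegree_X_sub_C] at hn
      exact (Even.add_self _).add (ih _ (by omega) rfl hg')
    · rw [multiplicity_eq_zero.2 fun hd => h0 (dvd_iff_isRoot.1 hd)]
      exact Even.zero

/-- Square factors at 1 and -1 are removed by induction. Once neither is a root, evaluating the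
reversal identity at 1 forces constant term 1, and evaluating it at -1 forces even degree. -/
theorem isPal_of_starPoly (h2 : (2 : F) ≠ 0) :
    ∀ (n : ℕ) {g : F[X]}, g.natDegree = n → g.Monic → g.coeff 0 ≠ 0 → starPoly g = g →
      (∀ r : F, r * r = 1 → Even (multiplicity (X - C r) g)) → IsPal g := by
  intro n
  induction n using Nat.strong_induction_on with
  | _ n ih =>
    intro g hn hg hg0 hs he
    by_cases h0 : ∃ r : F, r * r = 1 ∧ g.eval r = 0
    · obtain ⟨r, hr, h0⟩ := h0
      have h1 : (X - C r) ^ 2 ∣ g := by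
        have h3 : multiplicity (X - C r) g ≠ 0 := fun h =>
          multiplicity_eq_zero.1 h (dvd_iff_isRoot.2 h0)
        have h4 := he r hr
        refine pow_dvd_of_le_multiplicity ?_
        obtain ⟨m, hm⟩ := h4
        omega
      obtain ⟨g', rfl⟩ := h1
      have hp := isPal_X_sub_C_sq hr
      have hg' : g'.Monic := hp.monic.of_mul_monic_left hg
      have hd := hn
      rw [hp.monic.natDegree_mul hg', natDegree_pow, natDegree_X_sub_C] at hd
      refine hp.mul (ih _ (by omega) rfl hg' ?_ ?_ fun s hs' => ?_)
      · rw [mul_coeff_zero] at hg0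
        exact right_ne_zero_of_mul hg0
      · rw [starPoly_mul, hp.starPoly_eq] at hs
        exact mul_left_cancel₀ hp.monic.ne_zero hs
      · have := he s hs'
        rw [irreducible_multiplicity_mul_pow (irreducible_X_sub_C s) hg', Nat.even_add] at this
        exact this.1 (Even.add_self _)
    · push Not at h0
      have h1 := reverse_eq_C_mul_starPoly hg0
      rw [hs] at h1
      have h3 := eval_reverse_mul_pow (one_mul (1 : F)) g
      have h4 := eval_reverse_mul_pow (neg_mul_neg (1 : F) 1 |>.trans (one_mul 1)) g
      rw [h1, eval_mul, eval_C, one_pow, mul_one] at h3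
      have h5 : g.coeff 0 = 1 :=
        mul_right_cancel₀ (h0 1 (one_mul 1)) (h3.trans (one_mul _).symm)
      rw [h5, C_1, one_mul] at h1
      refine ⟨hg, ?_, h1⟩
      rw [h1] at h4
      have h6 : (-1 : F) ^ g.natDegree = 1 :=
        mul_left_cancel₀ (h0 (-1) (neg_mul_neg (1 : F) 1 |>.trans (one_mul 1)))
          (h4.trans (mul_one _).symm)
      by_contra hodd
      rw [Nat.not_even_iff_odd] at hodd
      rw [hodd.neg_one_pow] at h6
      exact h2 (by linear_combination -h6)

theorem isPal_mul_starPoly {p : F[X]} (hp : p.Monic) (h : p.coeff 0 ≠ 0) :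
    IsPal (p * starPoly p) := by
  refine ⟨hp.mul (monic_starPoly h), ?_, ?_⟩
  · rw [hp.natDegree_mul (monic_starPoly h), natDegree_starPoly h]
    exact Even.add_self _
  · rw [reverse_mul_of_domain, reverse_eq_C_mul_starPoly h,
      reverse_eq_C_mul_starPoly (coeff_zero_starPoly_ne_zero hp h), starPoly_starPoly hp h,
      coeff_zero_starPoly hp]
    have : C (p.coeff 0) * C (p.coeff 0)⁻¹ = 1 := by rw [← C_mul, mul_inv_cancel₀ h, C_1]
    linear_combination (starPoly p * p) * this

theorem isPal_of_eval_ne_zero (h2 : (2 : F) ≠ 0) {p : F[X]} (hpm : p.Monic)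
    (h : p.coeff 0 ≠ 0) (hs : starPoly p = p) (hr : ∀ r : F, r * r = 1 → p.eval r ≠ 0) :
    IsPal p :=
  isPal_of_starPoly h2 _ rfl hpm h hs fun r hr' => by
    rw [multiplicity_eq_zero.2 fun hd => hr r hr' (dvd_iff_isRoot.1 hd)]
    exact Even.zero

theorem starPoly_X_sub_C {r : F} (hr : r * r = 1) : starPoly (X - C r) = X - C r := by
  rw [starPoly, reverse_X_sub_C hr, ← mul_assoc, ← C_mul, coeff_sub, coeff_X_zero, coeff_C_zero,
    zero_sub, inv_mul_cancel₀, C_1, one_mul]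
  rintro h
  rw [neg_eq_zero] at h
  rw [h, zero_mul] at hr
  exact zero_ne_one hr

end Palindromic

/-! ### Inverse, dual and adjoint: the invariants of an isometry are self-reciprocal -/

section Duality

open Module LinearMap Polynomial

variable {F : Type u} [Field F] {V V' : Type u} [AddCommGroup V] [Module F V]
  [AddCommGroup V'] [Module F V']

theorem aeval_reverse_of_mul_eq_one {A : Type*} [Ring A] [Algebra F A] {x y : A} (hxy : x * y = 1)
    (hyx : y * x = 1) (p : F[X]) : aeval x p.reverse = aeval y p * x ^ p.natDegree := by
  have key : ∀ N, ∀ f : F[X], f.natDegree ≤ N → aeval x (reflect N f) = aeval y f * x ^ N := by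
    intro N f hf
    refine induction_with_natDegree_le (fun f => aeval x (reflect N f) = aeval y f * x ^ N) N
      (by simp) (fun n a _ hn => ?_) (fun f g _ _ hf hg => ?_) f hf
    · have h1 : y ^ n * x ^ n = 1 := by
        rw [← (show Commute y x from hyx.trans hxy.symm).mul_pow, hyx, one_pow]
      rw [reflect_C_mul_X_pow, revAt_le hn, map_mul, map_mul, aeval_C, map_pow, map_pow, aeval_X,
        aeval_X, mul_assoc, ← Nat.add_sub_of_le hn, pow_add x n, ← mul_assoc (y ^ n), h1, one_mul]
      simp
    · rw [reflect_add, map_add, map_add, hf, hg, add_mul]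
  exact key _ p le_rfl

theorem aeval_starPoly_of_mul_eq_one {A : Type*} [Ring A] [Algebra F A] {x y : A}
    (hxy : x * y = 1) (hyx : y * x = 1) (p : F[X]) :
    aeval x (starPoly p) = (p.coeff 0)⁻¹ • (aeval y p * x ^ p.natDegree) := by
  rw [starPoly, map_mul, aeval_C, aeval_reverse_of_mul_eq_one hxy hyx, ← Algebra.smul_def]

theorem powRank_of_isUnit_mul {N u : End F V} (hu : IsUnit u) (h : Commute N u) (k : ℕ) :
    powRank (N * u) k = powRank N k := by
  have hs : Function.Surjective ⇑(u ^ k) := ((Module.End.isUnit_iff _).1 (hu.pow k)).2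
  rw [powRank, powRank, h.mul_pow, Module.End.mul_eq_comp,
    LinearMap.range_comp_of_range_eq_top _ (LinearMap.range_eq_top.2 hs)]

theorem powRank_aeval_starPoly {x y : End F V} (hxy : x * y = 1) (hyx : y * x = 1) {p : F[X]}
    (hp : p.coeff 0 ≠ 0) (k : ℕ) :
    powRank (aeval x (starPoly p)) k = powRank (aeval y p) k := by
  have hux : IsUnit x := ⟨⟨x, y, hxy, hyx⟩, rfl⟩
  have hu : IsUnit ((p.coeff 0)⁻¹ • x ^ p.natDegree) := by
    rw [Algebra.smul_def]
    exact ((inv_ne_zero hp).isUnit.map (algebraMap F (End F V))).mul (hux.pow _)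
  rw [aeval_starPoly_of_mul_eq_one hxy hyx, ← mul_smul_comm]
  refine powRank_of_isUnit_mul hu ?_ k
  have hc : Commute y x := hyx.trans hxy.symm
  have h1 : ∀ q : F[X], Commute (aeval y q) x := by
    intro q
    induction q using Polynomial.induction_on' with
    | add p q hp' hq' =>
      rw [map_add]
      exact hp'.add_left hq'
    | monomial n a =>
      rw [aeval_monomial]
      exact (show Commute (algebraMap F (End F V) a) x from Algebra.commutes a x).mul_left
        (hc.pow_left n)
  exact ((h1 p).pow_right _).smul_right _

theorem powRank_dualMap [FiniteDimensional F V] (A : End F V) (k : ℕ) :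
    powRank (V := Dual F V) A.dualMap k = powRank A k := by
  have h : ∀ k, (A.dualMap : End F (Dual F V)) ^ k = (A ^ k).dualMap := by
    intro k
    induction k with
    | zero => rw [pow_zero, pow_zero]; rfl
    | succ k ih =>
      rw [pow_succ', ih, pow_succ, Module.End.mul_eq_comp, Module.End.mul_eq_comp,
        LinearMap.dualMap_comp_dualMap]
  rw [powRank, h, LinearMap.finrank_range_dualMap_eq_finrank_range, powRank]

theorem aeval_dualMap (A : End F V) (p : F[X]) :
    aeval (R := F) (A.dualMap : End F (Dual F V)) p = (aeval A p).dualMap := by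
  have h : ∀ k, (A.dualMap : End F (Dual F V)) ^ k = (A ^ k).dualMap := by
    intro k
    induction k with
    | zero => rw [pow_zero, pow_zero]; rfl
    | succ k ih =>
      rw [pow_succ', ih, pow_succ, Module.End.mul_eq_comp, Module.End.mul_eq_comp,
        LinearMap.dualMap_comp_dualMap]
  induction p using Polynomial.induction_on' with
  | add p q hp hq => rw [map_add, hp, hq, map_add]; exact LinearMap.ext fun f => LinearMap.ext fun v => by simp
  | monomial n a =>
    rw [aeval_monomial, aeval_monomial, h]
    ext f v
    simp

theorem HasInv.dualMap [FiniteDimensional F V] {x : End F V} {G : ℕ → F[X]} (h : HasInv x G) :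
    HasInv (V := Dual F V) x.dualMap G := by
  refine ⟨h.zero, h.monic, fun p hp hpm j => ?_⟩
  rw [aeval_dualMap, powRank_dualMap, powRank_dualMap, powRank_dualMap]
  exact h.rank p hp hpm j

theorem HasInv.coeff_zero_ne_zero {x y : End F V} (hxy : x * y = 1) (hyx : y * x = 1)
    {G : ℕ → F[X]} (h : HasInv x G) (i : ℕ) : (G i).coeff 0 ≠ 0 := by
  cases i with
  | zero => simp [h.zero]
  | succ j =>
    have h1 := h.rank X irreducible_X monic_X j
    have h3 : ∀ k, powRank (aeval x (X : F[X])) k = finrank F V := by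
      intro k
      have hux : IsUnit x := ⟨⟨x, y, hxy, hyx⟩, rfl⟩
      have hs : Function.Surjective ⇑(x ^ k) := ((Module.End.isUnit_iff _).1 (hux.pow k)).2
      rw [aeval_X, powRank, LinearMap.range_eq_top.2 hs, finrank_top]
    rw [h3, h3, h3, natDegree_X] at h1
    have h4 : multiplicity X (G (j + 1)) = 0 := by omega
    rw [multiplicity_eq_zero, X_dvd_iff] at h4
    exact h4

theorem multiplicity_starPoly {p g : F[X]} (hp : Irreducible p) (hpm : p.Monic)
    (hp0 : p.coeff 0 ≠ 0) (hg : g.Monic) (hg0 : g.coeff 0 ≠ 0) :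
    multiplicity p (starPoly g) = multiplicity (starPoly p) g := by
  have hs := irreducible_starPoly hp hpm hp0
  have hf := hp.finiteMultiplicity (monic_starPoly hg0)
  have hf' := hs.finiteMultiplicity hg
  have key : ∀ k, p ^ k ∣ starPoly g ↔ starPoly p ^ k ∣ g := by
    intro k
    have := pow_starPoly_dvd_iff (monic_starPoly hp0) (coeff_zero_starPoly_ne_zero hpm hp0) hg hg0 k
    rwa [starPoly_starPoly hpm hp0] at this
  apply le_antisymm
  · rw [← hf'.pow_dvd_iff_le_multiplicity, ← key]
    exact pow_multiplicity_dvd _ _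
  · rw [← hf.pow_dvd_iff_le_multiplicity, key]
    exact pow_multiplicity_dvd _ _

/-- Up to an invertible factor, evaluating `starPoly p` at `x` is evaluating `p` at `y`. The
irreducible `X` has no reciprocal and is treated apart; it does not occur, as `x` is invertible. -/
theorem HasInv.starPoly {x y : End F V} (hxy : x * y = 1) (hyx : y * x = 1)
    {G : ℕ → F[X]} (h : HasInv x G) : HasInv y fun i => starPoly (G i) := by
  have h0 := h.coeff_zero_ne_zero hxy hyx
  refine ⟨by rw [h.zero, starPoly_one], fun i => monic_starPoly (h0 i), fun p hp hpm j => ?_⟩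
  by_cases hp0 : p.coeff 0 = 0
  · have h1 : multiplicity p (_root_.starPoly (G (j + 1))) = 0 := by
      rw [multiplicity_eq_zero]
      intro hd
      exact coeff_zero_starPoly_ne_zero (h.monic _) (h0 _)
        (X_dvd_iff.1 ((X_dvd_iff.2 hp0).trans hd))
    have hpX : X = p := irreducible_X.eq_of_dvd_monic hp monic_X hpm (X_dvd_iff.2 hp0)
    have h3 : ∀ k, powRank (aeval y p) k = finrank F V := by
      intro k
      have hux : IsUnit y := ⟨⟨y, x, hyx, hxy⟩, rfl⟩
      have hs : Function.Surjective ⇑(y ^ k) := ((Module.End.isUnit_iff _).1 (hux.pow k)).2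
      rw [← hpX, aeval_X, powRank, LinearMap.range_eq_top.2 hs, finrank_top]
    rw [h1, h3, h3, h3]
    omega
  · rw [multiplicity_starPoly hp hpm hp0 (h.monic _) (h0 _), ← powRank_aeval_starPoly hxy hyx hp0,
      ← powRank_aeval_starPoly hxy hyx hp0, ← powRank_aeval_starPoly hxy hyx hp0,
      ← natDegree_starPoly hp0]
    exact h.rank _ (irreducible_starPoly hp hpm hp0) (monic_starPoly hp0) j

theorem powRank_eq_of_adjoint [FiniteDimensional F V] {ε : F} {b : V →ₗ[F] V →ₗ[F] F}
    (hb : IsForm ε b) {A A' : End F V} (h : ∀ v w, b (A v) w = b v (A' w)) (k : ℕ) :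
    powRank A k = powRank A' k := by
  have hinj : Function.Injective ⇑b := by
    rw [← LinearMap.ker_eq_bot, LinearMap.ker_eq_bot']
    intro v hv
    exact hb.nondeg v fun w => by rw [hv]; rfl
  let θ : V ≃ₗ[F] Dual F V := LinearEquiv.ofInjectiveOfFinrankEq b hinj
    Subspace.dual_finrank_eq.symm
  rw [← powRank_dualMap A']
  exact powRank_eq_of_equiv θ (fun v => LinearMap.ext fun w => h v w) k

theorem IsTriple.adj_aeval {ε : F} {b : V →ₗ[F] V →ₗ[F] F} {x y : End F V}
    (h : IsTriple ε b x y) (p : F[X]) (v w : V) : b (aeval x p v) w = b v (aeval y p w) := by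
  have key : ∀ (k : ℕ) (v w : V), b ((x ^ k) v) w = b v ((y ^ k) w) := by
    intro k
    induction k with
    | zero => simp
    | succ k ih =>
      intro v w
      rw [pow_succ, pow_succ', Module.End.mul_apply, Module.End.mul_apply, ih, h.adj]
  induction p using Polynomial.induction_on' with
  | add p q hp hq => simp [hp, hq]
  | monomial n a => simp [aeval_monomial, key]

/-- The form makes `p(x)` and `p(y)` adjoint, so they have the same ranks; thus `x` and its inverse
`y` share their invariants. -/
theorem IsTriple.starPoly_eq [FiniteDimensional F V] {ε : F} {b : V →ₗ[F] V →ₗ[F] F}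
    {x y : End F V} (h : IsTriple ε b x y) {G : ℕ → F[X]} (hG : HasInv x G) (i : ℕ) :
    starPoly (G i) = G i := by
  have h1 : HasInv y G := ⟨hG.zero, hG.monic, fun p hp hpm j => by
    simp only [← powRank_eq_of_adjoint h.form (h.adj_aeval p)]
    exact hG.rank p hp hpm j⟩
  exact congrFun ((hG.starPoly h.xy h.yx).unique h1) i

theorem IsTriple.formRank_eq_multiplicity [FiniteDimensional F V] {ε : F}
    {b : V →ₗ[F] V →ₗ[F] F} {x y : End F V} (h : IsTriple ε b x y) {G : ℕ → F[X]}
    (hG : HasInv x G) (k : ℕ) :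
    formRank (resForm b x k) = multiplicity (X - C 1) (G (k + 1)) := by
  have h1 := hG.rank _ (irreducible_X_sub_C 1) (monic_X_sub_C 1) k
  have h2 := formRank_resForm h k
  have h3 : aeval x (X - C (1 : F)) = x - 1 := by simp
  rw [h3, natDegree_X_sub_C] at h1
  omega

theorem IsTriple.formRank_neg_eq_multiplicity [FiniteDimensional F V] {ε : F}
    {b : V →ₗ[F] V →ₗ[F] F} {x y : End F V} (h : IsTriple ε b x y) {G : ℕ → F[X]}
    (hG : HasInv x G) (k : ℕ) :
    formRank (resForm b (-x) k) = multiplicity (X - C (-1)) (G (k + 1)) := by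
  have h1 := hG.rank _ (irreducible_X_sub_C (-1)) (monic_X_sub_C (-1)) k
  have h2 := formRank_resForm h.neg k
  have h3 : aeval x (X - C (-1 : F)) = (-x - 1) * -1 := by
    simp
    abel
  have h4 : ∀ k, powRank (aeval x (X - C (-1 : F))) k = powRank (-x - 1) k := by
    intro k
    rw [h3]
    exact powRank_of_isUnit_mul (u := (-1 : End F V)) isUnit_one.neg (Commute.neg_one_right _) k
  rw [h4, h4, h4, natDegree_X_sub_C] at h1
  omega

end Duality

/-! ### Complete invariants, orthogonal sums and hyperbolic blocks -/

section Data

open Module LinearMap Polynomial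

variable {F : Type u} [Field F] {V V' : Type u} [AddCommGroup V] [Module F V]
  [AddCommGroup V'] [Module F V']

theorem IsTriple.resForm_comm {b : V →ₗ[F] V →ₗ[F] F} {x y : End F V} (h : IsTriple (-1) b x y)
    {k : ℕ} (hk : Odd k) (v w : ker ((x - 1) ^ (k + 1))) :
    resForm b x k v w = resForm b x k w v := by
  rw [resForm_symm h, hk.neg_one_pow]
  ring

/-- `G` and `d` are the isometry invariants of the endomorphism `x` of the symplectic space
`(V, b)`. -/
structure HasData (b : V →ₗ[F] V →ₗ[F] F) (x : End F V) (G : ℕ → F[X]) (d : ℕ → ℤˣ × ℤˣ) :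
    Prop where
  inv : HasInv x G
  dsc_eq : ∀ k, Odd k → d (k + 1) = (dsc (resForm b x k), dsc (resForm b (-x) k))
  eq_one : ∀ i, Odd i ∨ i = 0 → d i = 1

theorem exists_hasData [FiniteDimensional F V] (b : V →ₗ[F] V →ₗ[F] F) (x : End F V) :
    ∃ G d, HasData b x G d := by
  classical
  obtain ⟨G, hG⟩ := exists_hasInv x
  refine ⟨G, fun i => if Odd i ∨ i = 0 then 1 else
    (dsc (resForm b x (i - 1)), dsc (resForm b (-x) (i - 1))), hG, fun k hk => ?_,
    fun i hi => if_pos hi⟩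
  rw [if_neg]
  · rfl
  · rintro (h | h)
    · exact Nat.not_even_iff_odd.2 h hk.add_one
    · omega

theorem HasData.unique {b : V →ₗ[F] V →ₗ[F] F} {x : End F V} {G G' : ℕ → F[X]}
    {d d' : ℕ → ℤˣ × ℤˣ} (h : HasData b x G d) (h' : HasData b x G' d') : G = G' ∧ d = d' := by
  refine ⟨h.inv.unique h'.inv, funext fun i => ?_⟩
  by_cases hi : Odd i ∨ i = 0
  · rw [h.eq_one i hi, h'.eq_one i hi]
  · push Not at hi
    obtain ⟨k, rfl⟩ := Nat.exists_eq_succ_of_ne_zero hi.2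
    have hk : Odd k := by
      by_contra hk
      exact Nat.not_odd_iff_even.2 (Nat.not_odd_iff_even.1 hi.1) (Nat.not_odd_iff_even.1 hk).add_one
    rw [h.dsc_eq k hk, h'.dsc_eq k hk]

theorem HasData.isometric [Finite F] [FiniteDimensional F V] [FiniteDimensional F V']
    (h2 : (2 : F) ≠ 0) {b : V →ₗ[F] V →ₗ[F] F} {x y : End F V} {b' : V' →ₗ[F] V' →ₗ[F] F}
    {x' y' : End F V'} (h : IsTriple (-1) b x y) (h' : IsTriple (-1) b' x' y') {G : ℕ → F[X]}
    {d : ℕ → ℤˣ × ℤˣ} (hd : HasData b x G d) (hd' : HasData b' x' G d) :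
    Isometric b x b' x' := by
  obtain ⟨θ, hθ⟩ := hd.inv.exists_equiv hd'.inv
  have key : ∀ k, Odd k → (dsc (resForm b x k), dsc (resForm b (-x) k)) =
      (dsc (resForm b' x' k), dsc (resForm b' (-x') k)) := fun k hk => by
    rw [← hd.dsc_eq k hk, ← hd'.dsc_eq k hk]
  exact isometric_of_equiv h2 h h' θ hθ (fun k hk => congrArg Prod.fst (key k hk))
    fun k hk => congrArg Prod.snd (key k hk)

/-- A map of symplectic spaces which is semilinear with respect to `σ`, multiplies the form by
`a` and intertwines `x` and `x'` scales the discriminants of the residual forms. -/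
theorem dsc_resForm_eq_of_map [Finite F] [FiniteDimensional F V] [FiniteDimensional F V']
    {b : V →ₗ[F] V →ₗ[F] F} {x y : End F V} {b' : V' →ₗ[F] V' →ₗ[F] F} {x' y' : End F V'}
    (h : IsTriple (-1) b x y) (h' : IsTriple (-1) b' x' y') (σ : F ≃+* F) {a : F} (ha : a ≠ 0)
    (f : V →+ V') (hx : ∀ v, f (x v) = x' (f v)) (hf : ∀ v w, b' (f v) (f w) = a * σ (b v w))
    {k : ℕ} (hk : Odd k) (hr : formRank (resForm b x k) = formRank (resForm b' x' k)) :
    dsc (resForm b' x' k) = qchi a ^ formRank (resForm b x k) * dsc (resForm b x k) := by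
  have hp : ∀ (j : ℕ) (v : V), f (((x - 1) ^ j) v) = ((x' - 1) ^ j) (f v) := by
    intro j
    induction j with
    | zero => simp
    | succ j ih =>
      intro v
      rw [pow_succ, pow_succ, Module.End.mul_apply, Module.End.mul_apply, ih]
      simp [hx]
  have hmem : ∀ v : ker ((x - 1) ^ (k + 1)), f (v : V) ∈ ker ((x' - 1) ^ (k + 1)) := by
    intro v
    rw [LinearMap.mem_ker, ← hp, LinearMap.mem_ker.1 v.2, map_zero]
  refine dsc_eq_of_map (h.resForm_comm hk) (h'.resForm_comm hk) σ ha
    (fun v => ⟨f v, hmem v⟩) (fun v w => ?_) hr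
  rw [resForm_apply, resForm_apply, ← hf, hp]

theorem IsTriple.orthSum {ε : F} {b : V →ₗ[F] V →ₗ[F] F} {x y : End F V}
    {b' : V' →ₗ[F] V' →ₗ[F] F} {x' y' : End F V'} (h : IsTriple ε b x y)
    (h' : IsTriple ε b' x' y') :
    IsTriple ε (orthSum b b') (prodMap x x') (prodMap y y') := by
  refine ⟨⟨fun v w => ?_, fun v hv => ?_⟩, ?_, ?_, fun v w => ?_⟩
  · simp [h.form.symm v.1, h'.form.symm v.2, mul_add]
  · refine Prod.ext (h.form.nondeg _ fun w => ?_) (h'.form.nondeg _ fun w => ?_)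
    · simpa using hv (w, 0)
    · simpa using hv (0, w)
  · ext v <;> simp [h.xy_apply, h'.xy_apply]
  · ext v <;> simp [h.yx_apply, h'.yx_apply]
  · simp [h.isom, h'.isom]

theorem dsc_resForm_orthSum [Finite F] [FiniteDimensional F V] [FiniteDimensional F V']
    {b : V →ₗ[F] V →ₗ[F] F} {x y : End F V} {b' : V' →ₗ[F] V' →ₗ[F] F} {x' y' : End F V'}
    (h : IsTriple (-1) b x y) (h' : IsTriple (-1) b' x' y') {k : ℕ} (hk : Odd k) :
    dsc (resForm (orthSum b b') (prodMap x x') k) =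
      dsc (resForm b x k) * dsc (resForm b' x' k) := by
  have hp : ∀ (j : ℕ) (v : V × V'), ((prodMap x x' - 1 : End F (V × V')) ^ j) v =
      (((x - 1) ^ j) v.1, ((x' - 1) ^ j) v.2) := by
    intro j
    induction j with
    | zero => intro v; rfl
    | succ j ih =>
      intro v
      rw [pow_succ, Module.End.mul_apply, ih, pow_succ, pow_succ]
      simp
  let f : ker ((x - 1) ^ (k + 1)) × ker ((x' - 1) ^ (k + 1)) →ₗ[F]
      ker ((prodMap x x' - 1 : End F (V × V')) ^ (k + 1)) :=
    (prodMap (Submodule.subtype _) (Submodule.subtype _)).codRestrict _ fun v => by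
      rw [LinearMap.mem_ker, hp]
      exact Prod.ext v.1.2 v.2.2
  have hsurj : Function.Surjective f := by
    rintro ⟨v, hv⟩
    rw [LinearMap.mem_ker, hp] at hv
    exact ⟨(⟨v.1, congrArg Prod.fst hv⟩, ⟨v.2, congrArg Prod.snd hv⟩), rfl⟩
  have hs := h.resForm_comm hk
  have hs' := h'.resForm_comm hk
  have hs2 := (h.orthSum h').resForm_comm hk
  have hsum : ∀ v w, orthSum (resForm b x k) (resForm b' x' k) v w =
      orthSum (resForm b x k) (resForm b' x' k) w v := fun v w => by
    rw [orthSum_apply, orthSum_apply, hs v.1, hs' v.2]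
  have hf : ∀ v w, resForm (orthSum b b') (prodMap x x') k (f v) (f w) =
      1 * orthSum (resForm b x k) (resForm b' x' k) v w := by
    intro v w
    rw [one_mul, orthSum_apply, resForm_apply, resForm_apply, resForm_apply, hp]
    rfl
  rw [← dsc_orthSum hs hs', dsc_eq_of_map hsum hs2 (RingEquiv.refl F) one_ne_zero f hf
    (formRank_eq_of_map (ε := 1) (by simpa using hs2) one_ne_zero f hf fun v' => ?_),
    qchi_one, one_pow, one_mul]
  obtain ⟨v, rfl⟩ := hsurj v'
  exact ⟨v, rfl⟩

theorem HasData.orthSum [Finite F] [FiniteDimensional F V] [FiniteDimensional F V']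
    {b : V →ₗ[F] V →ₗ[F] F} {x y : End F V} {b' : V' →ₗ[F] V' →ₗ[F] F} {x' y' : End F V'}
    (h : IsTriple (-1) b x y) (h' : IsTriple (-1) b' x' y') {G G' : ℕ → F[X]}
    {d d' : ℕ → ℤˣ × ℤˣ} (hd : HasData b x G d) (hd' : HasData b' x' G' d') :
    HasData (orthSum b b') (prodMap x x') (fun i => G i * G' i) (fun i => d i * d' i) := by
  refine ⟨hd.inv.prodMap hd'.inv, fun k hk => ?_, fun i hi => ?_⟩
  · have hn : -(prodMap x x' : End F (V × V')) = prodMap (-x) (-x') := by ext v <;> simp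
    rw [hd.dsc_eq k hk, hd'.dsc_eq k hk, hn, dsc_resForm_orthSum h h' hk,
      dsc_resForm_orthSum h.neg h'.neg hk]
    rfl
  · rw [hd.eq_one i hi, hd'.eq_one i hi, one_mul]

/-- The invariants `G`, `d` occur for some isometry of a symplectic space over `F`. -/
def Realizes (G : ℕ → F[X]) (d : ℕ → ℤˣ × ℤˣ) : Prop :=
  ∃ (V : Type u) (_ : AddCommGroup V) (_ : Module F V) (_ : FiniteDimensional F V)
    (b : V →ₗ[F] V →ₗ[F] F) (x y : End F V), IsTriple (-1) b x y ∧ HasData b x G d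

theorem Realizes.mul [Finite F] {G G' : ℕ → F[X]} {d d' : ℕ → ℤˣ × ℤˣ} (h : Realizes G d)
    (h' : Realizes G' d') : Realizes (fun i => G i * G' i) (fun i => d i * d' i) := by
  obtain ⟨V, _, _, _, b, x, y, h1, h2⟩ := h
  obtain ⟨V', _, _, _, b', x', y', h1', h2'⟩ := h'
  exact ⟨V × V', _, _, inferInstance, _, _, _, h1.orthSum h1', h2.orthSum h1 h1' h2'⟩

theorem IsTriple.dsc_eq_one [FiniteDimensional F V] {b : V →ₗ[F] V →ₗ[F] F} {x y : End F V}
    (h : IsTriple (-1) b x y) {G : ℕ → F[X]} (hG : HasInv x G) {k : ℕ} (hk : Odd k)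
    (h0 : (G (k + 1)).eval 1 ≠ 0) : dsc (resForm b x k) = 1 :=
  dsc_eq_one_of_formRank_eq_zero (h.resForm_comm hk) (by
    rw [h.formRank_eq_multiplicity hG, multiplicity_eq_zero]
    exact fun hd => h0 (dvd_iff_isRoot.1 hd))

theorem IsTriple.dsc_neg_eq_one [FiniteDimensional F V] {b : V →ₗ[F] V →ₗ[F] F} {x y : End F V}
    (h : IsTriple (-1) b x y) {G : ℕ → F[X]} (hG : HasInv x G) {k : ℕ} (hk : Odd k)
    (h0 : (G (k + 1)).eval (-1) ≠ 0) : dsc (resForm b (-x) k) = 1 :=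
  dsc_eq_one_of_formRank_eq_zero (h.neg.resForm_comm hk) (by
    rw [h.formRank_neg_eq_multiplicity hG, multiplicity_eq_zero]
    exact fun hd => h0 (dvd_iff_isRoot.1 hd))

theorem IsTriple.hasData_one [FiniteDimensional F V] {b : V →ₗ[F] V →ₗ[F] F} {x y : End F V}
    (h : IsTriple (-1) b x y) {G : ℕ → F[X]} (hG : HasInv x G)
    (h0 : ∀ k, Odd k → (G (k + 1)).eval 1 ≠ 0 ∧ (G (k + 1)).eval (-1) ≠ 0) :
    HasData b x G 1 :=
  ⟨hG, fun k hk => by rw [h.dsc_eq_one hG hk (h0 k hk).1, h.dsc_neg_eq_one hG hk (h0 k hk).2]; rfl,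
    fun _ _ => rfl⟩

theorem Realizes.congr {G G' : ℕ → F[X]} {d d' : ℕ → ℤˣ × ℤˣ} (h : Realizes G d)
    (hG : ∀ i, G i = G' i) (hd : ∀ i, d i = d' i) : Realizes G' d' := by
  rwa [funext hG, funext hd] at h

theorem realizes_one : Realizes (1 : ℕ → F[X]) 1 := by
  have hp : ∀ (x : End F PUnit.{u + 1}) k, powRank x k = 0 := fun x k =>
    Module.finrank_zero_of_subsingleton
  have h1 : IsTriple (-1) (0 : PUnit.{u + 1} →ₗ[F] PUnit.{u + 1} →ₗ[F] F) 1 1 :=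
    ⟨⟨by simp, fun v _ => Subsingleton.elim _ _⟩, one_mul 1, one_mul 1, by simp⟩
  have h3 : HasInv (1 : End F PUnit.{u + 1}) (1 : ℕ → F[X]) := by
    refine ⟨rfl, fun _ => monic_one, fun p hp' _ j => ?_⟩
    rw [hp, hp, hp, Pi.one_apply, multiplicity_eq_zero.2 hp'.not_dvd_one]
    simp
  exact ⟨_, _, _, inferInstance, _, _, _, h1, h1.hasData_one h3 (by simp)⟩

theorem exists_root_mul_eq_one {f : F[X]} (h : f.coeff 0 ≠ 0) :
    ∃ t : AdjoinRoot f, AdjoinRoot.root f * t = 1 := by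
  refine ⟨AdjoinRoot.mk f (f.divX * C (-(f.coeff 0)⁻¹)), ?_⟩
  rw [← AdjoinRoot.mk_X, ← map_mul, ← map_one (AdjoinRoot.mk f), AdjoinRoot.mk_eq_mk]
  refine ⟨C (-(f.coeff 0)⁻¹), ?_⟩
  have h1 := f.divX_mul_X_add
  have h3 : C (f.coeff 0) * C (-(f.coeff 0)⁻¹) = (-1 : F[X]) := by
    rw [← C_mul, mul_neg, mul_inv_cancel₀ h, C_neg, C_1]
  linear_combination C (-(f.coeff 0)⁻¹) * h1 - h3

theorem cyc_mul_mulLeft {f : F[X]} {t : AdjoinRoot f} (h : AdjoinRoot.root f * t = 1) :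
    cyc f * LinearMap.mulLeft F t = 1 :=
  LinearMap.ext fun v => show AdjoinRoot.root f * (t * v) = v by rw [← mul_assoc, h, one_mul]

theorem mulLeft_mul_cyc {f : F[X]} {t : AdjoinRoot f} (h : AdjoinRoot.root f * t = 1) :
    LinearMap.mulLeft F t * cyc f = 1 :=
  LinearMap.ext fun v => show t * (AdjoinRoot.root f * v) = v by
    rw [← mul_assoc, mul_comm t, h, one_mul]

/-- The space is `A × Dual F A` with its canonical alternating pairing; `x` acts by the root on `A`
and by the inverse transpose on the dual, which supplies the reciprocal block. The condition on `i`
and `p` excludes every symmetric residual form, so all signs are 1. -/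
theorem realizes_hyperbolic {p : F[X]} (hp : Irreducible p) (hpm : p.Monic)
    (hp0 : p.coeff 0 ≠ 0) {i : ℕ} (hi : Odd i ∨ p.eval 1 ≠ 0 ∧ p.eval (-1) ≠ 0) :
    Realizes (fun j => blockInv p i j * blockInv (starPoly p) i j) 1 := by
  have hfd : FiniteDimensional F (AdjoinRoot (p ^ i)) := (hpm.pow i).finite_adjoinRoot
  obtain ⟨t, ht⟩ := exists_root_mul_eq_one (f := p ^ i) (by
    rw [coeff_zero_eq_eval_zero, eval_pow, ← coeff_zero_eq_eval_zero]
    exact pow_ne_zero _ hp0)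
  let A := AdjoinRoot (p ^ i)
  let x : End F A := cyc (p ^ i)
  let y : End F A := LinearMap.mulLeft F t
  have hxy : x * y = 1 := cyc_mul_mulLeft ht
  have hyx : y * x = 1 := mulLeft_mul_cyc ht
  have hG := hasInv_cyc hp hpm i
  have hG' := hG.prodMap (hG.starPoly hxy hyx).dualMap
  let b : (A × Dual F A) →ₗ[F] (A × Dual F A) →ₗ[F] F :=
    LinearMap.mk₂ F (fun v w => w.2 v.1 - v.2 w.1) (fun _ _ _ => by simp; ring)
      (fun _ _ _ => by simp; ring) (fun _ _ _ => by simp; ring) (fun _ _ _ => by simp; ring)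
  have hb : ∀ v w, b v w = w.2 v.1 - v.2 w.1 := fun _ _ => rfl
  have h1 : IsTriple (-1) b (prodMap x (y.dualMap : End F (Dual F A)))
      (prodMap y (x.dualMap : End F (Dual F A))) := by
    refine ⟨⟨fun v w => ?_, fun v hv => ?_⟩, ?_, ?_, fun v w => ?_⟩
    · rw [hb, hb]; ring
    · refine Prod.ext ?_ (LinearMap.ext fun w => ?_)
      · rw [Prod.fst_zero, ← Module.forall_dual_apply_eq_zero_iff F]
        intro f
        simpa [hb] using hv (0, f)
      · simpa [hb] using hv (w, 0)
    · refine LinearMap.ext fun v => Prod.ext (LinearMap.congr_fun hxy v.1) (LinearMap.ext fun w => ?_)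
      exact congrArg v.2 (LinearMap.congr_fun hxy w)
    · refine LinearMap.ext fun v => Prod.ext (LinearMap.congr_fun hyx v.1) (LinearMap.ext fun w => ?_)
      exact congrArg v.2 (LinearMap.congr_fun hyx w)
    · have h3 : ∀ v, y (x v) = v := LinearMap.congr_fun hyx
      simp [hb, LinearMap.dualMap_apply, h3]
  have hs : ∀ j, starPoly (blockInv p i j) = blockInv (starPoly p) i j := by
    intro j
    unfold blockInv
    split_ifs
    exacts [rfl, starPoly_one]
  refine ⟨_, _, _, inferInstance, _, _, _, h1, ?_⟩
  have := h1.hasData_one hG' ?_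
  · simpa only [hs] using this
  · intro k hk
    simp only [hs, eval_mul]
    unfold blockInv
    by_cases hki : k + 1 = i
    · have hpe := hi.resolve_left fun h => Nat.not_even_iff_odd.2 (hki ▸ h) hk.add_one
      have hr : ∀ r : F, r * r = 1 → p.eval r ≠ 0 → (starPoly p).eval r ≠ 0 := by
        intro r hr h
        rw [← eval_reverse_mul_pow hr, reverse_eq_C_mul_starPoly hp0, eval_mul] at h
        exact right_ne_zero_of_mul (left_ne_zero_of_mul h)
      rw [if_pos ⟨hki, by omega⟩, if_pos ⟨hki, by omega⟩]
      exact ⟨mul_ne_zero hpe.1 (hr 1 (by simp) hpe.1), mul_ne_zero hpe.2 (hr _ (by simp) hpe.2)⟩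
    · rw [if_neg fun h => hki h.1, if_neg fun h => hki h.1]
      simp

end Data

/-! ### Invariant symplectic forms on cyclic modules -/

section CyclicBlocks

open Module LinearMap Polynomial

variable {F : Type u} [Field F]

/-- Since `f` is self-reciprocal, the inverse `t` of the root is again a root, and exchanging the
two is an involution of the algebra. -/
theorem exists_star {f : F[X]} (hf0 : f.coeff 0 ≠ 0) (hs : starPoly f = f) {t : AdjoinRoot f}
    (ht : AdjoinRoot.root f * t = 1) :
    ∃ s : AdjoinRoot f →ₐ[F] AdjoinRoot f, s (AdjoinRoot.root f) = t ∧
      s t = AdjoinRoot.root f ∧ ∀ u, s (s u) = u := by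
  have ht' : t * AdjoinRoot.root f = 1 := by rw [mul_comm, ht]
  have h0 : aeval t f = 0 := by
    have h1 := aeval_starPoly_of_mul_eq_one ht ht' f
    rw [hs, AdjoinRoot.aeval_eq, AdjoinRoot.mk_self, eq_comm, smul_eq_zero_iff_right
      (inv_ne_zero hf0)] at h1
    have hu : IsUnit (AdjoinRoot.root f) := ⟨⟨_, t, ht, ht'⟩, rfl⟩
    exact (hu.pow _).mul_left_eq_zero.1 h1
  let s : AdjoinRoot f →ₐ[F] AdjoinRoot f := AdjoinRoot.liftAlgHom f (Algebra.ofId F _) t h0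
  have h1 : s (AdjoinRoot.root f) = t := AdjoinRoot.liftAlgHom_root _ _ _ _
  have h2 : s t = AdjoinRoot.root f := by
    have h3 : t * s t = 1 := by rw [← h1, ← map_mul, h1, ht, map_one]
    calc s t = (AdjoinRoot.root f * t) * s t := by rw [ht, one_mul]
      _ = AdjoinRoot.root f := by rw [mul_assoc, h3, mul_one]
  have h4 : s.comp s = AlgHom.id F _ := AdjoinRoot.algHom_ext (by
    rw [AlgHom.comp_apply, h1, h2, AlgHom.id_apply])
  exact ⟨s, h1, h2, fun u => AlgHom.congr_fun h4 u⟩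

/-- The local ring `F[X] / (p ^ i)` has a simple socle, the elements killed by `p`, so every nonzero
ideal contains it. -/
theorem exists_mul_eq_of_socle {p : F[X]} (hp : Irreducible p) {i : ℕ}
    {z u : AdjoinRoot (p ^ i)} (hz : z ≠ 0) (hpz : AdjoinRoot.mk (p ^ i) p * z = 0) (hu : u ≠ 0) :
    ∃ c, z = u * c := by
  obtain ⟨Z, rfl⟩ := AdjoinRoot.mk_surjective z
  obtain ⟨U, rfl⟩ := AdjoinRoot.mk_surjective u
  rw [← map_mul, AdjoinRoot.mk_eq_zero] at hpz
  rw [Ne, AdjoinRoot.mk_eq_zero] at hz hu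
  cases i with
  | zero => simp at hz
  | succ n =>
    have hp0 := hp.ne_zero
    rw [pow_succ', mul_dvd_mul_iff_left hp0] at hpz
    obtain ⟨Z', rfl⟩ := hpz
    have hU0 : U ≠ 0 := fun h => hu (h ▸ dvd_zero _)
    obtain ⟨U', hU, hU'⟩ :=
      (FiniteMultiplicity.of_prime_left hp.prime hU0).exists_eq_pow_mul_and_not_dvd
    set m := multiplicity p U
    have hm : m ≤ n := by
      by_contra hm
      apply hu
      rw [hU]
      exact (pow_dvd_pow p (by omega)).mul_right U'
    obtain ⟨a, c, hac⟩ : IsCoprime U' (p ^ (n + 1)) :=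
      (((hp.coprime_iff_not_dvd).2 hU').symm).pow_right
    refine ⟨AdjoinRoot.mk _ (a * p ^ (n - m) * Z'), ?_⟩
    rw [← map_mul, AdjoinRoot.mk_eq_mk, hU]
    refine ⟨c * p ^ n * Z', ?_⟩
    have h1 : p ^ n = p ^ m * p ^ (n - m) := by rw [← pow_add, Nat.add_sub_cancel' hm]
    calc p ^ n * Z' - p ^ m * U' * (a * p ^ (n - m) * Z')
        = (p ^ n - (p ^ m * p ^ (n - m)) * (a * U')) * Z' := by ring
      _ = p ^ n * (1 - a * U') * Z' := by rw [← h1]; ring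
      _ = p ^ (n + 1) * (c * p ^ n * Z') := by rw [← hac]; ring

/-- The form is `b u v = m (u * s v)` for a functional `m` with `m ∘ s = -m`. A radical vector `u ≠
0` would force `m` to vanish on the ideal it generates, hence on the socle. So what is needed is a
socle element `z` that is skew for `s`: then antisymmetrizing a functional with `ℓ z ≠ 0` keeps it
nonzero at `z`. -/
theorem exists_isTriple_cyc (h2 : (2 : F) ≠ 0) {p : F[X]} (hp : Irreducible p) {i : ℕ}
    {t : AdjoinRoot (p ^ i)} (ht : AdjoinRoot.root (p ^ i) * t = 1)
    {s : AdjoinRoot (p ^ i) →ₐ[F] AdjoinRoot (p ^ i)} (hs1 : s (AdjoinRoot.root (p ^ i)) = t)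
    (hss : ∀ u, s (s u) = u) {z : AdjoinRoot (p ^ i)} (hz : z ≠ 0)
    (hpz : AdjoinRoot.mk (p ^ i) p * z = 0) (hzs : s z = -z) :
    ∃ b, IsTriple (-1) b (cyc (p ^ i)) (LinearMap.mulLeft F t) := by
  obtain ⟨ℓ, hℓ⟩ : ∃ ℓ : Dual F (AdjoinRoot (p ^ i)), ℓ z ≠ 0 := by
    by_contra h
    push Not at h
    exact hz ((Module.forall_dual_apply_eq_zero_iff F z).1 h)
  let m : AdjoinRoot (p ^ i) →ₗ[F] F := ℓ - ℓ ∘ₗ s.toLinearMap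
  have hm : ∀ u, m u = ℓ u - ℓ (s u) := fun _ => rfl
  have hms : ∀ u, m (s u) = - m u := fun u => by rw [hm, hm, hss]; ring
  have hmz : m z ≠ 0 := by
    rw [hm, hzs, map_neg, sub_neg_eq_add, ← two_mul]
    exact mul_ne_zero h2 hℓ
  let b : AdjoinRoot (p ^ i) →ₗ[F] AdjoinRoot (p ^ i) →ₗ[F] F :=
    LinearMap.mk₂ F (fun u v => m (u * s v)) (fun _ _ _ => by rw [add_mul, map_add])
      (fun _ _ _ => by rw [smul_mul_assoc, map_smul]) (fun _ _ _ => by rw [map_add, mul_add, map_add])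
      (fun _ _ _ => by rw [map_smul, mul_smul_comm, map_smul])
  have hb : ∀ u v, b u v = m (u * s v) := fun _ _ => rfl
  refine ⟨b, ⟨fun u v => ?_, fun u hu => ?_⟩, cyc_mul_mulLeft ht, mulLeft_mul_cyc ht,
    fun u v => ?_⟩
  · rw [hb, hb, neg_one_mul, ← hms, map_mul s, hss, mul_comm]
  · by_contra hu0
    obtain ⟨c, rfl⟩ := exists_mul_eq_of_socle hp hz hpz hu0
    apply hmz
    rw [← hss c, ← hb]
    exact hu _
  · rw [hb, hb, cyc_apply, cyc_apply, map_mul s, hs1, mul_mul_mul_comm, ht, one_mul]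

theorem coeff_zero_pow_ne_zero {p : F[X]} (h : p.coeff 0 ≠ 0) (i : ℕ) : (p ^ i).coeff 0 ≠ 0 := by
  rw [coeff_zero_eq_eval_zero, eval_pow, ← coeff_zero_eq_eval_zero]
  exact pow_ne_zero _ h

theorem realizes_cyc_of_isPal (h2 : (2 : F) ≠ 0) {p : F[X]} (hp : Irreducible p) (hpal : IsPal p)
    (h1 : p.eval 1 ≠ 0) (h1' : p.eval (-1) ≠ 0) {i : ℕ} (hi : i ≠ 0) :
    Realizes (blockInv p i) 1 := by
  obtain ⟨n, rfl⟩ := Nat.exists_eq_succ_of_ne_zero hi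
  have hp0 : p.coeff 0 ≠ 0 := by rw [hpal.coeff_zero]; exact one_ne_zero
  have hf0 := coeff_zero_pow_ne_zero hp0 (n + 1)
  have hfd : FiniteDimensional F (AdjoinRoot (p ^ (n + 1))) :=
    (hpal.monic.pow (n + 1)).finite_adjoinRoot
  obtain ⟨t, ht⟩ := exists_root_mul_eq_one hf0
  obtain ⟨s, hs1, hs2, hss⟩ := exists_star hf0 (by rw [starPoly_pow, hpal.starPoly_eq]) ht
  obtain ⟨k, hk⟩ := hpal.even
  set a := AdjoinRoot.root (p ^ (n + 1)) with ha
  set P := AdjoinRoot.mk (p ^ (n + 1)) p with hP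
  have hPs : s P = P * t ^ (k + k) := by
    have h3 := aeval_starPoly_of_mul_eq_one ht (by rw [mul_comm, ht]) p
    rw [hpal.starPoly_eq, hpal.coeff_zero, inv_one, one_smul, hk, AdjoinRoot.aeval_eq] at h3
    have h4 : s P = aeval t p := by
      rw [hP, ← AdjoinRoot.aeval_eq, ← aeval_algHom_apply, hs1]
    have h5 : P = aeval t p * a ^ (k + k) := h3
    rw [h4, h5, mul_assoc, ← mul_pow, ht, one_pow, mul_one]
  obtain ⟨b, hb⟩ : ∃ b, IsTriple (-1) b (cyc (p ^ (n + 1))) (LinearMap.mulLeft F t) := by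
    -- With `deg p = 2k`, the element `t ^ k * P` is fixed by `s`, while `a - t` is skew. The
    -- product lies in the socle, and is nonzero because `p` does not divide `X ^ 2 - 1`.
    refine exists_isTriple_cyc h2 hp ht hs1 hss (z := t ^ (k * n) * P ^ n * (a - t)) ?_ ?_ ?_
    · intro hz
      have h3 : a ^ (k * n) * a * (t ^ (k * n) * P ^ n * (a - t)) = P ^ n * (a ^ 2 - 1) := by
        have h4 : a ^ (k * n) * t ^ (k * n) = 1 := by rw [← mul_pow, ht, one_pow]
        linear_combination (P ^ n * a * (a - t)) * h4 - P ^ n * ht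
      rw [hz, mul_zero, eq_comm, hP, ha, ← AdjoinRoot.mk_X, ← map_pow, ← map_pow,
        ← map_one (AdjoinRoot.mk _), ← map_sub, ← map_mul, AdjoinRoot.mk_eq_zero, pow_succ,
        mul_dvd_mul_iff_left (pow_ne_zero _ hp.ne_zero)] at h3
      have h5 : (X : F[X]) ^ 2 - 1 = (X - C 1) * (X - C (-1)) := by
        rw [C_neg, C_1]; ring
      rw [h5] at h3
      rcases hp.prime.dvd_or_dvd h3 with h | h
      · rw [hp.eq_of_dvd_monic (irreducible_X_sub_C 1) hpal.monic (monic_X_sub_C 1) h] at h1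
        simp at h1
      · rw [hp.eq_of_dvd_monic (irreducible_X_sub_C _) hpal.monic (monic_X_sub_C _) h] at h1'
        simp at h1'
    · have h3 : P * P ^ n = 0 := by
        rw [← pow_succ', hP, ← map_pow, AdjoinRoot.mk_self]
      linear_combination (t ^ (k * n) * (a - t)) * h3
    · have h4 : a ^ (k * n) * t ^ (k * n) = 1 := by rw [← mul_pow, ht, one_pow]
      rw [map_mul, map_mul, map_sub, map_pow, map_pow, hPs, hs1, hs2]
      have h5 : (P * t ^ (k + k)) ^ n = P ^ n * (t ^ (k * n) * t ^ (k * n)) := by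
        rw [mul_pow, ← pow_mul, ← pow_add]
        ring_nf
      rw [h5]
      linear_combination (P ^ n * t ^ (k * n) * (t - a)) * h4
  refine ⟨_, _, _, hfd, b, _, _, hb, hb.hasData_one (hasInv_cyc hp hpal.monic _) ?_⟩
  intro k _
  unfold blockInv
  split_ifs
  · exact ⟨h1, h1'⟩
  · simp

theorem exists_isTriple_cyc_X_sub_C (h2 : (2 : F) ≠ 0) {r : F} (hr : r * r = 1) {i : ℕ}
    (hi : Even i) (hi0 : i ≠ 0) : ∃ b y, IsTriple (-1) b (cyc ((X - C r) ^ i)) y := by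
  obtain ⟨n, rfl⟩ := Nat.exists_eq_succ_of_ne_zero hi0
  have hp0 : (X - C r).coeff 0 ≠ 0 := by
    rw [coeff_sub, coeff_X_zero, coeff_C_zero, zero_sub, neg_ne_zero]
    exact left_ne_zero_of_mul_eq_one hr
  have hn : Odd n := by
    by_contra hn
    exact Nat.not_odd_iff_even.2 hi (Nat.not_odd_iff_even.1 hn).add_one
  have hf0 := coeff_zero_pow_ne_zero hp0 (n + 1)
  obtain ⟨t, ht⟩ := exists_root_mul_eq_one hf0
  obtain ⟨s, hs1, hs2, hss⟩ := exists_star hf0 (by rw [starPoly_pow, starPoly_X_sub_C hr]) ht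
  set a := AdjoinRoot.root ((X - C r) ^ (n + 1)) with ha
  set c := AdjoinRoot.of ((X - C r) ^ (n + 1)) r with hc
  have hcr : c * c = 1 := by rw [hc, ← map_mul, hr, map_one]
  have hac : AdjoinRoot.mk ((X - C r) ^ (n + 1)) (X - C r) = a - c := by
    rw [map_sub, AdjoinRoot.mk_X, AdjoinRoot.mk_C]
  have hsc : s c = c := s.commutes r
  have h0 : (a - c) * (a - c) ^ n = 0 := by
    rw [← pow_succ', ← hac, ← map_pow, AdjoinRoot.mk_self]
  refine ⟨_, _, (exists_isTriple_cyc h2 (irreducible_X_sub_C r) ht hs1 hss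
    (z := (a - c) ^ n) ?_ ?_ ?_).choose_spec⟩
  · rw [← hac, ← map_pow, Ne, AdjoinRoot.mk_eq_zero, pow_succ]
    intro h
    exact (irreducible_X_sub_C r).not_isUnit (isUnit_of_dvd_one
      ((mul_dvd_mul_iff_left (pow_ne_zero n (X_sub_C_ne_zero r))).1 (by simpa using h)))
  · rw [hac, h0]
  -- On the socle `a` acts as `c`, so `c * t` acts as 1, and `s` multiplies `(a - c) ^ n` by `(-1) ^
  -- n`. This is where odd `n`, that is, even block size, is needed.
  · have h1 : t - c = -(c * t) * (a - c) := by linear_combination c * ht - t * hcr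
    have h3 : (c * t) * (a - c) ^ n = (a - c) ^ n := by
      linear_combination (a - c) ^ n * ht - t * h0
    have h4 : ∀ k, (c * t) ^ k * (a - c) ^ n = (a - c) ^ n := by
      intro k
      induction k with
      | zero => rw [pow_zero, one_mul]
      | succ k ih => rw [pow_succ (c * t) k, mul_assoc, h3, ih]
    rw [map_pow, map_sub, hs1, hsc, h1, mul_pow, hn.neg_pow, neg_mul, h4]

/-- Multiplying the form by a nonsquare flips the discriminant of a residual form of rank one. -/
theorem IsTriple.exists_dsc_eq [Finite F] (h2 : (2 : F) ≠ 0) {V : Type u} [AddCommGroup V]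
    [Module F V] [FiniteDimensional F V] {b : V →ₗ[F] V →ₗ[F] F} {x y : End F V}
    (h : IsTriple (-1) b x y) {k : ℕ} (hk : Odd k) (hr : formRank (resForm b x k) = 1) (e : ℤˣ) :
    ∃ b', IsTriple (-1) b' x y ∧ dsc (resForm b' x k) = e := by
  by_cases he : dsc (resForm b x k) = e
  · exact ⟨b, h, he⟩
  obtain ⟨a, ha⟩ := FiniteField.exists_nonsquare (F := F) (by
    intro h
    apply h2
    have := ringChar.Nat.cast_ringChar (R := F)
    rw [h] at this
    exact_mod_cast this)
  have ha0 : a ≠ 0 := fun h => ha (h ▸ IsSquare.zero)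
  have hq : qchi a = -1 := (Int.units_eq_one_or _).resolve_left fun h => ha (qchi_eq_one_iff.1 h)
  have h' : IsTriple (-1) (a • b) x y := by
    refine ⟨⟨fun v w => ?_, fun v hv => h.form.nondeg v fun w => ?_⟩, h.xy, h.yx, fun v w => ?_⟩
    · simp [h.form.symm v w]
    · simpa [ha0] using hv w
    · simp [h.isom]
  refine ⟨a • b, h', ?_⟩
  have h3 : formRank (resForm b x k) = formRank (resForm (a • b) x k) := by
    have h4 := formRank_resForm h k
    have h5 := formRank_resForm h' k
    omega
  rw [dsc_resForm_eq_of_map h h' (RingEquiv.refl F) ha0 (AddMonoidHom.id V) (fun _ => rfl)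
    (fun _ _ => rfl) hk h3, hr, hq, pow_one]
  rcases Int.units_eq_one_or (dsc (resForm b x k)) with h4 | h4 <;>
    rcases Int.units_eq_one_or e with h5 | h5 <;> simp_all

theorem eval_blockInv_ne_zero {p : F[X]} {i j : ℕ} {r : F} (h : j ≠ i ∨ p.eval r ≠ 0) :
    (blockInv p i j).eval r ≠ 0 := by
  unfold blockInv
  split_ifs with h1
  · exact h.resolve_left fun h => h h1.1
  · simp

/-- A single block of even size at the eigenvalue 1 carries a form with either sign. Two blocks are
needed for an even rank; the first takes the sign `e` and the second the sign 1. -/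
theorem realizes_cyc_sq_one [Finite F] (h2 : (2 : F) ≠ 0) {i : ℕ} (hi : Even i) (hi0 : i ≠ 0)
    (e : ℤˣ) : Realizes (fun j => blockInv (X - C (1 : F)) i j * blockInv (X - C 1) i j)
      (fun j => if j = i then (e, 1) else 1) := by
  obtain ⟨n, rfl⟩ := Nat.exists_eq_succ_of_ne_zero hi0
  have hn : Odd n := by
    by_contra hn
    exact Nat.not_odd_iff_even.2 hi (Nat.not_odd_iff_even.1 hn).add_one
  have hfd : FiniteDimensional F (AdjoinRoot ((X - C (1 : F)) ^ (n + 1))) :=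
    ((monic_X_sub_C (1 : F)).pow (n + 1)).finite_adjoinRoot
  have hG := hasInv_cyc (irreducible_X_sub_C (1 : F)) (monic_X_sub_C 1) (n + 1)
  obtain ⟨b, y, hb⟩ := exists_isTriple_cyc_X_sub_C h2 (one_mul (1 : F)) hi hi0
  have hr : formRank (resForm b (cyc ((X - C (1 : F)) ^ (n + 1))) n) = 1 := by
    rw [hb.formRank_eq_multiplicity hG, blockInv, if_pos ⟨rfl, hi0⟩, multiplicity_self]
  have key : ∀ e : ℤˣ, Realizes (blockInv (X - C (1 : F)) (n + 1))
      (fun j => if j = n + 1 then (e, 1) else 1) := by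
    intro e
    obtain ⟨b', hb', he⟩ := hb.exists_dsc_eq h2 hn hr e
    refine ⟨_, _, _, hfd, b', _, _, hb', hG, fun k hk => ?_, fun j hj => if_neg ?_⟩
    · have h3 : dsc (resForm b' (-cyc ((X - C (1 : F)) ^ (n + 1))) k) = 1 :=
        hb'.dsc_neg_eq_one hG hk (eval_blockInv_ne_zero (Or.inr (by
          simp only [eval_sub, eval_X, eval_C]
          intro h
          apply h2
          linear_combination -h)))
      by_cases hkn : k = n
      · subst hkn
        rw [if_pos rfl, he, h3]
      · rw [if_neg (by omega), h3,
          hb'.dsc_eq_one hG hk (eval_blockInv_ne_zero (Or.inl (by omega)))]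
        rfl
    · rintro rfl
      rcases hj with h | h
      · exact Nat.not_even_iff_odd.2 h hi
      · omega
  refine ((key e).mul (key 1)).congr (fun _ => rfl) fun j => ?_
  split_ifs <;> simp

/-- The same construction, with the sign adjusted for `-x` in place of `x`. -/
theorem realizes_cyc_sq_neg_one [Finite F] (h2 : (2 : F) ≠ 0) {i : ℕ} (hi : Even i) (hi0 : i ≠ 0)
    (e : ℤˣ) : Realizes (fun j => blockInv (X - C (-1 : F)) i j * blockInv (X - C (-1)) i j)
      (fun j => if j = i then (1, e) else 1) := by
  obtain ⟨n, rfl⟩ := Nat.exists_eq_succ_of_ne_zero hi0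
  have hn : Odd n := by
    by_contra hn
    exact Nat.not_odd_iff_even.2 hi (Nat.not_odd_iff_even.1 hn).add_one
  have hfd : FiniteDimensional F (AdjoinRoot ((X - C (-1 : F)) ^ (n + 1))) :=
    ((monic_X_sub_C (-1 : F)).pow (n + 1)).finite_adjoinRoot
  have hG := hasInv_cyc (irreducible_X_sub_C (-1 : F)) (monic_X_sub_C (-1)) (n + 1)
  obtain ⟨b, y, hb⟩ := exists_isTriple_cyc_X_sub_C h2 (neg_mul_neg (1 : F) 1 |>.trans (one_mul 1))
    hi hi0
  have hr : formRank (resForm b (-cyc ((X - C (-1 : F)) ^ (n + 1))) n) = 1 := by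
    rw [hb.formRank_neg_eq_multiplicity hG, blockInv, if_pos ⟨rfl, hi0⟩, multiplicity_self]
  have key : ∀ e : ℤˣ, Realizes (blockInv (X - C (-1 : F)) (n + 1))
      (fun j => if j = n + 1 then (1, e) else 1) := by
    intro e
    obtain ⟨b', hb', he⟩ := hb.neg.exists_dsc_eq h2 hn hr e
    have hb'' := hb'.neg
    rw [neg_neg, neg_neg] at hb''
    refine ⟨_, _, _, hfd, b', _, _, hb'', hG, fun k hk => ?_, fun j hj => if_neg ?_⟩
    · have h3 : dsc (resForm b' (cyc ((X - C (-1 : F)) ^ (n + 1))) k) = 1 :=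
        hb''.dsc_eq_one hG hk (eval_blockInv_ne_zero (Or.inr (by
          simp only [eval_sub, eval_X, eval_C]
          intro h
          apply h2
          linear_combination h)))
      by_cases hkn : k = n
      · subst hkn
        rw [if_pos rfl, he, h3]
      · rw [if_neg (by omega), h3,
          hb''.dsc_neg_eq_one hG hk (eval_blockInv_ne_zero (Or.inl (by omega)))]
        rfl
    · rintro rfl
      rcases hj with h | h
      · exact Nat.not_even_iff_odd.2 h hi
      · omega
  refine ((key e).mul (key 1)).congr (fun _ => rfl) fun j => ?_
  split_ifs <;> simp

end CyclicBlocks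

/-! ### Every admissible family of invariants occurs -/

section Realization

open Module LinearMap Polynomial

variable {F : Type u} [Field F]

/-- The possible invariants of the isometries of symplectic spaces for which the multiplicities of
the eigenvalues `1` and `-1` in all invariant polynomials are even. -/
structure Admissible (G : ℕ → F[X]) (d : ℕ → ℤˣ × ℤˣ) : Prop where
  zero : G 0 = 1
  pal : ∀ i, IsPal (G i)
  fst : ∀ i, Odd i ∨ i = 0 ∨ (G i).eval 1 ≠ 0 → (d i).1 = 1
  snd : ∀ i, Odd i ∨ i = 0 ∨ (G i).eval (-1) ≠ 0 → (d i).2 = 1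

/-- The smallest piece to peel off `g`: a double linear factor at 1 or -1, a self-reciprocal
irreducible, or an irreducible times its reciprocal. The last two clauses describe the sign `s` of
the piece: each component is either the prescribed one or is 1 with the piece irrelevant to that
sign. This keeps the remaining data admissible. -/
theorem exists_block [Finite F] (h2 : (2 : F) ≠ 0) {g : F[X]} (hg : IsPal g) (hg1 : g ≠ 1) {i : ℕ}
    (hi : i ≠ 0) (e : ℤˣ × ℤˣ) :
    ∃ (q : F[X]) (s : ℤˣ × ℤˣ), IsPal q ∧ q.natDegree ≠ 0 ∧ q ∣ g ∧
      Realizes (fun j => if j = i then q else 1) (fun j => if j = i then s else 1) ∧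
      (s.1 = e.1 ∨ s.1 = 1 ∧ (Odd i ∨ q.eval 1 ≠ 0)) ∧
      (s.2 = e.2 ∨ s.2 = 1 ∧ (Odd i ∨ q.eval (-1) ≠ 0)) := by
  have hb : ∀ (p : F[X]) j, blockInv p i j = if j = i then p else 1 := fun p j => by
    simp [blockInv, hi]
  have hgu : ¬ IsUnit g := fun h => hg1 (hg.monic.eq_one_of_isUnit h)
  have hg0 : g.coeff 0 ≠ 0 := by rw [hg.coeff_zero]; exact one_ne_zero
  have hd1 : ∀ j, (if j = i then (1 : ℤˣ × ℤˣ) else 1) = 1 := fun j => ite_self _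
  have hdeg : ∀ r : F, ((X - C r) ^ 2).natDegree ≠ 0 := fun r => by
    rw [natDegree_pow, natDegree_X_sub_C]
    norm_num
  have h21 : (1 : F) - -1 ≠ 0 := fun h => h2 (by linear_combination h)
  have h22 : (-1 : F) - 1 ≠ 0 := fun h => h2 (by linear_combination -h)
  have hsq : ∀ (r : F), r * r = 1 → g.eval r = 0 → Odd i →
      ∃ q : F[X], IsPal q ∧ q.natDegree ≠ 0 ∧ q ∣ g ∧
      Realizes (fun j => if j = i then q else 1) (fun j => if j = i then 1 else 1) := by
    intro r hr h0 hio
    obtain ⟨g', hg', -⟩ := hg.exists_of_root h2 hr h0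
    refine ⟨(X - C r) ^ 2, isPal_X_sub_C_sq hr, hdeg _, ⟨g', hg'⟩, ?_⟩
    refine (realizes_hyperbolic (irreducible_X_sub_C r) (monic_X_sub_C r) ?_ (Or.inl hio)).congr
      (fun j => ?_) fun j => (hd1 j).symm
    · rw [coeff_sub, coeff_X_zero, coeff_C_zero, zero_sub, neg_ne_zero]
      exact left_ne_zero_of_mul_eq_one hr
    · rw [starPoly_X_sub_C hr, hb]
      split_ifs
      exacts [(sq _).symm, one_mul 1]
  have hm1 : (-1 : F) * -1 = 1 := by ring
  by_cases h1 : g.eval 1 = 0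
  · rcases Nat.even_or_odd i with hie | hio
    · obtain ⟨g', hg', -⟩ := hg.exists_of_root h2 (one_mul 1) h1
      refine ⟨(X - C 1) ^ 2, (e.1, 1), isPal_X_sub_C_sq (one_mul 1), hdeg _,
        ⟨g', hg'⟩, ?_, Or.inl rfl, Or.inr ⟨rfl, Or.inr ?_⟩⟩
      · refine (realizes_cyc_sq_one h2 hie hi e.1).congr (fun j => ?_) fun j => rfl
        rw [hb]
        split_ifs
        exacts [(sq _).symm, one_mul 1]
      · simpa using h22
    · obtain ⟨q, hq1, hq2, hq3, hq4⟩ := hsq 1 (one_mul 1) h1 hio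
      exact ⟨q, 1, hq1, hq2, hq3, hq4, Or.inr ⟨rfl, Or.inl hio⟩, Or.inr ⟨rfl, Or.inl hio⟩⟩
  by_cases h1' : g.eval (-1) = 0
  · rcases Nat.even_or_odd i with hie | hio
    · obtain ⟨g', hg', -⟩ := hg.exists_of_root h2 hm1 h1'
      refine ⟨(X - C (-1)) ^ 2, (1, e.2), isPal_X_sub_C_sq hm1, hdeg _,
        ⟨g', hg'⟩, ?_, Or.inr ⟨rfl, Or.inr ?_⟩, Or.inl rfl⟩
      · refine (realizes_cyc_sq_neg_one h2 hie hi e.2).congr (fun j => ?_) fun j => rfl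
        rw [hb]
        split_ifs
        exacts [(sq _).symm, one_mul 1]
      · simpa using h21
    · obtain ⟨q, hq1, hq2, hq3, hq4⟩ := hsq (-1) hm1 h1' hio
      exact ⟨q, 1, hq1, hq2, hq3, hq4, Or.inr ⟨rfl, Or.inl hio⟩, Or.inr ⟨rfl, Or.inl hio⟩⟩
  obtain ⟨p, hpm, hp, hpg⟩ := exists_monic_irreducible_factor g hgu
  obtain ⟨g', hg'⟩ := hpg
  have hp0 : p.coeff 0 ≠ 0 := by
    rw [hg', mul_coeff_zero] at hg0
    exact left_ne_zero_of_mul hg0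
  have hev : ∀ q, q ∣ g → q.eval 1 ≠ 0 ∧ q.eval (-1) ≠ 0 := by
    rintro q ⟨q', rfl⟩
    rw [eval_mul] at h1 h1'
    exact ⟨left_ne_zero_of_mul h1, left_ne_zero_of_mul h1'⟩
  have hpe := hev p ⟨g', hg'⟩
  by_cases hps : starPoly p = p
  · have hpal : IsPal p := by
      refine isPal_of_eval_ne_zero h2 hpm hp0 hps fun r hr => ?_
      have : (r - 1) * (r - -1) = 0 := by linear_combination hr
      rcases mul_eq_zero.1 this with h | h
      · rw [sub_eq_zero.1 h]; exact hpe.1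
      · rw [sub_eq_zero.1 h]; exact hpe.2
    refine ⟨p, 1, hpal, hp.natDegree_pos.ne', ⟨g', hg'⟩, ?_, Or.inr ⟨rfl, Or.inr hpe.1⟩,
      Or.inr ⟨rfl, Or.inr hpe.2⟩⟩
    exact (realizes_cyc_of_isPal h2 hp hpal hpe.1 hpe.2 hi).congr (hb p) fun j => (hd1 j).symm
  · have hdvd : p * starPoly p ∣ g := by
      have h3 : starPoly p ∣ g := by
        rw [← hg.starPoly_eq]
        exact starPoly_dvd ⟨g', hg'⟩
      refine IsCoprime.mul_dvd ?_ ⟨g', hg'⟩ h3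
      rw [hp.coprime_iff_not_dvd]
      exact fun h => hps (hp.eq_of_dvd_monic (irreducible_starPoly hp hpm hp0) hpm
        (monic_starPoly hp0) h).symm
    have hqe := hev _ hdvd
    refine ⟨p * starPoly p, 1, isPal_mul_starPoly hpm hp0, ?_, hdvd, ?_,
      Or.inr ⟨rfl, Or.inr hqe.1⟩, Or.inr ⟨rfl, Or.inr hqe.2⟩⟩
    · rw [hpm.natDegree_mul (monic_starPoly hp0)]
      have := hp.natDegree_pos
      omega
    · refine (realizes_hyperbolic hp hpm hp0 (Or.inr hpe) (i := i)).congr (fun j => ?_)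
        fun j => (hd1 j).symm
      rw [hb, hb]
      split_ifs
      exacts [rfl, one_mul 1]

/-- Induction on the total degree: one block from `exists_block` is split off as an orthogonal
summand. The bound `N` makes the total degree a finite sum. -/
theorem Admissible.realizes [Finite F] (h2 : (2 : F) ≠ 0) (N : ℕ) : ∀ (m : ℕ) {G : ℕ → F[X]}
    {d : ℕ → ℤˣ × ℤˣ}, Admissible G d → (∀ i ≥ N, G i = 1) →
    ∑ j ∈ Finset.range N, (G j).natDegree = m → Realizes G d := by
  intro m
  induction m using Nat.strong_induction_on with
  | _ m ih =>
    intro G d h hN hm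
    by_cases hG : ∀ i, G i = 1
    · refine realizes_one.congr (fun i => (hG i).symm) fun i => ?_
      exact (Prod.ext (h.fst i (by simp [hG])) (h.snd i (by simp [hG]))).symm
    · push Not at hG
      obtain ⟨i, hi⟩ := hG
      have hi0 : i ≠ 0 := by
        rintro rfl
        exact hi h.zero
      have hiN : i < N := by
        by_contra hiN
        exact hi (hN i (not_lt.1 hiN))
      obtain ⟨q, s, hq, hq0, ⟨g', hg'⟩, hR, hs1, hs2⟩ := exists_block h2 (h.pal i) hi hi0 (d i)
      have hpal : IsPal g' := hq.of_mul_left (hg' ▸ h.pal i)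
      have hss : s * s = 1 := by
        refine Prod.ext ?_ ?_ <;> exact Int.units_mul_self _
      have huu : ∀ u : ℤˣ, u * u = 1 := Int.units_mul_self
      -- Signs are their own inverses, so the remaining sign is `s * d i`. A component where `s`
      -- agrees with `d i` becomes 1, which is always allowed; elsewhere `d i` is unchanged and the
      -- block does not affect the condition.
      have hA : Admissible (Function.update G i g') (Function.update d i (s * d i)) := by
        refine ⟨by rw [Function.update_of_ne hi0.symm, h.zero], fun j => ?_, fun j hj => ?_,
          fun j hj => ?_⟩
        · by_cases hji : j = i
          · rw [hji, Function.update_self]; exact hpal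
          · rw [Function.update_of_ne hji]; exact h.pal j
        · by_cases hji : j = i
          · subst hji
            rw [Function.update_self] at hj ⊢
            rw [Prod.fst_mul]
            rcases hs1 with h3 | ⟨h3, h4⟩
            · rw [h3, huu]
            · rw [h3, one_mul]
              apply h.fst
              rcases hj with h5 | h5 | h5
              · exact Or.inl h5
              · exact absurd h5 hi0
              · rcases h4 with h4 | h4
                · exact Or.inl h4
                · rw [hg', eval_mul]
                  exact Or.inr (Or.inr (mul_ne_zero h4 h5))
          · rw [Function.update_of_ne hji] at hj ⊢
            exact h.fst j hj
        · by_cases hji : j = i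
          · subst hji
            rw [Function.update_self] at hj ⊢
            rw [Prod.snd_mul]
            rcases hs2 with h3 | ⟨h3, h4⟩
            · rw [h3, huu]
            · rw [h3, one_mul]
              apply h.snd
              rcases hj with h5 | h5 | h5
              · exact Or.inl h5
              · exact absurd h5 hi0
              · rcases h4 with h4 | h4
                · exact Or.inl h4
                · rw [hg', eval_mul]
                  exact Or.inr (Or.inr (mul_ne_zero h4 h5))
          · rw [Function.update_of_ne hji] at hj ⊢
            exact h.snd j hj
      have hlt : ∑ j ∈ Finset.range N, (Function.update G i g' j).natDegree < m := by
        rw [← hm]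
        refine Finset.sum_lt_sum (fun j _ => ?_) ⟨i, Finset.mem_range.2 hiN, ?_⟩
        · by_cases hji : j = i
          · rw [hji, Function.update_self, hg', hq.monic.natDegree_mul hpal.monic]
            omega
          · rw [Function.update_of_ne hji]
        · rw [Function.update_self, hg', hq.monic.natDegree_mul hpal.monic]
          omega
      refine (hR.mul (ih _ hlt hA (fun j hj => ?_) rfl)).congr (fun j => ?_) fun j => ?_
      · rw [Function.update_of_ne (by omega), hN j hj]
      · by_cases hji : j = i
        · rw [if_pos hji, hji, Function.update_self, ← hg']
        · rw [if_neg hji, Function.update_of_ne hji, one_mul]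
      · by_cases hji : j = i
        · rw [if_pos hji, hji, Function.update_self, ← mul_assoc, hss, one_mul]
        · rw [if_neg hji, Function.update_of_ne hji, one_mul]

/-- If the residual forms have even rank then the invariants are admissible. -/
theorem HasData.admissible (h2 : (2 : F) ≠ 0) {V : Type u} [AddCommGroup V] [Module F V]
    [FiniteDimensional F V] {b : V →ₗ[F] V →ₗ[F] F} {x y : End F V} (h : IsTriple (-1) b x y)
    {G : ℕ → F[X]} {d : ℕ → ℤˣ × ℤˣ} (hd : HasData b x G d)
    (h1 : ∀ k, Odd k → Even (formRank (resForm b x k)) ∧ Even (formRank (resForm b (-x) k))) :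
    Admissible G d := by
  have hodd : ∀ (i : ℕ), ¬ (Odd i ∨ i = 0) → ∃ k, Odd k ∧ i = k + 1 := by
    intro i hi
    push Not at hi
    obtain ⟨k, rfl⟩ := Nat.exists_eq_succ_of_ne_zero hi.2
    refine ⟨k, ?_, rfl⟩
    by_contra hk
    exact hi.1 (Nat.not_odd_iff_even.1 hk).add_one
  refine ⟨hd.inv.zero, fun i => ?_, fun i hi => ?_, fun i hi => ?_⟩
  · cases i with
    | zero => rw [hd.inv.zero]; exact isPal_one
    | succ k =>
      -- For even `k` the residual form is skew-symmetric, so its rank is even without any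
      -- hypothesis.
      have key : ∀ {x y : End F V}, IsTriple (-1) b x y →
          (Odd k → Even (formRank (resForm b x k))) → Even (formRank (resForm b x k)) := by
        intro x y h hk
        by_cases hko : Odd k
        · exact hk hko
        · refine even_formRank_of_skew h2 fun v w => ?_
          rw [resForm_symm h, (Nat.not_odd_iff_even.1 hko).neg_one_pow]
          ring
      refine isPal_of_starPoly h2 _ rfl (hd.inv.monic _)
        (hd.inv.coeff_zero_ne_zero h.xy h.yx _) (h.starPoly_eq hd.inv _) fun r hr => ?_
      have : (r - 1) * (r - -1) = 0 := by linear_combination hr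
      rcases mul_eq_zero.1 this with h' | h'
      · rw [sub_eq_zero.1 h', ← h.formRank_eq_multiplicity hd.inv]
        exact key h fun hk => (h1 k hk).1
      · rw [sub_eq_zero.1 h', ← h.formRank_neg_eq_multiplicity hd.inv]
        exact key h.neg fun hk => (h1 k hk).2
  · by_cases h3 : Odd i ∨ i = 0
    · rw [hd.eq_one i h3]; rfl
    · obtain ⟨k, hk, rfl⟩ := hodd i h3
      rw [hd.dsc_eq k hk, h.dsc_eq_one hd.inv hk (by tauto)]
  · by_cases h3 : Odd i ∨ i = 0
    · rw [hd.eq_one i h3]; rfl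
    · obtain ⟨k, hk, rfl⟩ := hodd i h3
      rw [hd.dsc_eq k hk, h.dsc_neg_eq_one hd.inv hk (by tauto)]

theorem HasData.even_formRank (h2 : (2 : F) ≠ 0) {V : Type u} [AddCommGroup V] [Module F V]
    [FiniteDimensional F V] {b : V →ₗ[F] V →ₗ[F] F} {x y : End F V} (h : IsTriple (-1) b x y)
    {G : ℕ → F[X]} {d : ℕ → ℤˣ × ℤˣ} (hd : HasData b x G d) (hA : Admissible G d) (k : ℕ) :
    Even (formRank (resForm b x k)) ∧ Even (formRank (resForm b (-x) k)) := by
  rw [h.formRank_eq_multiplicity hd.inv, h.formRank_neg_eq_multiplicity hd.inv]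
  exact ⟨(hA.pal _).even_multiplicity h2 (one_mul 1) _ rfl,
    (hA.pal _).even_multiplicity h2 (by ring) _ rfl⟩

end Realization

/-! ### Semilinear transport of the invariants -/

section Semilinear

open Module LinearMap Polynomial

variable {F : Type u} [Field F] {V V' : Type u} [AddCommGroup V] [Module F V]
  [AddCommGroup V'] [Module F V']

theorem powRank_eq_of_semilinear {σ : F ≃+* F} (f : V ≃+ V') (hf : ∀ (a : F) v, f (a • v) = σ a • f v)
    {N : End F V} {N' : End F V'} (h : ∀ v, f (N v) = N' (f v)) (k : ℕ) :
    powRank N k = powRank N' k := by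
  have hp : ∀ (k : ℕ) v, f ((N ^ k) v) = (N' ^ k) (f v) := by
    intro k
    induction k with
    | zero => simp
    | succ k ih =>
      intro v
      rw [pow_succ, pow_succ, Module.End.mul_apply, Module.End.mul_apply, ih, h]
  have hp' : ∀ w, f.symm ((N' ^ k) w) = (N ^ k) (f.symm w) := fun w => by
    rw [AddEquiv.symm_apply_eq, hp, AddEquiv.apply_symm_apply]
  let j : range (N ^ k) ≃+ range (N' ^ k) :=
    { toFun := fun v => ⟨f v, by obtain ⟨_, w, rfl⟩ := v; exact ⟨f w, (hp k w).symm⟩⟩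
      invFun := fun v => ⟨f.symm v, by obtain ⟨_, w, rfl⟩ := v; exact ⟨f.symm w, (hp' w).symm⟩⟩
      left_inv := fun v => Subtype.ext (f.symm_apply_apply _)
      right_inv := fun v => Subtype.ext (f.apply_symm_apply _)
      map_add' := fun v w => Subtype.ext (map_add f _ _) }
  exact congrArg Cardinal.toNat
    (rank_eq_of_equiv_equiv σ j σ.bijective fun a v => Subtype.ext (hf a v))

theorem aeval_apply_semilinear {σ : F ≃+* F} (f : V ≃+ V')
    (hf : ∀ (a : F) v, f (a • v) = σ a • f v) {x : End F V} {x' : End F V'}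
    (h : ∀ v, f (x v) = x' (f v)) (p : F[X]) (v : V) :
    f (aeval x p v) = aeval x' (p.map (σ : F →+* F)) (f v) := by
  induction p using Polynomial.induction_on' generalizing v with
  | add p q hp hq => simp [hp, hq]
  | monomial n a =>
    simp only [map_monomial, aeval_monomial, Module.End.mul_apply, Module.algebraMap_end_apply, hf]
    congr 1
    induction n generalizing v with
    | zero => simp
    | succ n ih => rw [pow_succ, pow_succ, Module.End.mul_apply, Module.End.mul_apply, ih, h]

theorem HasInv.of_semilinear {σ : F ≃+* F} (f : V ≃+ V')
    (hf : ∀ (a : F) v, f (a • v) = σ a • f v) {x : End F V} {x' : End F V'}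
    (h : ∀ v, f (x v) = x' (f v)) {G : ℕ → F[X]} (hG : HasInv x G) :
    HasInv x' fun i => (G i).map (σ : F →+* F) := by
  refine ⟨by simp [hG.zero], fun i => (hG.monic i).map _, fun p hp hpm j => ?_⟩
  obtain ⟨q, rfl⟩ := (Polynomial.mapEquiv σ).surjective p
  have hq : Irreducible q := (MulEquiv.irreducible_iff (Polynomial.mapEquiv σ)).1 hp
  have hmap : ∀ g : F[X], Polynomial.mapEquiv σ g = g.map (σ : F →+* F) := fun g => rfl
  have hqm : q.Monic := by
    rw [hmap] at hpm
    exact Polynomial.monic_of_injective (f := (σ : F →+* F)) σ.injective hpm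
  have := hG.rank q hq hqm j
  have hr : ∀ k, powRank (aeval x' (q.map (σ : F →+* F))) k = powRank (aeval x q) k := fun k =>
    (powRank_eq_of_semilinear f hf (aeval_apply_semilinear f hf h q) k).symm
  rw [← hmap, multiplicity_map_eq, hmap, hr, hr, hr, natDegree_map]
  exact this

end Semilinear

/-! ### From conjugacy classes of the symplectic group to invariants -/

section Dictionary

open Module LinearMap Polynomial

variable {F : Type u} [Field F] {n : ℕ}

/-- The standard symplectic form. -/
noncomputable def stdForm (n : ℕ) (F : Type u) [Field F] :
    (Fin n ⊕ Fin n → F) →ₗ[F] (Fin n ⊕ Fin n → F) →ₗ[F] F :=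
  Matrix.toLinearMap₂' F (J (Fin n) F)

theorem stdForm_apply (v w : Fin n ⊕ Fin n → F) :
    stdForm n F v w = v ⬝ᵥ (J (Fin n) F *ᵥ w) := Matrix.toLinearMap₂'_apply' _ _ _

theorem stdForm_mulVec (g : Matrix (Fin n ⊕ Fin n) (Fin n ⊕ Fin n) F)
    (v w : Fin n ⊕ Fin n → F) :
    stdForm n F (g *ᵥ v) (g *ᵥ w) = v ⬝ᵥ ((gᵀ * J (Fin n) F * g) *ᵥ w) := by
  rw [stdForm_apply, ← Matrix.mulVec_mulVec, ← Matrix.mulVec_mulVec, Matrix.dotProduct_mulVec _ gᵀ,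
    Matrix.vecMul_transpose]

theorem isForm_stdForm : IsForm (-1) (stdForm n F) := by
  refine ⟨fun v w => ?_, fun v hv => ?_⟩
  · rw [stdForm_apply, stdForm_apply, Matrix.dotProduct_mulVec, ← Matrix.mulVec_transpose,
      J_transpose, Matrix.neg_mulVec, neg_dotProduct, neg_one_mul, dotProduct_comm]
  · have h1 : v ᵥ* J (Fin n) F = 0 := dotProduct_eq_zero _ fun w => by
      rw [← Matrix.dotProduct_mulVec, ← stdForm_apply, hv]
    have h2 : v ᵥ* (J (Fin n) F * J (Fin n) F) = 0 := by
      rw [← Matrix.vecMul_vecMul, h1, Matrix.zero_vecMul]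
    rw [J_squared, Matrix.vecMul_neg, Matrix.vecMul_one, neg_eq_zero] at h2
    exact h2

/-- The endomorphism given by an element of the symplectic group. -/
noncomputable def spEnd (x : symplecticGroup (Fin n) F) : End F (Fin n ⊕ Fin n → F) :=
  Matrix.mulVecLin (x : Matrix (Fin n ⊕ Fin n) (Fin n ⊕ Fin n) F)

theorem spEnd_apply (x : symplecticGroup (Fin n) F) (v : Fin n ⊕ Fin n → F) :
    spEnd x v = (x : Matrix (Fin n ⊕ Fin n) (Fin n ⊕ Fin n) F) *ᵥ v := rfl

theorem spEnd_mul (x y : symplecticGroup (Fin n) F) : spEnd (x * y) = spEnd x * spEnd y :=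
  Matrix.mulVecLin_mul _ _

theorem spEnd_one : spEnd (1 : symplecticGroup (Fin n) F) = 1 := Matrix.mulVecLin_one

theorem spEnd_injective : Function.Injective (spEnd (n := n) (F := F)) := fun _ _ h =>
  Subtype.ext ((Matrix.toLin' (R := F)).injective h)

theorem isTriple_spEnd (x : symplecticGroup (Fin n) F) :
    IsTriple (-1) (stdForm n F) (spEnd x) (spEnd x⁻¹) := by
  refine ⟨isForm_stdForm, ?_, ?_, fun v w => ?_⟩
  · rw [← spEnd_mul, mul_inv_cancel, spEnd_one]
  · rw [← spEnd_mul, inv_mul_cancel, spEnd_one]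
  · rw [spEnd_apply, spEnd_apply, stdForm_mulVec, SymplecticGroup.mem_iff'.1 x.2, stdForm_apply]

theorem exists_spEnd_eq {g : End F (Fin n ⊕ Fin n → F)}
    (hg : ∀ v w, stdForm n F (g v) (g w) = stdForm n F v w) :
    ∃ x : symplecticGroup (Fin n) F, spEnd x = g := by
  have h1 : Matrix.mulVecLin (LinearMap.toMatrix' g) = g := Matrix.toLin'_toMatrix' g
  refine ⟨⟨LinearMap.toMatrix' g, SymplecticGroup.mem_iff'.2 ?_⟩, h1⟩
  have h2 : ∀ v w : Fin n ⊕ Fin n → F,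
      v ⬝ᵥ (((LinearMap.toMatrix' g)ᵀ * J (Fin n) F * LinearMap.toMatrix' g) *ᵥ w) =
        v ⬝ᵥ (J (Fin n) F *ᵥ w) := by
    intro v w
    rw [← stdForm_mulVec, ← stdForm_apply, ← Matrix.mulVecLin_apply, ← Matrix.mulVecLin_apply, h1,
      hg]
  apply (Matrix.toLin' (R := F)).injective
  refine LinearMap.ext fun w => ?_
  exact dotProduct_eq _ _ fun v => by
    rw [dotProduct_comm, dotProduct_comm _ v]
    exact h2 v w

theorem isConj_iff_isometric {x x' : symplecticGroup (Fin n) F} :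
    IsConj x x' ↔ Isometric (stdForm n F) (spEnd x) (stdForm n F) (spEnd x') := by
  rw [isConj_iff]
  constructor
  · rintro ⟨c, hc⟩
    have hT := isTriple_spEnd c
    refine ⟨LinearEquiv.ofLinearMap (spEnd c) (spEnd c⁻¹) hT.xy hT.yx, fun v => ?_, hT.isom⟩
    change (spEnd c * spEnd x) v = (spEnd x' * spEnd c) v
    rw [← spEnd_mul, ← spEnd_mul, ← hc, inv_mul_cancel_right]
  · rintro ⟨θ, h1, h2⟩
    obtain ⟨c, hc⟩ := exists_spEnd_eq (g := θ.toLinearMap) h2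
    refine ⟨c, ?_⟩
    rw [mul_inv_eq_iff_eq_mul]
    apply spEnd_injective
    rw [spEnd_mul, spEnd_mul, hc]
    exact LinearMap.ext h1

theorem exists_spEnd_isometric (h2 : (2 : F) ≠ 0) {V : Type u} [AddCommGroup V] [Module F V]
    [FiniteDimensional F V] {b : V →ₗ[F] V →ₗ[F] F} {x y : End F V} (h : IsTriple (-1) b x y)
    (hn : finrank F V = 2 * n) :
    ∃ x' : symplecticGroup (Fin n) F, Isometric b x (stdForm n F) (spEnd x') := by
  obtain ⟨θ, -, hθ⟩ := isometric_one_of_alternating h2 _ h.form (isForm_stdForm (n := n) (F := F)) hn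
    (by simp [two_mul])
  obtain ⟨x', hx'⟩ := exists_spEnd_eq (g := θ.conj x) fun v w => by
    rw [LinearEquiv.conj_apply_apply, LinearEquiv.conj_apply_apply, hθ, h.isom, ← hθ,
      LinearEquiv.apply_symm_apply, LinearEquiv.apply_symm_apply]
  refine ⟨x', θ, fun v => ?_, hθ⟩
  rw [hx', LinearEquiv.conj_apply_apply, LinearEquiv.symm_apply_apply]

/-- The action of a diagonal automorphism times a field automorphism on the invariants. -/
theorem exists_semilinear {σ : F ≃+* F} {δ : MulAut (symplecticGroup (Fin n) F)}
    (hδ : IsDiagonalAut δ) (hδ' : ¬ IsInnerAut δ) :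
    ∃ (c : F) (f : (Fin n ⊕ Fin n → F) ≃+ (Fin n ⊕ Fin n → F)), ¬ IsSquare c ∧
      (∀ (a : F) v, f (a • v) = σ a • f v) ∧
      (∀ v w, stdForm n F (f v) (f w) = c * σ (stdForm n F v w)) ∧
      ∀ x v, f (spEnd x v) = spEnd ((δ * fieldAut n σ) x) (f v) := by
  obtain ⟨g, ⟨c, hc⟩, hg⟩ := hδ
  have hgi : g.val * (g⁻¹).val = 1 := by rw [← Units.val_mul, mul_inv_cancel, Units.val_one]
  have hig : (g⁻¹).val * g.val = 1 := by rw [← Units.val_mul, inv_mul_cancel, Units.val_one]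
  have hJ := J_squared (l := Fin n) (R := F)
  -- The similitude condition is stated as `g J gᵀ = c J`, whereas the action on column vectors
  -- needs `gᵀ J g = c J`, with the same multiplier.
  have hc' : g.valᵀ * J (Fin n) F * g.val = (c : F) • J (Fin n) F := by
    have h1 : J (Fin n) F * g.valᵀ = (c : F) • ((g⁻¹).val * J (Fin n) F) := by
      calc J (Fin n) F * g.valᵀ = ((g⁻¹).val * g.val) * (J (Fin n) F * g.valᵀ) := by
            rw [hig, Matrix.one_mul]
        _ = (g⁻¹).val * (g.val * J (Fin n) F * g.valᵀ) := by simp only [Matrix.mul_assoc]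
        _ = _ := by rw [hc, Matrix.mul_smul]
    calc g.valᵀ * J (Fin n) F * g.val
        = -((J (Fin n) F * J (Fin n) F) * g.valᵀ * J (Fin n) F * g.val) := by
          rw [hJ]; simp
      _ = -(J (Fin n) F * (J (Fin n) F * g.valᵀ) * J (Fin n) F * g.val) := by
          simp only [Matrix.mul_assoc]
      _ = -((c : F) • (J (Fin n) F * ((g⁻¹).val * ((J (Fin n) F * J (Fin n) F) * g.val)))) := by
          rw [h1]
          simp only [Matrix.mul_smul, Matrix.smul_mul, Matrix.mul_assoc]
      _ = (c : F) • J (Fin n) F := by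
          rw [hJ]
          simp
  -- Apply `σ` to the coordinates, then `g`.
  let f : (Fin n ⊕ Fin n → F) ≃+ (Fin n ⊕ Fin n → F) :=
    { toFun := fun v => g.val *ᵥ (σ ∘ v)
      invFun := fun v => σ.symm ∘ ((g⁻¹).val *ᵥ v)
      left_inv := fun v => by
        beta_reduce
        rw [Matrix.mulVec_mulVec, hig, Matrix.one_mulVec]
        funext i
        simp
      right_inv := fun v => by
        beta_reduce
        have : σ ∘ σ.symm ∘ ((g⁻¹).val *ᵥ v) = (g⁻¹).val *ᵥ v := by
          funext i
          simp
        rw [this, Matrix.mulVec_mulVec, hgi, Matrix.one_mulVec]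
      map_add' := fun v w => by
        rw [← Matrix.mulVec_add]
        congr 1
        funext i
        simp }
  have hf : ∀ v, f v = g.val *ᵥ (σ ∘ v) := fun _ => rfl
  refine ⟨c, f, ?_, fun a v => ?_, fun v w => ?_, fun x v => ?_⟩
  -- If the multiplier were `a ^ 2`, then `a⁻¹ • g` would be symplectic and induce the same
  -- conjugation, making `δ` inner.
  · rintro ⟨a, ha⟩
    have ha0 : a ≠ 0 := by
      rintro rfl
      exact c.ne_zero (by rw [ha, zero_mul])
    apply hδ'
    have hm : a⁻¹ • g.val ∈ symplecticGroup (Fin n) F := by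
      rw [SymplecticGroup.mem_iff, transpose_smul, Matrix.smul_mul, Matrix.smul_mul,
        Matrix.mul_smul, hc, smul_smul, smul_smul, ha]
      rw [show a⁻¹ * a⁻¹ * (a * a) = 1 by field_simp, one_smul]
    refine ⟨⟨a⁻¹ • g.val, hm⟩, MulEquiv.ext fun x => ?_⟩
    rw [MulAut.conj_apply, eq_mul_inv_iff_mul_eq]
    apply Subtype.ext
    change (δ x : Matrix (Fin n ⊕ Fin n) (Fin n ⊕ Fin n) F) * (a⁻¹ • g.val) =
      (a⁻¹ • g.val) * (x : Matrix (Fin n ⊕ Fin n) (Fin n ⊕ Fin n) F)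
    rw [hg, Matrix.mul_smul, Matrix.mul_assoc, hig, Matrix.mul_one, Matrix.smul_mul]
  · rw [hf, hf, ← Matrix.mulVec_smul]
    congr 1
    funext i
    simp
  · rw [hf, hf, stdForm_mulVec, hc', stdForm_apply, Matrix.smul_mulVec, dotProduct_smul,
      smul_eq_mul]
    congr 1
    have h1 : J (Fin n) F *ᵥ (σ ∘ w) = σ ∘ (J (Fin n) F *ᵥ w) := by
      funext i
      rw [Function.comp_apply, ← RingEquiv.coe_toRingHom σ, RingHom.map_mulVec]
      change _ = ((J (Fin n) F).map (σ : F →+* F) *ᵥ _) i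
      rw [map_J]
    rw [h1, ← RingEquiv.coe_toRingHom σ, RingHom.map_dotProduct]
  · have h1 : (((δ * fieldAut n σ) x : symplecticGroup (Fin n) F) :
        Matrix (Fin n ⊕ Fin n) (Fin n ⊕ Fin n) F) =
        g.val * (x : Matrix (Fin n ⊕ Fin n) (Fin n ⊕ Fin n) F).map σ * (g⁻¹).val := hg _
    rw [hf, hf, spEnd_apply, spEnd_apply, h1, Matrix.mulVec_mulVec, Matrix.mul_assoc, hig,
      Matrix.mul_one, ← Matrix.mulVec_mulVec]
    congr 1
    funext i
    rw [Function.comp_apply, ← RingEquiv.coe_toRingHom σ, RingHom.map_mulVec]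

theorem dsc_resForm_eq_of_isometric [Finite F] {V V' : Type u} [AddCommGroup V] [Module F V]
    [AddCommGroup V'] [Module F V'] [FiniteDimensional F V] [FiniteDimensional F V']
    {b : V →ₗ[F] V →ₗ[F] F} {x y : End F V} {b' : V' →ₗ[F] V' →ₗ[F] F} {x' y' : End F V'}
    (h : IsTriple (-1) b x y) (h' : IsTriple (-1) b' x' y') (hi : Isometric b x b' x') {k : ℕ}
    (hk : Odd k) : dsc (resForm b x k) = dsc (resForm b' x' k) := by
  obtain ⟨θ, h1, h2⟩ := hi
  have hr : formRank (resForm b x k) = formRank (resForm b' x' k) := by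
    have h4 := formRank_resForm h k
    have h5 := formRank_resForm h' k
    have hθ : ∀ j, powRank (x - 1) j = powRank (x' - 1) j :=
      powRank_eq_of_equiv θ fun v => by simp [h1]
    simp only [hθ] at h4
    omega
  rw [dsc_resForm_eq_of_map h h' (RingEquiv.refl F) one_ne_zero (θ : V →+ V') h1
    (fun v w => by rw [one_mul]; exact h2 v w) hk hr, qchi_one, one_pow, one_mul]

theorem HasData.of_isometric [Finite F] {V V' : Type u} [AddCommGroup V] [Module F V]
    [AddCommGroup V'] [Module F V'] [FiniteDimensional F V] [FiniteDimensional F V']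
    {b : V →ₗ[F] V →ₗ[F] F} {x y : End F V} {b' : V' →ₗ[F] V' →ₗ[F] F} {x' y' : End F V'}
    (h : IsTriple (-1) b x y) (h' : IsTriple (-1) b' x' y') (hi : Isometric b x b' x')
    {G : ℕ → F[X]} {d : ℕ → ℤˣ × ℤˣ} (hd : HasData b x G d) : HasData b' x' G d := by
  have hi' : Isometric b (-x) b' (-x') := by
    obtain ⟨θ, h1, h2⟩ := hi
    exact ⟨θ, fun v => by simp [h1], h2⟩
  refine ⟨?_, fun k hk => ?_, hd.eq_one⟩
  · obtain ⟨θ, h1, -⟩ := hi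
    exact hd.inv.of_equiv θ h1
  · rw [hd.dsc_eq k hk, dsc_resForm_eq_of_isometric h h' hi hk,
      dsc_resForm_eq_of_isometric h.neg h'.neg hi' hk]

/-- The image of `x` has invariants `σ(G i)`; once these equal `G i`, its discriminants are those of
`x` times `(-1)` to the residual ranks, the multiplier being a nonsquare. Conjugacy therefore forces
even ranks, hence admissible data; conversely admissibility makes all the sign changes trivial, and
the classification applies. -/
theorem isConj_apply_iff [Finite F] (h2 : (2 : F) ≠ 0) {σ : F ≃+* F}
    {δ : MulAut (symplecticGroup (Fin n) F)} (hδ : IsDiagonalAut δ) (hδ' : ¬ IsInnerAut δ)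
    {x : symplecticGroup (Fin n) F} {G : ℕ → F[X]} {d : ℕ → ℤˣ × ℤˣ}
    (hd : HasData (stdForm n F) (spEnd x) G d) :
    IsConj ((δ * fieldAut n σ) x) x ↔
      Admissible G d ∧ ∀ i, (G i).map (σ : F →+* F) = G i := by
  obtain ⟨c, f, hc, hf1, hf2, hf3⟩ := exists_semilinear (σ := σ) hδ hδ'
  have hc0 : c ≠ 0 := fun h => hc (h ▸ IsSquare.zero)
  have hqc : qchi c = -1 := (Int.units_eq_one_or _).resolve_left fun h => hc (qchi_eq_one_iff.1 h)
  set x' := (δ * fieldAut n σ) x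
  have h := isTriple_spEnd x
  have h' := isTriple_spEnd x'
  have hG' := hd.inv.of_semilinear f hf1 (hf3 x)
  have hrank : (∀ i, (G i).map (σ : F →+* F) = G i) → ∀ k,
      formRank (resForm (stdForm n F) (spEnd x) k) =
        formRank (resForm (stdForm n F) (spEnd x') k) ∧
      formRank (resForm (stdForm n F) (-spEnd x) k) =
        formRank (resForm (stdForm n F) (-spEnd x') k) := by
    intro hσ k
    rw [h.formRank_eq_multiplicity hd.inv, h'.formRank_eq_multiplicity hG',
      h.formRank_neg_eq_multiplicity hd.inv, h'.formRank_neg_eq_multiplicity hG', hσ]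
    exact ⟨rfl, rfl⟩
  have hdsc : (∀ i, (G i).map (σ : F →+* F) = G i) → ∀ k, Odd k →
      dsc (resForm (stdForm n F) (spEnd x') k) =
        (-1) ^ formRank (resForm (stdForm n F) (spEnd x) k) *
          dsc (resForm (stdForm n F) (spEnd x) k) ∧
      dsc (resForm (stdForm n F) (-spEnd x') k) =
        (-1) ^ formRank (resForm (stdForm n F) (-spEnd x) k) *
          dsc (resForm (stdForm n F) (-spEnd x) k) := by
    intro hσ k hk
    rw [← hqc]
    exact ⟨dsc_resForm_eq_of_map h h' σ hc0 f.toAddMonoidHom (hf3 x) hf2 hk (hrank hσ k).1,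
      dsc_resForm_eq_of_map h.neg h'.neg σ hc0 f.toAddMonoidHom
        (fun v => (map_neg f _).trans (congrArg Neg.neg (hf3 x v))) hf2 hk (hrank hσ k).2⟩
  rw [isConj_iff_isometric]
  constructor
  · intro hi
    have hd' := hd.of_isometric h h' hi.symm
    have hσ : ∀ i, (G i).map (σ : F →+* F) = G i := congrFun (hG'.unique hd'.inv)
    refine ⟨hd.admissible h2 h fun k hk => ?_, hσ⟩
    have h3 := hdsc hσ k hk
    have h4 := (hd.dsc_eq k hk).symm.trans (hd'.dsc_eq k hk)
    rw [← (Prod.mk.inj h4).1, ← (Prod.mk.inj h4).2] at h3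
    have key : ∀ (m : ℕ) (u : ℤˣ), u = (-1) ^ m * u → Even m := by
      intro m u hu
      by_contra hm
      rw [(Nat.not_even_iff_odd.1 hm).neg_one_pow] at hu
      rcases Int.units_eq_one_or u with rfl | rfl <;> exact absurd hu (by decide)
    exact ⟨key _ _ h3.1, key _ _ h3.2⟩
  · rintro ⟨hA, hσ⟩
    have hd' : HasData (stdForm n F) (spEnd x') G d := by
      refine ⟨?_, fun k hk => ?_, hd.eq_one⟩
      · rwa [funext hσ] at hG'
      · obtain ⟨h3, h4⟩ := hdsc hσ k hk
        obtain ⟨h5, h6⟩ := hd.even_formRank h2 h hA k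
        rw [hd.dsc_eq k hk, h3, h4, h5.neg_one_pow, h6.neg_one_pow, one_mul, one_mul]
    exact hd'.isometric h2 h' h hd

/-- The data of the invariant classes. -/
def dataSet (σ : F ≃+* F) (n : ℕ) : Set ((ℕ → F[X]) × (ℕ → ℤˣ × ℤˣ)) :=
  {z | Admissible z.1 z.2 ∧ (∀ i, (z.1 i).map (σ : F →+* F) = z.1 i) ∧
    ∃ N, (∀ i ≥ N, z.1 i = 1) ∧ ∑ j ∈ Finset.range N, j * (z.1 j).natDegree = 2 * n}

/-- Each fixed class is sent to the data of a chosen representative. Injectivity is the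
classification; surjectivity is realization, followed by a transport to the standard symplectic
space of the right dimension. -/
theorem numInvariantClasses_eq_card [Finite F] (h2 : (2 : F) ≠ 0) {σ : F ≃+* F}
    {δ : MulAut (symplecticGroup (Fin n) F)} (hδ : IsDiagonalAut δ) (hδ' : ¬ IsInnerAut δ) :
    numInvariantClasses (δ * fieldAut n σ) = Nat.card (dataSet σ n) := by
  have hdim : finrank F (Fin n ⊕ Fin n → F) = 2 * n := by simp [two_mul]
  have hinv : ∀ x : symplecticGroup (Fin n) F,
      ConjClasses.map (δ * fieldAut n σ).toMonoidHom (ConjClasses.mk x) = ConjClasses.mk x ↔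
        IsConj ((δ * fieldAut n σ) x) x := fun x => ConjClasses.mk_eq_mk_iff_isConj
  choose G d hd using fun x : symplecticGroup (Fin n) F => exists_hasData (stdForm n F) (spEnd x)
  have hmem : ∀ x, ConjClasses.map (δ * fieldAut n σ).toMonoidHom (ConjClasses.mk x) =
      ConjClasses.mk x → (G x, d x) ∈ dataSet σ n := by
    intro x hx
    rw [hinv, isConj_apply_iff h2 hδ hδ' (hd x)] at hx
    obtain ⟨N, hN⟩ := (hd x).inv.finrank_eq
    exact ⟨hx.1, hx.2, N, (hN N le_rfl).1, (hN N le_rfl).2.symm.trans hdim⟩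
  have hout : ∀ C : ConjClasses (symplecticGroup (Fin n) F), ConjClasses.mk C.out = C := fun C =>
    Quotient.out_eq C
  refine Nat.card_eq_of_bijective (fun C => ⟨(G C.1.out, d C.1.out), hmem _ (by
    rw [hout]; exact C.2)⟩) ⟨fun C C' hCC => ?_, ?_⟩
  · have h1 := congrArg Subtype.val hCC
    have h3 : G C.1.out = G C'.1.out := congrArg Prod.fst h1
    have h4 : d C.1.out = d C'.1.out := congrArg Prod.snd h1
    have h5 := hd C.1.out
    rw [h3, h4] at h5
    apply Subtype.ext
    rw [← hout C.1, ← hout C'.1, ConjClasses.mk_eq_mk_iff_isConj, isConj_iff_isometric]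
    exact h5.isometric h2 (isTriple_spEnd _) (isTriple_spEnd _) (hd _)
  · rintro ⟨⟨G₀, d₀⟩, hA, hσ, N, hN, hn⟩
    obtain ⟨V, _, _, _, b, x, y, h, hx⟩ := hA.realizes h2 N _ hN rfl
    have hV : finrank F V = 2 * n := by
      obtain ⟨N', hN'⟩ := hx.inv.finrank_eq
      rw [(hN' (max N N') (le_max_right _ _)).2, ← hn]
      refine (Finset.sum_subset (Finset.range_mono (le_max_left _ _)) fun j _ hj => ?_).symm
      rw [hN j (by simpa using hj), natDegree_one, mul_zero]
    obtain ⟨x', hx'⟩ := exists_spEnd_isometric h2 h hV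
    have hdx := hx.of_isometric h (isTriple_spEnd x') hx'
    have hfix : ConjClasses.map (δ * fieldAut n σ).toMonoidHom (ConjClasses.mk x') =
        ConjClasses.mk x' := by
      rw [hinv, isConj_apply_iff h2 hδ hδ' hdx]
      exact ⟨hA, hσ⟩
    refine ⟨⟨ConjClasses.mk x', hfix⟩, Subtype.ext ?_⟩
    set w := (ConjClasses.mk x').out
    have hw : IsConj x' w := by
      rw [← ConjClasses.mk_eq_mk_iff_isConj, hout]
    have h5 := hdx.of_isometric (isTriple_spEnd _) (isTriple_spEnd _) (isConj_iff_isometric.1 hw)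
    obtain ⟨h6, h7⟩ := (hd w).unique h5
    exact Prod.ext h6 h7

end Dictionary

/-! ### Infinite products and the generating function of partitions -/

section Product

open PowerSeries

/-- The power series `∑ j, a j * X ^ (d * j)`. -/
noncomputable def stretch {R : Type*} [CommSemiring R] (a : ℕ → R) (d : ℕ) : PowerSeries R :=
  PowerSeries.mk fun m => if d ∣ m then a (m / d) else 0

/-- Rewrites the factors in the product formula for `Nat.Partition.genFun`, in which the constant
term stands apart, as single series. -/
theorem one_add_tsum_eq_stretch {R : Type*} [CommSemiring R] [TopologicalSpace R] [T2Space R]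
    {a : ℕ → R} (ha : a 0 = 1) (i : ℕ) :
    1 + ∑' j, a (j + 1) • (X : PowerSeries R) ^ ((i + 1) * (j + 1)) = stretch a (i + 1) := by
  have hs := Nat.Partition.summable_genFun_term (fun _ => a) i
  ext m
  rw [map_add, hs.map_tsum _ (WithPiTopology.continuous_coeff _ _), stretch, coeff_mk]
  simp only [map_smul, coeff_X_pow, smul_eq_mul, mul_ite, mul_one, mul_zero, coeff_one]
  by_cases hm : m = 0
  · subst hm
    simp [ha]
  · rw [if_neg hm, zero_add]
    by_cases hd : i + 1 ∣ m
    · obtain ⟨k, rfl⟩ := hd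
      have hk : k ≠ 0 := by rintro rfl; exact hm (mul_zero _)
      rw [if_pos (dvd_mul_right _ _), Nat.mul_div_cancel_left _ (Nat.succ_pos i),
        tsum_eq_single (k - 1)]
      · rw [Nat.sub_add_cancel (Nat.one_le_iff_ne_zero.2 hk), if_pos rfl]
      · intro j hj
        refine if_neg fun h => hj ?_
        have := Nat.eq_of_mul_eq_mul_left (Nat.succ_pos i) h
        omega
    · rw [if_neg hd]
      have : ∀ j, (if m = (i + 1) * (j + 1) then a (j + 1) else 0) = 0 := fun j =>
        if_neg fun h => hd ⟨_, h⟩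
      simp [this]

theorem hasProd_stretch {R : Type*} [CommSemiring R] [TopologicalSpace R] [T2Space R]
    (f : ℕ → ℕ → R) (h0 : ∀ i, f i 0 = 1) :
    HasProd (fun i => stretch (f (i + 1)) (i + 1)) (Nat.Partition.genFun f) := by
  simp only [← one_add_tsum_eq_stretch (h0 _)]
  exact Nat.Partition.hasProd_genFun f

theorem stretch_mul (a a' : ℕ → ℤ) {d : ℕ} (hd : 0 < d) (q : ℕ) (h0 : a' 0 = a 0)
    (h : ∀ j, a' (j + 1) = a (j + 1) - q * a j) :
    stretch a d * (1 - (q : PowerSeries ℤ) * X ^ d) = stretch a' d := by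
  ext m
  have hq : (q : PowerSeries ℤ) = C (q : ℤ) := by simp
  have h1 : stretch a d * (1 - (q : PowerSeries ℤ) * X ^ d) =
      stretch a d - C (q : ℤ) * (stretch a d * X ^ d) := by rw [hq]; ring
  rw [h1, map_sub, coeff_C_mul, coeff_mul_X_pow', stretch, stretch, coeff_mk, coeff_mk, coeff_mk]
  by_cases hm : d ∣ m
  · obtain ⟨k, rfl⟩ := hm
    rw [if_pos (dvd_mul_right _ _), if_pos (dvd_mul_right _ _), Nat.mul_div_cancel_left _ hd]
    cases k with
    | zero => rw [if_neg (by omega), h0]; ring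
    | succ j =>
      have h3 : d * (j + 1) - d = d * j := by rw [Nat.mul_succ, Nat.add_sub_cancel]
      rw [if_pos (Nat.le_mul_of_pos_right d (Nat.succ_pos j)), h3, if_pos (dvd_mul_right _ _),
        Nat.mul_div_cancel_left _ hd, h]
  · rw [if_neg hm, if_neg hm]
    split_ifs with h3 h4
    · exact absurd ((Nat.dvd_sub_iff_left h3 dvd_rfl).1 h4) hm
    all_goals ring

theorem stretch_choose_two {d : ℕ} (hd : 0 < d) :
    stretch (fun j => (Nat.choose 2 j : ℤ)) d = (1 + X ^ d) ^ 2 := by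
  have h : (1 + X ^ d : PowerSeries ℤ) ^ 2 = 1 + C (2 : ℤ) * X ^ d + X ^ (2 * d) := by
    have : (C (2 : ℤ) : PowerSeries ℤ) = 2 := by simp
    rw [this]
    ring
  ext m
  rw [h, stretch, coeff_mk, map_add, map_add, coeff_C_mul, coeff_X_pow, coeff_X_pow, coeff_one]
  by_cases hm : d ∣ m
  · obtain ⟨k, rfl⟩ := hm
    rw [if_pos (dvd_mul_right _ _), Nat.mul_div_cancel_left _ hd]
    have h1 : d * k = d ↔ k = 1 :=
      ⟨fun h => Nat.eq_of_mul_eq_mul_left hd (h.trans (mul_one d).symm), fun h => by rw [h, mul_one]⟩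
    have h2 : d * k = 2 * d ↔ k = 2 :=
      ⟨fun h => Nat.eq_of_mul_eq_mul_left hd (h.trans (mul_comm 2 d)), fun h => by rw [h, mul_comm]⟩
    have h3 : d * k = 0 ↔ k = 0 := by simp [hd.ne']
    simp only [h1, h2, h3]
    match k with
    | 0 => simp
    | 1 => simp
    | 2 => simp
    | k + 3 => simp [Nat.choose_eq_zero_of_lt]
  · rw [if_neg hm, if_neg (by rintro rfl; exact hm (dvd_zero d)),
      if_neg (by rintro rfl; exact hm dvd_rfl), if_neg (by rintro rfl; exact hm (dvd_mul_left d 2))]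
    simp

theorem stretch_single (d : ℕ) (hd : 0 < d) :
    stretch (fun j => if j = 0 then (1 : ℤ) else 0) d = 1 := by
  ext m
  rw [stretch, coeff_mk, coeff_one]
  by_cases hm : m = 0
  · simp [hm]
  · rw [if_neg hm]
    split_ifs with h1 h2
    · have := (Nat.div_eq_zero_iff.1 h2).resolve_left hd.ne'
      exact absurd (Nat.le_of_dvd (Nat.pos_of_ne_zero hm) h1) (not_le.2 this)
    all_goals rfl

/-- Lets one family of factors be exchanged for another with the same product, here `(1 + X ^ j) ^
2` over even `j` for `(1 + X ^ (2 * i)) ^ 2` over all `i`. -/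
theorem hasProd_mul_of_eq {M ι : Type*} [CommMonoid M] [TopologicalSpace M] [ContinuousMul M]
    [T2Space M] {A B C : ι → M} {a b p : M} (hA : HasProd A a) (hB : HasProd B b)
    (hC : HasProd C b) (hP : HasProd (fun i => B i * A i) p) :
    HasProd (fun i => C i * A i) p := by
  rw [hP.unique (hB.mul hA)]
  exact hC.mul hA

/-- The recursions on `f` say that its series in `k` is `1 / (1 - q t)` for odd `i` and `(1 + t) ^ 2
/ (1 - q t)` for even `i`, the numerator having coefficients `Nat.choose 2 k`. -/
theorem hasProd_of_factor (q : ℕ) (f : ℕ → ℕ → ℤ) (hodd : ∀ i, Odd i → ∀ k, f i k = q ^ k)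
    (h0 : ∀ i, f i 0 = 1) (heven : ∀ i, i ≠ 0 → Even i →
      ∀ k, f i (k + 1) = q * f i k + Nat.choose 2 (k + 1)) :
    HasProd (fun i : ℕ => (1 + (X : PowerSeries ℤ) ^ (2 * (i + 1))) ^ 2 *
        PowerSeries.invOfUnit (1 - (q : PowerSeries ℤ) * X ^ (i + 1)) 1)
      (Nat.Partition.genFun f) := by
  have hunit : ∀ i : ℕ, (1 - (q : PowerSeries ℤ) * X ^ (i + 1)) *
      PowerSeries.invOfUnit (1 - (q : PowerSeries ℤ) * X ^ (i + 1)) 1 = 1 := fun i =>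
    mul_invOfUnit _ _ (by simp)
  have hdiv : ∀ {i : ℕ} {P Q : PowerSeries ℤ}, P * (1 - (q : PowerSeries ℤ) * X ^ (i + 1)) = Q →
      P = Q * PowerSeries.invOfUnit (1 - (q : PowerSeries ℤ) * X ^ (i + 1)) 1 := by
    intro i P Q h
    rw [← h, mul_assoc, hunit, mul_one]
  have hA : HasProd (fun i : ℕ => PowerSeries.invOfUnit (1 - (q : PowerSeries ℤ) * X ^ (i + 1)) 1)
      (Nat.Partition.genFun fun _ k => (q : ℤ) ^ k) := by
    have h := hasProd_stretch (fun _ k => (q : ℤ) ^ k) fun _ => pow_zero _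
    refine (congrArg (fun φ => HasProd φ _) (funext fun i => ?_)).mp h
    have := stretch_mul (fun k => (q : ℤ) ^ k) (fun j => if j = 0 then 1 else 0) (Nat.succ_pos i) q
      (by simp) (fun j => by simp [pow_succ'])
    rw [stretch_single _ (Nat.succ_pos i)] at this
    rw [hdiv this, one_mul]
  let B : ℕ → PowerSeries ℤ := fun i => if Even (i + 1) then (1 + X ^ (i + 1)) ^ 2 else 1
  have hB : HasProd B (Nat.Partition.genFun fun i k =>
      if Even i then (Nat.choose 2 k : ℤ) else if k = 0 then 1 else 0) := by
    have h := hasProd_stretch (fun i k =>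
      if Even i then (Nat.choose 2 k : ℤ) else if k = 0 then 1 else 0) fun i => by simp
    refine (congrArg (fun φ => HasProd φ _) (funext fun i => ?_)).mp h
    by_cases hi : Even (i + 1)
    · simp only [B, if_pos hi]
      exact stretch_choose_two (Nat.succ_pos i)
    · simp only [B, if_neg hi]
      exact stretch_single _ (Nat.succ_pos i)
  have hC : HasProd (fun i : ℕ => (1 + (X : PowerSeries ℤ) ^ (2 * (i + 1))) ^ 2)
      (Nat.Partition.genFun fun i k =>
        if Even i then (Nat.choose 2 k : ℤ) else if k = 0 then 1 else 0) := by
    -- Factors are indexed from 0, so the part `2 * (i + 1)` sits at position `2 * i + 1`; all other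
    -- factors of `B` are 1.
    have hinj : Function.Injective fun i : ℕ => 2 * i + 1 := fun i j h => by
      simp only at h
      omega
    have h1 := (hinj.hasProd_iff (f := B) fun m hm => if_neg fun he => hm ?_).2 hB
    · refine (congrArg (fun φ => HasProd φ _) (funext fun i => ?_)).mp h1
      have h3 : 2 * i + 1 + 1 = 2 * (i + 1) := by ring
      simp only [Function.comp_apply, B, h3, if_pos (even_two_mul (i + 1))]
    · obtain ⟨r, hr⟩ := he
      exact ⟨r - 1, by change 2 * (r - 1) + 1 = m; omega⟩
  have hP : HasProd (fun i => B i *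
      PowerSeries.invOfUnit (1 - (q : PowerSeries ℤ) * X ^ (i + 1)) 1) (Nat.Partition.genFun f) := by
    refine (congrArg (fun φ => HasProd φ _) (funext fun i => ?_)).mp (hasProd_stretch f h0)
    apply hdiv
    by_cases hi : Even (i + 1)
    · simp only [B, if_pos hi]
      rw [← stretch_choose_two (Nat.succ_pos i)]
      exact stretch_mul (f (i + 1)) (fun j => (Nat.choose 2 j : ℤ)) (Nat.succ_pos i) q
        (by simp [h0]) fun j => by
        rw [heven _ (Nat.succ_ne_zero i) hi]
        ring
    · simp only [B, if_neg hi]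
      refine (stretch_mul (f (i + 1)) (fun j => if j = 0 then 1 else 0) (Nat.succ_pos i) q
        (by simp [h0]) fun j => ?_).trans (stretch_single _ (Nat.succ_pos i))
      rw [hodd _ (Nat.not_even_iff_odd.1 hi), hodd _ (Nat.not_even_iff_odd.1 hi)]
      simp [pow_succ']
  exact hasProd_mul_of_eq hA hB hC hP

end Product

/-! ### Counting palindromic polynomials and admissible data -/

section Counting

open Polynomial

variable {F : Type u} [Field F]

/-- The palindromic polynomials of degree `2 * k` which are fixed by `σ`. -/
def palSet (σ : F ≃+* F) (k : ℕ) : Set F[X] :=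
  {g | IsPal g ∧ g.map (σ : F →+* F) = g ∧ g.natDegree = 2 * k}

theorem coeff_eq_of_mem_palSet {σ : F ≃+* F} {k : ℕ} {g : F[X]} (hg : g ∈ palSet σ k) {n : ℕ}
    (hn : n ≤ 2 * k) : g.coeff n = g.coeff (2 * k - n) := by
  conv_lhs => rw [← hg.1.reverse, coeff_reverse, hg.2.2, revAt_le hn]

/-- The constant and leading coefficients are 1, the coefficients of index 1 to `k` are free in the
fixed field of `σ`, and symmetry determines the others. -/
theorem card_palSet (σ : F ≃+* F) (k : ℕ) :
    Nat.card (palSet σ k) = Nat.card {x : F // σ x = x} ^ k := by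
  let φ : palSet σ k → Fin k → {x : F // σ x = x} := fun g j => ⟨g.1.coeff (j + 1), by
    conv_rhs => rw [← g.2.2.1, coeff_map]
    rfl⟩
  have hφ : Function.Bijective φ := by
    constructor
    · rintro ⟨g, hg⟩ ⟨g', hg'⟩ h
      have key : ∀ n ≤ k, g.coeff n = g'.coeff n := by
        intro n hn
        cases n with
        | zero => rw [hg.1.coeff_zero, hg'.1.coeff_zero]
        | succ m => exact congrArg Subtype.val (congrFun h ⟨m, hn⟩)
      apply Subtype.ext
      ext n
      by_cases h1 : n ≤ k
      · exact key n h1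
      · by_cases h2 : n ≤ 2 * k
        · rw [coeff_eq_of_mem_palSet hg h2, coeff_eq_of_mem_palSet hg' h2]
          exact key _ (by omega)
        · rw [coeff_eq_zero_of_natDegree_lt (by rw [hg.2.2]; omega),
            coeff_eq_zero_of_natDegree_lt (by rw [hg'.2.2]; omega)]
    · intro c
      let a : ℕ → F := fun m => if m = 0 then 1 else if h : m - 1 < k then (c ⟨m - 1, h⟩ : F) else 0
      have ha : ∀ m, σ (a m) = a m := by
        intro m
        simp only [a]
        split_ifs with h1 h2
        exacts [map_one σ, (c _).2, map_zero σ]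
      let g : F[X] := ∑ n ∈ Finset.range (2 * k + 1), monomial n (a (min n (2 * k - n)))
      have hc : ∀ n, g.coeff n = if n ≤ 2 * k then a (min n (2 * k - n)) else 0 := by
        intro n
        simp only [g, finsetSum_coeff, coeff_monomial]
        rw [Finset.sum_ite_eq']
        simp
      have htop : g.coeff (2 * k) = 1 := by
        rw [hc, if_pos le_rfl, Nat.sub_self, Nat.min_zero]
        exact if_pos rfl
      have hdeg : g.natDegree = 2 * k := by
        refine natDegree_eq_of_le_of_coeff_ne_zero ?_ (by rw [htop]; exact one_ne_zero)
        rw [natDegree_le_iff_coeff_eq_zero]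
        intro n hn
        rw [hc, if_neg (not_le.2 hn)]
      refine ⟨⟨g, ⟨?_, ?_, ?_⟩, ?_, hdeg⟩, ?_⟩
      · rw [Monic, leadingCoeff, hdeg, htop]
      · rw [hdeg]; exact even_two_mul k
      · ext n
        rw [coeff_reverse, hdeg]
        by_cases hn : n ≤ 2 * k
        · rw [revAt_le hn, hc, hc, if_pos hn, if_pos (Nat.sub_le _ _), Nat.sub_sub_self hn, min_comm]
        · rw [revAt_eq_self_of_lt (not_le.1 hn)]
      · ext n
        rw [coeff_map, hc]
        split_ifs
        · exact ha _
        · exact map_zero _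
      · funext j
        apply Subtype.ext
        change g.coeff (j + 1) = c j
        have hj := j.2
        rw [hc, if_pos (by omega), min_eq_left (by omega)]
        simp [a]
  rw [Nat.card_eq_of_bijective φ hφ, Nat.card_fun]
  simp

theorem card_palSet_dvd (σ : F ≃+* F) (k : ℕ) {m : ℕ} {h : F[X]} (hh : h ∈ palSet σ m) :
    Nat.card {g : F[X] // g ∈ palSet σ k ∧ h ∣ g} =
      if m ≤ k then Nat.card {x : F // σ x = x} ^ (k - m) else 0 := by
  split_ifs with hmk
  · rw [← card_palSet]
    symm
    have hmem : ∀ g ∈ palSet σ (k - m), h * g ∈ palSet σ k := fun g hg =>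
      ⟨hh.1.mul hg.1, by rw [Polynomial.map_mul, hh.2.1, hg.2.1], by
        rw [hh.1.monic.natDegree_mul hg.1.monic, hh.2.2, hg.2.2]; omega⟩
    refine Nat.card_eq_of_bijective (fun g : palSet σ (k - m) =>
      (⟨h * g.1, hmem g.1 g.2, dvd_mul_right _ _⟩ : {g : F[X] // g ∈ palSet σ k ∧ h ∣ g}))
      ⟨fun g g' hgg => ?_, ?_⟩
    · exact Subtype.ext (mul_left_cancel₀ hh.1.monic.ne_zero (congrArg Subtype.val hgg))
    · rintro ⟨_, hg, g', rfl⟩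
      have hp : IsPal g' := hh.1.of_mul_left hg.1
      refine ⟨⟨g', hp, ?_, ?_⟩, rfl⟩
      · have := hg.2.1
        rw [Polynomial.map_mul, hh.2.1] at this
        exact mul_left_cancel₀ hh.1.monic.ne_zero this
      · have := hg.2.2
        rw [hh.1.monic.natDegree_mul hp.monic, hh.2.2] at this
        omega
  · have : IsEmpty {g : F[X] // g ∈ palSet σ k ∧ h ∣ g} := ⟨fun g => hmk (by
      have := natDegree_le_of_dvd g.2.2 g.2.1.1.monic.ne_zero
      rw [hh.2.2, g.2.1.2.2] at this
      omega)⟩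
    exact Nat.card_of_isEmpty

/-- The data at the elementary divisors which are `i`-th powers. -/
def localSet (σ : F ≃+* F) (i k : ℕ) : Set (F[X] × (ℤˣ × ℤˣ)) :=
  {z | z.1 ∈ palSet σ k ∧ (Odd i ∨ i = 0 ∨ z.1.eval 1 ≠ 0 → z.2.1 = 1) ∧
    (Odd i ∨ i = 0 ∨ z.1.eval (-1) ≠ 0 → z.2.2 = 1)}

theorem finite_palSet [Finite F] (σ : F ≃+* F) (k : ℕ) : (palSet σ k).Finite := by
  apply Nat.finite_of_card_ne_zero
  rw [card_palSet]
  have : Nonempty {x : F // σ x = x} := ⟨⟨0, map_zero σ⟩⟩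
  exact pow_ne_zero _ Nat.card_pos.ne'

theorem finite_localSet [Finite F] (σ : F ≃+* F) (i k : ℕ) : Finite (localSet σ i k) :=
  (((finite_palSet σ k).prod (Set.toFinite (Set.univ : Set (ℤˣ × ℤˣ)))).subset fun _ hz =>
    ⟨hz.1, Set.mem_univ _⟩).to_subtype

theorem card_localSet_odd (σ : F ≃+* F) {i : ℕ} (hi : Odd i) (k : ℕ) :
    Nat.card (localSet σ i k) = Nat.card {x : F // σ x = x} ^ k := by
  rw [← card_palSet]
  refine Nat.card_eq_of_bijective (fun z => ⟨z.1.1, z.2.1⟩) ⟨?_, ?_⟩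
  · rintro ⟨⟨g, e⟩, hz⟩ ⟨⟨g', e'⟩, hz'⟩ h
    have h1 : g = g' := congrArg Subtype.val h
    have h2 : e = 1 := Prod.ext (hz.2.1 (Or.inl hi)) (hz.2.2 (Or.inl hi))
    have h3 : e' = 1 := Prod.ext (hz'.2.1 (Or.inl hi)) (hz'.2.2 (Or.inl hi))
    rw [Subtype.mk.injEq, h1, h2, h3]
  · rintro ⟨g, hg⟩
    exact ⟨⟨(g, 1), hg, fun _ => rfl, fun _ => rfl⟩, rfl⟩

theorem IsPal.sq_dvd_iff (h2 : (2 : F) ≠ 0) {g : F[X]} (hg : IsPal g) {r : F} (hr : r * r = 1) :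
    (X - C r) ^ 2 ∣ g ↔ g.eval r = 0 := by
  constructor
  · intro h
    exact dvd_iff_isRoot.1 ((dvd_pow_self _ two_ne_zero).trans h)
  · intro h
    obtain ⟨g', hg', -⟩ := hg.exists_of_root h2 hr h
    exact ⟨g', hg'⟩

/-- The elements are sorted by their two signs. A sign -1 at `r` forces a root, equivalently
divisibility by `(X - r) ^ 2`. The value `N m` counts the polynomials divisible by a given
palindromic factor of degree `2 * m`, and the four sign patterns have `m` equal to 0, 1, 1, 2. -/
theorem card_localSet_even (h2 : (2 : F) ≠ 0) [Finite F] (σ : F ≃+* F) {i : ℕ} (hi0 : i ≠ 0)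
    (hi : Even i) (k : ℕ) {N : ℕ → ℕ}
    (hN : ∀ m, N m = if m ≤ k then Nat.card {x : F // σ x = x} ^ (k - m) else 0) :
    Nat.card (localSet σ i k) = N 0 + N 1 + (N 1 + N 2) := by
  have hfin := finite_localSet σ i k
  have ho : ¬ Odd i := Nat.not_odd_iff_even.2 hi
  have hone : (1 : F[X]) ∈ palSet σ 0 := ⟨isPal_one, by simp, by simp⟩
  have hm1 : (-1 : F) * -1 = 1 := by ring
  have hsq : ∀ r : F, r * r = 1 → σ r = r → (X - C r) ^ 2 ∈ palSet σ 1 := fun r hr hσ =>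
    ⟨isPal_X_sub_C_sq hr, by simp [hσ], by rw [natDegree_pow, natDegree_X_sub_C]⟩
  have hs1 := hsq 1 (one_mul 1) (map_one σ)
  have hs2 := hsq (-1) hm1 (by simp)
  have hs12 : (X - C (1 : F)) ^ 2 * (X - C (-1)) ^ 2 ∈ palSet σ 2 :=
    ⟨hs1.1.mul hs2.1, by rw [Polynomial.map_mul, hs1.2.1, hs2.2.1], by
      rw [hs1.1.monic.natDegree_mul hs2.1.monic, hs1.2.2, hs2.2.2]⟩
  have hcop : IsCoprime ((X - C (1 : F)) ^ 2) ((X - C (-1)) ^ 2) := by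
    refine (isCoprime_X_sub_C_of_isUnit_sub ?_).pow
    rw [sub_neg_eq_add, one_add_one_eq_two]
    exact h2.isUnit
  let E : localSet σ i k ≃ Σ e : ℤˣ × ℤˣ, {g : F[X] // (g, e) ∈ localSet σ i k} :=
    { toFun := fun z => ⟨z.1.2, z.1.1, z.2⟩
      invFun := fun z => ⟨(z.2.1, z.1), z.2.2⟩ }
  have hfib : ∀ e, Finite {g : F[X] // (g, e) ∈ localSet σ i k} := fun e =>
    Finite.of_injective (fun g => (⟨(g.1, e), g.2⟩ : localSet σ i k)) fun g g' h =>
      Subtype.ext (congrArg Prod.fst (congrArg Subtype.val h))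
  have hcard : ∀ (e : ℤˣ × ℤˣ) (h : F[X]) (m : ℕ), h ∈ palSet σ m →
      (∀ g, IsPal g → (((g.eval 1 ≠ 0 → e.1 = 1) ∧ (g.eval (-1) ≠ 0 → e.2 = 1)) ↔ h ∣ g)) →
      Nat.card {g : F[X] // (g, e) ∈ localSet σ i k} = N m := by
    intro e h m hm H
    rw [hN, ← card_palSet_dvd σ k hm]
    refine Nat.card_congr (Equiv.subtypeEquivRight fun g => ?_)
    constructor
    · rintro ⟨h3, h4, h5⟩
      exact ⟨h3, (H g h3.1).1 ⟨fun h => h4 (Or.inr (Or.inr h)), fun h => h5 (Or.inr (Or.inr h))⟩⟩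
    · rintro ⟨h3, h4⟩
      obtain ⟨h5, h6⟩ := (H g h3.1).2 h4
      exact ⟨h3, fun h => h5 ((h.resolve_left ho).resolve_left hi0),
        fun h => h6 ((h.resolve_left ho).resolve_left hi0)⟩
  have hu : (-1 : ℤˣ) ≠ 1 := by decide
  rw [Nat.card_congr E, Nat.card_sigma, Fintype.sum_prod_type]
  simp only [UnitsInt.univ, Finset.sum_insert (show (1 : ℤˣ) ∉ ({-1} : Finset ℤˣ) by decide),
    Finset.sum_singleton]
  rw [hcard (1, 1) 1 0 hone, hcard (1, -1) _ 1 hs2, hcard (-1, 1) _ 1 hs1, hcard (-1, -1) _ 2 hs12]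
  · intro g hg
    have hd : (X - C (1 : F)) ^ 2 * (X - C (-1)) ^ 2 ∣ g ↔
        (X - C (1 : F)) ^ 2 ∣ g ∧ (X - C (-1)) ^ 2 ∣ g :=
      ⟨fun h => ⟨dvd_of_mul_right_dvd h, dvd_of_mul_left_dvd h⟩, fun h => hcop.mul_dvd h.1 h.2⟩
    rw [hd, hg.sq_dvd_iff h2 (one_mul 1), hg.sq_dvd_iff h2 hm1]
    simp [hu]
  · intro g hg
    rw [hg.sq_dvd_iff h2 (one_mul 1)]
    simp [hu]
  · intro g hg
    rw [hg.sq_dvd_iff h2 hm1]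
    simp [hu]
  · intro g hg
    simp

/-- The half degrees of the `G i` are the multiplicities of the parts `i` in a partition of `n`. For
a fixed partition the data at the different parts are chosen independently. -/
theorem card_dataSet [Finite F] (σ : F ≃+* F) (n : ℕ) :
    Nat.card (dataSet σ n) = ∑ p : n.Partition, ∏ i ∈ p.parts.toFinset,
      Nat.card (localSet σ i (p.parts.count i)) := by
  classical
  have hfin : ∀ i k, Finite (localSet σ i k) := finite_localSet σ
  have hlocal0 : ∀ i, ((1, 1) : F[X] × (ℤˣ × ℤˣ)) ∈ localSet σ i 0 := fun i =>
    ⟨⟨isPal_one, by simp, by simp⟩, fun _ => rfl, fun _ => rfl⟩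
  let T := Σ p : n.Partition, ∀ i : p.parts.toFinset, localSet σ i (p.parts.count i.1)
  -- Outside the parts of the partition the only possible datum is the polynomial 1 with trivial
  -- signs.
  let w : T → ℕ → F[X] × (ℤˣ × ℤˣ) := fun t i =>
    if h : i ∈ t.1.parts.toFinset then (t.2 ⟨i, h⟩).1 else (1, 1)
  have hw : ∀ t i, w t i ∈ localSet σ i (t.1.parts.count i) := by
    intro t i
    by_cases h : i ∈ t.1.parts.toFinset
    · simp only [w, dif_pos h]
      exact (t.2 ⟨i, h⟩).2
    · simp only [w, dif_neg h]
      rw [Multiset.count_eq_zero_of_notMem fun h' => h (Multiset.mem_toFinset.2 h')]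
      exact hlocal0 i
  have hw1 : ∀ t i, i ∉ t.1.parts → w t i = (1, 1) := fun t i h =>
    dif_neg fun h' => h (Multiset.mem_toFinset.1 h')
  have hmem : ∀ t, ((fun i => (w t i).1, fun i => (w t i).2) :
      (ℕ → F[X]) × (ℕ → ℤˣ × ℤˣ)) ∈ dataSet σ n := by
    intro t
    have h0 : w t 0 = (1, 1) := hw1 t 0 fun h => (t.1.parts_pos h).ne' rfl
    refine ⟨⟨congrArg Prod.fst h0, fun i => (hw t i).1.1, fun i => (hw t i).2.1,
      fun i => (hw t i).2.2⟩, fun i => (hw t i).1.2.1, n + 1, fun i hi => ?_, ?_⟩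
    · have : i ∉ t.1.parts := fun h => by
        have := Nat.Partition.le_of_mem_parts h
        omega
      exact congrArg Prod.fst (hw1 t i this)
    · have h1 : ∀ j, (w t j).1.natDegree = 2 * t.1.parts.count j := fun j => (hw t j).1.2.2
      simp only [h1]
      have h3 : ∑ j ∈ Finset.range (n + 1), t.1.parts.count j * j = n := by
        conv_rhs => rw [← t.1.parts_sum, Finset.sum_multiset_count]
        refine (Finset.sum_subset (fun j hj => ?_) fun j _ hj => ?_).symm
        · exact Finset.mem_range.2 (Nat.lt_succ_of_le
            (Nat.Partition.le_of_mem_parts (Multiset.mem_toFinset.1 hj)))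
        · rw [Multiset.count_eq_zero_of_notMem fun h' => hj (Multiset.mem_toFinset.2 h'), zero_mul]
      conv_rhs => rw [← h3, Finset.mul_sum]
      exact Finset.sum_congr rfl fun j _ => by ring
  have hbij : Function.Bijective fun t : T => (⟨_, hmem t⟩ : dataSet σ n) := by
    constructor
    · rintro ⟨p, c⟩ ⟨p', c'⟩ h
      have h1 : ∀ i, w ⟨p, c⟩ i = w ⟨p', c'⟩ i := fun i => Prod.ext
        (congrFun (congrArg Prod.fst (congrArg Subtype.val h)) i)
        (congrFun (congrArg Prod.snd (congrArg Subtype.val h)) i)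
      have h3 : p = p' := by
        apply Nat.Partition.ext
        ext i
        have h4 := (hw ⟨p, c⟩ i).1.2.2
        have h5 := (hw ⟨p', c'⟩ i).1.2.2
        rw [h1] at h4
        have h6 := h4.symm.trans h5
        simp only at h6
        omega
      subst h3
      congr 1
      funext ⟨i, hi⟩
      apply Subtype.ext
      have := h1 i
      simpa only [w, dif_pos hi] using this
    · rintro ⟨⟨G, d⟩, hA, hσ, N, hN, hn⟩
      replace hA : Admissible G d := hA
      replace hσ : ∀ i, (G i).map (σ : F →+* F) = G i := hσ
      replace hN : ∀ i ≥ N, G i = 1 := hN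
      replace hn : ∑ j ∈ Finset.range N, j * (G j).natDegree = 2 * n := hn
      have hk : ∀ i, ∃ k, (G i).natDegree = 2 * k := fun i => by
        obtain ⟨k, hk⟩ := (hA.pal i).even
        exact ⟨k, by omega⟩
      choose k hk using hk
      have hk0 : k 0 = 0 := by
        have := hk 0
        rw [hA.zero, natDegree_one] at this
        omega
      have hkN : ∀ i ≥ N, k i = 0 := fun i hi => by
        have := hk i
        rw [hN i hi, natDegree_one] at this
        omega
      let m : Multiset ℕ := ∑ j ∈ Finset.range N, Multiset.replicate (k j) j
      have hcount : ∀ i, m.count i = k i := by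
        intro i
        simp only [m, Multiset.count_sum', Multiset.count_replicate]
        rw [Finset.sum_ite_eq']
        split_ifs with h
        · rfl
        · exact (hkN i (by simpa using h)).symm
      have hsum : m.sum = n := by
        simp only [m, Multiset.sum_sum, Multiset.sum_replicate, smul_eq_mul]
        have h3 : ∑ j ∈ Finset.range N, j * (2 * k j) = 2 * n := by
          rw [← hn]
          exact Finset.sum_congr rfl fun j _ => by rw [← hk j]
        have h4 : ∑ j ∈ Finset.range N, j * (2 * k j) = 2 * ∑ j ∈ Finset.range N, k j * j := by
          rw [Finset.mul_sum]
          exact Finset.sum_congr rfl fun j _ => by ring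
        omega
      let p : n.Partition := ⟨m, fun {i} hi => by
        rw [← Multiset.count_pos, hcount] at hi
        rcases Nat.eq_zero_or_pos i with rfl | h
        · omega
        · exact h, hsum⟩
      have hloc : ∀ i, (G i, d i) ∈ localSet σ i (p.parts.count i) := fun i =>
        ⟨⟨hA.pal i, hσ i, by rw [hk, ← hcount]⟩, hA.fst i, hA.snd i⟩
      refine ⟨⟨p, fun i => ⟨(G i, d i), hloc i⟩⟩, Subtype.ext ?_⟩
      have key : ∀ i, w ⟨p, fun i => ⟨(G i, d i), hloc i⟩⟩ i = (G i, d i) := by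
        intro i
        by_cases h : i ∈ p.parts.toFinset
        · simp only [w, dif_pos h]
        · rw [hw1 _ _ fun h' => h (Multiset.mem_toFinset.2 h')]
          have h0 : k i = 0 := by
            rw [← hcount]
            exact Multiset.count_eq_zero_of_notMem fun h' => h (Multiset.mem_toFinset.2 h')
          have h1 : G i = 1 := (hA.pal i).monic.natDegree_eq_zero.1 (by rw [hk, h0])
          refine Prod.ext h1.symm (Prod.ext ?_ ?_)
          · exact (hA.fst i (Or.inr (Or.inr (by rw [h1]; simp)))).symm
          · exact (hA.snd i (Or.inr (Or.inr (by rw [h1]; simp)))).symm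
      exact Prod.ext (funext fun i => congrArg Prod.fst (key i))
        (funext fun i => congrArg Prod.snd (key i))
  rw [← Nat.card_eq_of_bijective _ hbij, Nat.card_sigma]
  refine Finset.sum_congr rfl fun p _ => ?_
  rw [Nat.card_pi, Finset.prod_coe_sort p.parts.toFinset
    fun i => Nat.card (localSet σ i (p.parts.count i))]

theorem hasProd_card_dataSet [Finite F] (h2 : (2 : F) ≠ 0) (σ : F ≃+* F) :
    HasProd
      (fun i : ℕ => (1 + (PowerSeries.X : PowerSeries ℤ) ^ (2 * (i + 1))) ^ 2 *
        PowerSeries.invOfUnit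
          (1 - (Nat.card {x : F // σ x = x} : PowerSeries ℤ) * PowerSeries.X ^ (i + 1)) 1)
      (PowerSeries.mk fun n : ℕ => (Nat.card (dataSet σ n) : ℤ)) := by
  set q := Nat.card {x : F // σ x = x} with hq
  -- The value at `i = 0` is a convention, satisfying the normalization `f 0 0 = 1`; parts of a
  -- partition are positive, so it never enters.
  let f : ℕ → ℕ → ℤ := fun i k => if i = 0 then (if k = 0 then 1 else 0) else
    Nat.card (localSet σ i k)
  have heven : ∀ i, i ≠ 0 → Even i → ∀ k, f i k = ((if 0 ≤ k then q ^ (k - 0) else 0) +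
      (if 1 ≤ k then q ^ (k - 1) else 0) + ((if 1 ≤ k then q ^ (k - 1) else 0) +
      (if 2 ≤ k then q ^ (k - 2) else 0)) : ℕ) := by
    intro i hi0 hi k
    simp only [f, if_neg hi0]
    rw [card_localSet_even h2 σ hi0 hi k (N := fun m => if m ≤ k then q ^ (k - m) else 0)
      fun m => rfl]
  have hodd : ∀ i, Odd i → ∀ k, f i k = (q : ℤ) ^ k := by
    intro i hi k
    have hi0 : i ≠ 0 := by rintro rfl; exact absurd hi (by decide)
    simp only [f, if_neg hi0]
    rw [card_localSet_odd σ hi, ← hq]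
    push_cast
    rfl
  have h := hasProd_of_factor q f hodd (fun i => ?_) fun i hi0 hi k => ?_
  · convert h using 1
    ext n
    rw [PowerSeries.coeff_mk, Nat.Partition.coeff_genFun, card_dataSet]
    push_cast
    refine Finset.sum_congr rfl fun p _ => ?_
    rw [Finsupp.prod, Multiset.toFinsupp_support]
    refine Finset.prod_congr rfl fun i hi => ?_
    rw [Multiset.toFinsupp_apply]
    have hi0 : i ≠ 0 := (p.parts_pos (Multiset.mem_toFinset.1 hi)).ne'
    simp only [f, if_neg hi0]
  · by_cases hi0 : i = 0
    · simp [f, hi0]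
    rcases Nat.even_or_odd i with hi | hi
    · rw [heven i hi0 hi]; simp
    · rw [hodd i hi]; simp
  · rw [heven i hi0 hi, heven i hi0 hi]
    match k with
    | 0 => simp; ring
    | 1 => simp; ring
    | k + 2 =>
      rw [Nat.choose_eq_zero_of_lt (by omega)]
      simp
      ring

end Counting

/-! ### The trivial group and the generating function -/

theorem card_dataSet_zero {F : Type u} [Field F] [Finite F] (σ : F ≃+* F) :
    Nat.card (dataSet σ 0) = 1 := by
  rw [card_dataSet, Fintype.sum_unique]
  simp

theorem numInvariantClasses_of_subsingleton {G : Type*} [Group G] [Subsingleton G]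
    (φ : MulAut G) : numInvariantClasses φ = 1 := by
  have hs : Subsingleton (ConjClasses G) := Quot.Subsingleton
  have hu : Nonempty {C : ConjClasses G // C.map φ.toMonoidHom = C} :=
    ⟨⟨ConjClasses.mk 1, Subsingleton.elim _ _⟩⟩
  exact Nat.card_eq_one_iff_unique.2 ⟨inferInstance, hu⟩

theorem proposition3p4 {F : Type*} [Field F] [Finite F] (hF : ringChar F ≠ 2) (σ : F ≃+* F)
    (δ : ∀ n : ℕ, MulAut (symplecticGroup (Fin n) F))
    (hδ : ∀ n : ℕ, 1 ≤ n → IsDiagonalAut (δ n) ∧ ¬ IsInnerAut (δ n)) :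
    HasProd
      (fun i : ℕ => (1 + (PowerSeries.X : PowerSeries ℤ) ^ (2 * (i + 1))) ^ 2 *
        PowerSeries.invOfUnit
          (1 - (Nat.card {x : F // σ x = x} : PowerSeries ℤ) * PowerSeries.X ^ (i + 1)) 1)
      (PowerSeries.mk fun n : ℕ => (numInvariantClasses (δ n * fieldAut n σ) : ℤ)) := by
  have h2 : (2 : F) ≠ 0 := by
    intro h
    apply hF
    have h1 : ringChar F ∣ 2 := (ringChar.spec F 2).1 (by exact_mod_cast h)
    exact ((Nat.dvd_prime Nat.prime_two).1 h1).resolve_left (CharP.ringChar_ne_one)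
  have h : ∀ n, numInvariantClasses (δ n * fieldAut n σ) = Nat.card (dataSet σ n) := by
    intro n
    cases n with
    -- Nothing is assumed about `δ 0`; the group is trivial, and both counts are 1.
    | zero =>
      have : Subsingleton (symplecticGroup (Fin 0) F) :=
        ⟨fun x y => Subtype.ext (Subsingleton.elim _ _)⟩
      rw [card_dataSet_zero, numInvariantClasses_of_subsingleton]
    | succ n =>
      obtain ⟨h3, h4⟩ := hδ (n + 1) (Nat.succ_pos n)
      exact numInvariantClasses_eq_card h2 h3 h4
  simp only [h]
  exact hasProd_card_dataSet h2 σ
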